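/- Setting. Let $\Bbbk$ be an algebraically closed field and let $\mathscr{C}$ be a fiat $2$-category over $\Bbbk$: a strict $2$-category with finitely many objects, whose categories $\mathscr{C}(\mathtt{i},\mathtt{j})$ are additive, idempotent complete and $\Bbbk$-linear with finite-dimensional morphism spaces and finitely many indecomposable objects up to isomorphism, with $\Bbbk$-bilinear horizontal composition and indecomposable identity $1$-morphisms $\mathbb{1}_{\mathtt{i}}$, together with a weak involution $F\mapsto F^*$ (an object-preserving anti-automorphism reversing $1$- and $2$-morphisms, with $F^{**}\cong F$) and, for every $F\in\mathscr{C}(\mathtt{i},\mathtt{j})$, $2$-morphisms $F\circ F^*\to\mathbb{1}_{\mathtt{j}}$ and $\mathbb{1}_{\mathtt{i}}\to F^*\circ F$ satisfying the triangle identities. Indecomposable $1$-morphisms are considered up to isomorphism, so $H=H^*$ means $H\cong H^*$. Cells. For indecomposable $F,G$ write $F\le_R G$, $F\le_L G$, $F\le_{LR}G$ if $G$ is a direct summand of some $H\circ F$, $F\circ H$, $H_2\circ F\circ H_1$, respectively; the equivalence classes of these preorders are the right, left and two-sided cells; $\mathcal{R}_F$, $\mathcal{L}_F$ are the right and left cell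 of $F$. A two-sided cell $\mathcal{Q}$ is strongly regular if different right cells in $\mathcal{Q}$ are not comparable for $\le_R$ and $|\mathcal{L}\cap\mathcal{R}|=1$ for all left cells $\mathcal{L}$ and right cells $\mathcal{R}$ in $\mathcal{Q}$. Fix a strongly regular two-sided cell $\mathcal{Q}$. Let $\mathscr{I}_{\mathcal{Q}}$ be the ideal of all $2$-morphisms factoring through direct sums of indecomposable $1$-morphisms $K\not\le_{LR}\mathcal{Q}$. Isomorphisms of $1$-morphisms below are isomorphisms in $\mathscr{C}/\mathscr{I}_{\mathcal{Q}}$; equivalently, they are isomorphisms in the full $2$-subcategory $\mathscr{C}_{\mathcal{Q}}$ of it generated by the identities and $\mathcal{Q}$. (If all indecomposable $1$-morphisms are $\le_{LR}\mathcal{Q}$, in particular if $\mathscr{C}=\mathscr{C}_{\mathcal{Q}}$, then $\mathscr{I}_{\mathcal{Q}}=0$ and they are isomorphisms in $\mathscr{C}$.) Cell $2$-representations. Let $\overline{\mathscr{C}}(\mathtt{i},\mathtt{j})$ be the category of diagrams $F\xrightarrow{\alpha}G$ in $\mathscr{C}(\mathtt{i},\mathtt{j})$ with morphisms the commutative squares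 modulo those whose component at the target of the diagrams factors through the target diagram; $1$-morphisms $H\in\mathscr{C}(\mathtt{j},\mathtt{k})$ act as functors $\overline{\mathscr{C}}(\mathtt{i},\mathtt{j})\to\overline{\mathscr{C}}(\mathtt{i},\mathtt{k})$ by composition. Let $P'_F=(0\to F)$ and, for $F$ indecomposable, let $L'_F$ be its simple quotient. For a right cell $\mathcal{R}\subset\mathcal{Q}$ of $1$-morphisms starting at $\mathtt{i}$, $G_{\mathcal{R}}$ is the element for which there is a subobject $K$ of $P'_{\mathbb{1}_{\mathtt{i}}}$ such that all simple subquotients of $P'_{\mathbb{1}_{\mathtt{i}}}/K$ are annihilated by all $F\in\mathcal{R}$, $K$ has simple top $L'_{G_{\mathcal{R}}}$, and $F\,L'_{G_{\mathcal{R}}}\ne0$ for all $F\in\mathcal{R}$. The cell $2$-representation $\mathbf{C}_{\mathcal{R}}$ has as $\mathbf{C}_{\mathcal{R}}(\mathtt{j})$ the full subcategory of $\overline{\mathscr{C}}(\mathtt{i},\mathtt{j})$ of all cokernels of morphisms between objects of the additive closure of the objects $P_F:=F\,L'_{G_{\mathcal{R}}}$, $F\in\mathcal{R}\cap\mathscr{C}(\mathtt{i},\mathtt{j})$,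 with the restricted action. For $F\in\mathcal{R}$ let $L_F$ be the simple quotient of $P_F$ in $\mathbf{C}_{\mathcal{R}}$. Statement. All $G_{\mathcal{R}}$ ($\mathcal{R}\subset\mathcal{Q}$) and $L_F$ ($F\in\mathcal{Q}$) exist. There are unique integers $m_{F,H}\ge0$, for $F,H\in\mathcal{Q}$ with the same target, such that for all such $F,H$: (a) $H^*\circ F\cong m_{F,H}\,G$ (a direct sum of $m_{F,H}$ copies), where $\{G\}=\mathcal{L}_{H^*}\cap\mathcal{R}_F$; moreover, $m_{F,F}\neq0$. Furthermore, for $F,H,G\in\mathcal{Q}$: (b) If $F\sim_R H$ (and $F$, $H$ have the same target), then $m_{F,H}=m_{H,F}$. (c) If $H=H^*$ and $F\sim_R H$, then $m_{F,F}=\dim\operatorname{End}(F\,L_H)=\dim\operatorname{End}(P_F)$. (d) If $H=H^*$ and $F\sim_R H$, then $F\circ H\cong m_{H,H}F$ and $H\circ F^*\cong m_{H,H}F^*$. (e) If $H=H^*$ and $H\sim_L F$, then $m_{H,H}=\dim\operatorname{Hom}(P_F,H\,L_F)$. (f) If $H=H^*$, $G=G^*$, $H\sim_L F$ and $G\sim_R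 F$, then $m_{F,F}\,m_{G,G}=m_{F^*,F^*}\,m_{H,H}$. Let $F\in\mathcal{Q}$ and $\mathcal{R}=\mathcal{R}_F$. Then in the cell $2$-representation $\mathbf{C}_{\mathcal{R}}$: (g) $P_F$ is injective; (h) $F^*\,L_F\cong P_{G_{\mathcal{R}}}$; (i) for every $H\in\mathcal{Q}$ whose source is the target of $F$, the object $H\,L_F$ is zero or both projective and injective. (j) If $F,H\in\mathcal{Q}$, $H=H^*$ and $F\sim_L H$, then $m_{F,F}$ divides $m_{H,H}$. -/

import Mathlib

open CategoryTheory CategoryTheory.Limits CategoryTheory.Bicategory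

noncomputable section

namespace Fiat

open scoped ZeroObject

attribute [local instance] hasBinaryBiproducts_of_finite_biproducts

universe w v u

/-! ### The abelianization of an additive category -/

section Freyd

variable (k : Type*) [Field k] {A : Type*} [Category A] [Preadditive A] [Linear k A]

/-- Objects of the abelianization of `A`: diagrams `left ⟶ right` in `A`. Such a diagram stands
for its cokernel. -/
structure Freyd (k : Type*) (A : Type*) [Category A] where
  /-- the source of the diagram -/
  left : A
  /-- the target of the diagram -/
  right : A
  /-- the diagram -/
  hom : left ⟶ right

namespace Freyd

variable {k}

/-- Commutative squares between two diagrams. -/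
def squares (X Y : Freyd k A) :
    Submodule k ((X.left ⟶ Y.left) × (X.right ⟶ Y.right)) where
  carrier := {p | X.hom ≫ p.2 = p.1 ≫ Y.hom}
  add_mem' {p q} hp hq := by
    simp only [Set.mem_ofPred_eq, Prod.fst_add, Prod.snd_add, Preadditive.comp_add,
      Preadditive.add_comp] at *
    rw [hp, hq]
  zero_mem' := by simp
  smul_mem' c p hp := by
    simp only [Set.mem_ofPred_eq, Prod.smul_fst, Prod.smul_snd, Linear.comp_smul,
      Linear.smul_comp] at *
    rw [hp]

/-- The squares which are homotopic to zero: the second component factors through `Y.hom`. -/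
def null (X Y : Freyd k A) : Submodule k (squares X Y) where
  carrier := {p | ∃ ξ : X.right ⟶ Y.left, ξ ≫ Y.hom = p.1.2}
  add_mem' := by
    rintro p q ⟨ξ, hξ⟩ ⟨η, hη⟩
    exact ⟨ξ + η, by simp [hξ, hη]⟩
  zero_mem' := ⟨0, by simp⟩
  smul_mem' := by
    rintro c p ⟨ξ, hξ⟩
    exact ⟨c • ξ, by simp [hξ]⟩

/-- Morphisms of the abelianization: commutative squares modulo null ones. -/
abbrev Mor (X Y : Freyd k A) := squares X Y ⧸ null X Y

/-- The morphism given by a commutative square. -/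
def ofSq {X Y : Freyd k A} (p : squares X Y) : Mor X Y := (null X Y).mkQ p

/-- The identity square. -/
def idSq (X : Freyd k A) : squares X X := ⟨(𝟙 _, 𝟙 _), by simp [squares]⟩

/-- Pasting of squares. -/
def compSq {X Y Z : Freyd k A} (p : squares X Y) (q : squares Y Z) : squares X Z :=
  ⟨(p.1.1 ≫ q.1.1, p.1.2 ≫ q.1.2), by
    have hp : X.hom ≫ p.1.2 = p.1.1 ≫ Y.hom := p.2
    have hq : Y.hom ≫ q.1.2 = q.1.1 ≫ Z.hom := q.2
    change X.hom ≫ p.1.2 ≫ q.1.2 = (p.1.1 ≫ q.1.1) ≫ Z.hom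
    rw [← Category.assoc, hp, Category.assoc, hq, Category.assoc]⟩

/-- Composition of morphisms, as a bilinear map. -/
def comp (X Y Z : Freyd k A) : Mor X Y →ₗ[k] Mor Y Z →ₗ[k] Mor X Z :=
  (null X Y).liftQ
    (LinearMap.flip ((null Y Z).liftQ
      (LinearMap.mk₂ k (fun (q : squares Y Z) (p : squares X Y) => ofSq (compSq p q))
        (fun q q' p => by
          rw [ofSq, ofSq, ofSq, ← map_add]; congr 1; ext <;> simp [compSq])
        (fun c q p => by
          rw [ofSq, ofSq, ← map_smul]; congr 1; ext <;> simp [compSq])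
        (fun q p p' => by
          rw [ofSq, ofSq, ofSq, ← map_add]; congr 1; ext <;> simp [compSq])
        (fun c q p => by
          rw [ofSq, ofSq, ← map_smul]; congr 1; ext <;> simp [compSq]))
      (by
        rintro q ⟨ξ, hξ⟩
        ext p
        refine (Submodule.Quotient.mk_eq_zero _).2 ⟨p.1.2 ≫ ξ, ?_⟩
        simp [compSq, hξ])))
    (by
      rintro p ⟨ξ, hξ⟩
      ext q
      refine (Submodule.Quotient.mk_eq_zero _).2 ⟨ξ ≫ q.1.1, ?_⟩
      have hq : Y.hom ≫ q.1.2 = q.1.1 ≫ Z.hom := q.2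
      change (ξ ≫ q.1.1) ≫ Z.hom = p.1.2 ≫ q.1.2
      rw [← hξ, Category.assoc, Category.assoc, hq])

theorem comp_ofSq {X Y Z : Freyd k A} (p : squares X Y) (q : squares Y Z) :
    comp X Y Z (ofSq p) (ofSq q) = ofSq (compSq p q) := rfl

theorem ofSq_surjective {X Y : Freyd k A} (f : Mor X Y) : ∃ p, ofSq p = f :=
  Submodule.mkQ_surjective _ f

theorem comp_add_left {X Y Z : Freyd k A} (f f' : Mor X Y) (g : Mor Y Z) :
    comp X Y Z (f + f') g = comp X Y Z f g + comp X Y Z f' g := by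
  rw [map_add]; rfl

theorem comp_smul_left {X Y Z : Freyd k A} (c : k) (f : Mor X Y) (g : Mor Y Z) :
    comp X Y Z (c • f) g = c • comp X Y Z f g := by
  rw [map_smul]; rfl

theorem comp_add_right {X Y Z : Freyd k A} (f : Mor X Y) (g g' : Mor Y Z) :
    comp X Y Z f (g + g') = comp X Y Z f g + comp X Y Z f g' := map_add _ g g'

theorem comp_smul_right {X Y Z : Freyd k A} (c : k) (f : Mor X Y) (g : Mor Y Z) :
    comp X Y Z f (c • g) = c • comp X Y Z f g := map_smul _ c g

instance : Category (Freyd k A) where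
  Hom X Y := Mor X Y
  id X := ofSq (idSq X)
  comp {X Y Z} f g := comp X Y Z f g
  id_comp {X Y} f := by
    obtain ⟨p, rfl⟩ := ofSq_surjective f
    rw [comp_ofSq]; congr 1; ext <;> simp [compSq, idSq]
  comp_id {X Y} f := by
    obtain ⟨p, rfl⟩ := ofSq_surjective f
    rw [comp_ofSq]; congr 1; ext <;> simp [compSq, idSq]
  assoc {X Y Z W} f g h := by
    obtain ⟨p, rfl⟩ := ofSq_surjective f
    obtain ⟨q, rfl⟩ := ofSq_surjective g
    obtain ⟨r, rfl⟩ := ofSq_surjective h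
    rw [comp_ofSq, comp_ofSq, comp_ofSq, comp_ofSq]; congr 1; ext <;> simp [compSq]

instance : Preadditive (Freyd k A) where
  homGroup X Y := inferInstanceAs (AddCommGroup (Mor X Y))
  add_comp _ _ _ f f' g := comp_add_left f f' g
  comp_add _ _ _ f g g' := comp_add_right f g g'

instance : Linear k (Freyd k A) where
  homModule X Y := inferInstanceAs (Module k (Mor X Y))
  smul_comp _ _ _ c f g := comp_smul_left c f g
  comp_smul _ _ _ f c g := comp_smul_right c f g

/-- The projective object `0 ⟶ F`. -/
def proj (k : Type*) [Field k] {A : Type*} [Category A] [Preadditive A] [Linear k A]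
    [HasFiniteBiproducts A] (F : A) : Freyd k A where
  left := 0
  right := F
  hom := 0

end Freyd

end Freyd

/-! ### Notions for modules -/

section Modules

variable {A : Type*} [Category A]

/-- `G` is a direct summand of `X`. -/
def IsSummand [HasZeroMorphisms A] [HasBinaryBiproducts A] (G X : A) : Prop :=
  ∃ Y : A, Nonempty (X ≅ G ⊞ Y)

/-- The direct sum of `n` copies of `G`. -/
abbrev copies [HasZeroMorphisms A] [HasFiniteBiproducts A] (n : ℕ) (G : A) : A :=
  ⨁ (fun _ : Fin n => G)

/-- `S` is a simple quotient of `X`. -/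
def IsSimpleQuotient [HasZeroMorphisms A] (S X : A) : Prop :=
  Simple S ∧ ∃ p : X ⟶ S, Epi p

/-- `S` is a subquotient of `X`. -/
def IsSubquotient (S X : A) : Prop :=
  ∃ (N : A) (f : N ⟶ X) (g : N ⟶ S), Mono f ∧ Epi g

/-- `X` has simple top `L`: every quotient map from `X` to a simple object agrees,
up to isomorphism, with one fixed such map `X ⟶ L`. -/
def HasSimpleTop [HasZeroMorphisms A] (X L : A) : Prop :=
  Simple L ∧ ∃ p : X ⟶ L, Epi p ∧
    ∀ (S : A) (q : X ⟶ S), Simple S → Epi q → ∃ e : L ≅ S, p ≫ e.hom = q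

/-- `add 𝒮`: direct summands of finite direct sums of objects from `𝒮`. -/
def InAdd [HasZeroMorphisms A] (𝒮 : Set A) (X : A) : Prop :=
  ∃ (n : ℕ) (Y : Fin n → A) (b : Bicone Y),
    (∀ a, Y a ∈ 𝒮) ∧ Nonempty b.IsBilimit ∧ Nonempty (Retract X b.pt)

end Modules

/-! ### Finitary and fiat 2-categories -/

variable (k : Type*) [Field k] (C : Type u) [Bicategory.{w, v} C]
  [∀ i j : C, Preadditive (i ⟶ j)] [∀ i j : C, Linear k (i ⟶ j)]
  [∀ i j : C, HasFiniteBiproducts (i ⟶ j)]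

/-- `k`-finitary (strict) 2-categories. Composition of `1`-morphisms in diagrammatic order:
`F ≫ H` is the composite usually written `H ∘ F`. -/
class IsFinitary : Prop where
  strict : Bicategory.Strict C
  finite_objects : Finite C
  idempotentComplete : ∀ i j : C, IsIdempotentComplete (i ⟶ j)
  finiteDimensional : ∀ {i j : C} (F G : i ⟶ j), FiniteDimensional k (F ⟶ G)
  finite_indecomposables : ∀ i j : C, ∃ s : Set (i ⟶ j), s.Finite ∧
    ∀ F : i ⟶ j, Indecomposable F → ∃ G ∈ s, Nonempty (F ≅ G)
  whiskerLeft_add : ∀ {i j l : C} (F : i ⟶ j) {G H : j ⟶ l} (α β : G ⟶ H),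
    F ◁ (α + β) = F ◁ α + F ◁ β
  whiskerLeft_smul : ∀ {i j l : C} (F : i ⟶ j) {G H : j ⟶ l} (c : k) (α : G ⟶ H),
    F ◁ (c • α) = c • (F ◁ α)
  add_whiskerRight : ∀ {i j l : C} {F G : i ⟶ j} (α β : F ⟶ G) (H : j ⟶ l),
    (α + β) ▷ H = α ▷ H + β ▷ H
  smul_whiskerRight : ∀ {i j l : C} {F G : i ⟶ j} (c : k) (α : F ⟶ G) (H : j ⟶ l),
    (c • α) ▷ H = c • (α ▷ H)
  indecomposable_id : ∀ i : C, Indecomposable (𝟙 i)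

/-- A weakly involutive, object-preserving anti-automorphism `*`, reversing both `1`-morphisms and
`2`-morphisms, and compatible with composition up to coherent isomorphism. -/
structure Involution (C : Type u) [Bicategory.{w, v} C] where
  /-- `F ↦ F^*` -/
  star {i j : C} (F : i ⟶ j) : j ⟶ i
  /-- the action on `2`-morphisms -/
  map {i j : C} {F G : i ⟶ j} (α : F ⟶ G) : star G ⟶ star F
  map_id {i j : C} (F : i ⟶ j) : map (𝟙 F) = 𝟙 (star F)
  map_comp {i j : C} {F G H : i ⟶ j} (α : F ⟶ G) (β : G ⟶ H) :
    map (α ≫ β) = map β ≫ map α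
  /-- `1^* ≅ 1` -/
  mapId (i : C) : star (𝟙 i) ≅ 𝟙 i
  /-- `(G ∘ F)^* ≅ F^* ∘ G^*` -/
  mapComp {i j l : C} (F : i ⟶ j) (G : j ⟶ l) : star (F ≫ G) ≅ star G ≫ star F
  mapComp_naturality_left {i j l : C} {F F' : i ⟶ j} (α : F ⟶ F') (G : j ⟶ l) :
    map (α ▷ G) ≫ (mapComp F G).hom = (mapComp F' G).hom ≫ star G ◁ map α
  mapComp_naturality_right {i j l : C} (F : i ⟶ j) {G G' : j ⟶ l} (β : G ⟶ G') :
    map (F ◁ β) ≫ (mapComp F G).hom = (mapComp F G').hom ≫ map β ▷ star F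
  map_associator {i j l m : C} (F : i ⟶ j) (G : j ⟶ l) (H : l ⟶ m) :
    map (α_ F G H).hom ≫ (mapComp (F ≫ G) H).hom ≫ star H ◁ (mapComp F G).hom =
      (mapComp F (G ≫ H)).hom ≫ (mapComp G H).hom ▷ star F ≫
        (α_ (star H) (star G) (star F)).hom
  map_leftUnitor {i j : C} (F : i ⟶ j) :
    map (λ_ F).hom ≫ (mapComp (𝟙 i) F).hom ≫ star F ◁ (mapId i).hom = (ρ_ (star F)).inv
  map_rightUnitor {i j : C} (F : i ⟶ j) :
    map (ρ_ F).hom ≫ (mapComp F (𝟙 j)).hom ≫ (mapId j).hom ▷ star F = (λ_ (star F)).inv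
  /-- `F^** ≅ F` -/
  starStar {i j : C} (F : i ⟶ j) : star (star F) ≅ F
  starStar_naturality {i j : C} {F G : i ⟶ j} (α : F ⟶ G) :
    map (map α) ≫ (starStar G).hom = (starStar F).hom ≫ α

/-- The fiat structure on a finitary 2-category: an involution with adjunctions, that is, with
`2`-morphisms `F ∘ F^* ⟶ 1` and `1 ⟶ F^* ∘ F` satisfying the triangle identities. -/
structure FiatStructure (C : Type u) [Bicategory.{w, v} C] extends Involution C where
  adjunction {i j : C} (F : i ⟶ j) : Nonempty (Bicategory.Adjunction F (star F))

/-! ### The action on the principal 2-representations -/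

section Action

variable {C}
variable [IsFinitary k C]

variable {k}

/-- Composition of a square with a `1`-morphism. -/
def whiskerSq {i j l : C} (F : j ⟶ l) {X Y : Freyd k (i ⟶ j)} :
    Freyd.squares X Y →ₗ[k] Freyd.squares
      (⟨X.left ≫ F, X.right ≫ F, X.hom ▷ F⟩ : Freyd k (i ⟶ l))
      ⟨Y.left ≫ F, Y.right ≫ F, Y.hom ▷ F⟩ where
  toFun p := ⟨(p.1.1 ▷ F, p.1.2 ▷ F), by
    have hp : X.hom ≫ p.1.2 = p.1.1 ≫ Y.hom := p.2
    change X.hom ▷ F ≫ p.1.2 ▷ F = p.1.1 ▷ F ≫ Y.hom ▷ F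
    rw [← comp_whiskerRight, hp, comp_whiskerRight]⟩
  map_add' p q := by
    ext <;> simp [IsFinitary.add_whiskerRight (k := k)]
  map_smul' c p := by
    ext <;> simp [IsFinitary.smul_whiskerRight (k := k)]

/-- The action of a `1`-morphism `F` from `j` to `l` on the `i`-th principal 2-representation:
the functor sending a diagram `α` to `F(α)`. -/
def act {i j l : C} (F : j ⟶ l) : Freyd k (i ⟶ j) ⥤ Freyd k (i ⟶ l) where
  obj X := ⟨X.left ≫ F, X.right ≫ F, X.hom ▷ F⟩
  map {X Y} f := Submodule.mapQ (Freyd.null X Y) (Freyd.null _ _) (whiskerSq F) (by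
    rintro p ⟨ξ, hξ⟩
    refine ⟨ξ ▷ F, ?_⟩
    change ξ ▷ F ≫ Y.hom ▷ F = p.1.2 ▷ F
    rw [← comp_whiskerRight, hξ]) f
  map_id X := by
    change Freyd.ofSq _ = Freyd.ofSq _
    congr 1; ext <;> simp [whiskerSq, Freyd.idSq]
  map_comp {X Y Z} f g := by
    obtain ⟨p, rfl⟩ := Freyd.ofSq_surjective f
    obtain ⟨q, rfl⟩ := Freyd.ofSq_surjective g
    change Freyd.ofSq _ = Freyd.ofSq _
    congr 1; ext <;> simp [whiskerSq, Freyd.compSq]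

end Action

/-! ### Cells -/

section Cells

variable {C}

/-- `F ≤_R G`: `G` is a direct summand of some `H ∘ F`. -/
def LeR {i j l : C} (F : i ⟶ j) (G : i ⟶ l) : Prop :=
  ∃ H : j ⟶ l, IsSummand G (F ≫ H)

/-- `F ≤_L G`: `G` is a direct summand of some `F ∘ H`. -/
def LeL {i j l : C} (F : i ⟶ j) (G : l ⟶ j) : Prop :=
  ∃ H : l ⟶ i, IsSummand G (H ≫ F)

/-- `F ≤_LR G`: `G` is a direct summand of some `H₂ ∘ F ∘ H₁`. -/
def LeLR {i j l m : C} (F : i ⟶ j) (G : l ⟶ m) : Prop :=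
  ∃ (H₁ : l ⟶ i) (H₂ : j ⟶ m), IsSummand G (H₁ ≫ F ≫ H₂)

/-- The right cell of `F`, closed under isomorphism; `F ∼_R G` means `G ∈ rightCell F`. -/
def rightCell {i j : C} (F : i ⟶ j) (l : C) : Set (i ⟶ l) :=
  {G | Indecomposable G ∧ LeR F G ∧ LeR G F}

/-- The left cell of `F`, closed under isomorphism; `F ∼_L G` means `G ∈ leftCell F`. -/
def leftCell {i j : C} (F : i ⟶ j) (l : C) : Set (l ⟶ j) :=
  {G | Indecomposable G ∧ LeL F G ∧ LeL G F}

/-- `Q` is a two-sided cell, viewed as a set of `1`-morphisms closed under isomorphism. -/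
def IsTwoSidedCell (Q : ∀ i j : C, Set (i ⟶ j)) : Prop :=
  ∃ (i j : C) (F : i ⟶ j), Indecomposable F ∧
    ∀ (l m : C) (G : l ⟶ m), G ∈ Q l m ↔ Indecomposable G ∧ LeLR F G ∧ LeLR G F

/-- Different right cells inside `Q` are not comparable, and every right cell and every left cell
inside `Q` have exactly one element in common, up to isomorphism. -/
structure IsStronglyRegular (Q : ∀ i j : C, Set (i ⟶ j)) : Prop where
  isTwoSidedCell : IsTwoSidedCell Q
  regular : ∀ {i j l : C} (F : i ⟶ j) (G : i ⟶ l), F ∈ Q i j → G ∈ Q i l → LeR F G → LeR G F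
  inter : ∀ {i j l m : C} (F : i ⟶ j) (G : l ⟶ m), F ∈ Q i j → G ∈ Q l m →
    ∃ K : i ⟶ m, (K ∈ rightCell F m ∧ K ∈ leftCell G i) ∧
      ∀ K' : i ⟶ m, K' ∈ rightCell F m → K' ∈ leftCell G i → Nonempty (K' ≅ K)

/-- The ideal `I_Q`: `2`-morphisms `f`, `g` are related if `f - g` factors through a direct sum
of indecomposable `1`-morphisms `K` with `K ≰_LR Q`. -/
def cellIdeal (Q : ∀ i j : C, Set (i ⟶ j)) (i j : C) : HomRel (i ⟶ j) :=
  fun X Y f g => ∃ (n : ℕ) (K : Fin n → (i ⟶ j)),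
    (∀ a, Indecomposable (K a) ∧ ∀ (l m : C) (F : l ⟶ m), F ∈ Q l m → ¬ LeLR (K a) F) ∧
    ∃ (s : X ⟶ ⨁ K) (t : ⨁ K ⟶ Y), f - g = s ≫ t

/-- `X` and `Y` become isomorphic in the quotient of the 2-category by the ideal `I_Q`. -/
def IsoMod (Q : ∀ i j : C, Set (i ⟶ j)) {i j : C} (X Y : i ⟶ j) : Prop :=
  Nonempty ((Quotient.functor (cellIdeal Q i j)).obj X ≅
    (Quotient.functor (cellIdeal Q i j)).obj Y)

end Cells

/-! ### Cell 2-representations -/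

section CellReps

variable {k C}
variable [IsFinitary k C]

/-- `G` is the element `G_R` attached to the right cell `R` (of `1`-morphisms starting at `i`)
and `L` is the simple object `L_G`: there is a submodule `K` of `P_{1_i}` such that every simple
subquotient of `P_{1_i} / K` is annihilated by all `F ∈ R`, while `K` has simple top `L`
and `F L ≠ 0` for all `F ∈ R`. -/
def IsCellGenerator {i : C} (R : ∀ l : C, Set (i ⟶ l)) (G : i ⟶ i) (L : Freyd k (i ⟶ i)) :
    Prop :=
  Indecomposable G ∧ IsSimpleQuotient L (Freyd.proj k G) ∧
  ∃ (K M : Freyd k (i ⟶ i)) (ι : K ⟶ Freyd.proj k (𝟙 i)) (π : Freyd.proj k (𝟙 i) ⟶ M)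
    (z : ι ≫ π = 0),
    Mono ι ∧ Nonempty (IsColimit (CokernelCofork.ofπ π z)) ∧
    (∀ S, Simple S → IsSubquotient S M → ∀ l, ∀ F ∈ R l, IsZero ((act F).obj S)) ∧
    HasSimpleTop K L ∧ ∀ l, ∀ F ∈ R l, ¬ IsZero ((act F).obj L)

/-- The category `C_R(j)` as a full subcategory of `P_i(j)`: all cokernels of morphisms between
objects in the additive closure of the `F L`, `F ∈ R`, where `L = L_{G_R}`. -/
def cellProp {i : C} (R : ∀ l : C, Set (i ⟶ l)) (L : Freyd k (i ⟶ i)) (j : C) :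
    ObjectProperty (Freyd k (i ⟶ j)) :=
  fun M => ∃ (X₁ X₀ : Freyd k (i ⟶ j)) (f : X₁ ⟶ X₀) (g : X₀ ⟶ M) (z : f ≫ g = 0),
    InAdd {Y | ∃ F ∈ R j, Y = (act F).obj L} X₁ ∧
    InAdd {Y | ∃ F ∈ R j, Y = (act F).obj L} X₀ ∧
    Nonempty (IsColimit (CokernelCofork.ofπ g z))

/-- The category `C_R(j)` of the cell 2-representation `C_R`. The action of a `1`-morphism `H`
on it is the restriction of `act H`. -/
abbrev CellRep {i : C} (R : ∀ l : C, Set (i ⟶ l)) (L : Freyd k (i ⟶ i)) (j : C) :=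
  (cellProp R L j).FullSubcategory

/-- `S` is the simple object `L_F` of `C_R(j)`: the simple quotient, in `C_R(j)`, of the
indecomposable projective `P_F = F L_{G_R}`. -/
def IsCellSimple {i j : C} (R : ∀ l : C, Set (i ⟶ l)) (L : Freyd k (i ⟶ i)) (F : i ⟶ j)
    (S : CellRep R L j) : Prop :=
  ∃ h : cellProp R L j ((act F).obj L), IsSimpleQuotient S ⟨(act F).obj L, h⟩

end CellReps

end Fiat

end

open CategoryTheory CategoryTheory.Limits CategoryTheory.Bicategory

noncomputable section

namespace Fiat

open scoped ZeroObject

attribute [local instance] hasBinaryBiproducts_of_finite_biproducts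

universe w v u

set_option linter.unusedSectionVars false

/-! ### Finite-dimensional algebras without idempotents -/

section Algebra

variable {k R : Type*} [Field k] [IsAlgClosed k] [Ring R] [Algebra k R] [FiniteDimensional k R]

/-! Modules are objects of the category of diagrams, which is abelian, and they are measured by M(X)
:= dim Hom(P'_X, M) (`Freyd.dimAt`). In a fiat 2-category F and F^* act as adjoints on both sides,
so all actions are exact and (F M)(X) = M(F^*∘X) (`dimAt_act`). Questions about modules thus become
questions about summands of composites.

Combinatorics of Q. Let K be the kernel of a largest quotient of P'_1 annihilated by the right cell
R. Then F K ≅ P'_F for F in R, and locality of End(P'_F) forces K to have a simple top, which gives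
G_R (`exists_isCellGenerator`). It follows that F is a summand of F∘G_R and G_R is a summand of
F^*∘F. Hence Q is stable under *, and G_R is the unique self-dual element of R. By strong regularity
every summand of H^*∘F that is not killed by the ideal lies in one left and one right cell of Q,
which is (a). The multiplicity is unique because Hom(P'_-, L'_G) counts it and vanishes on the ideal
(`isoMod_iff`). Applying * gives (b). Computing F^*∘F∘H and F∘F^*∘F in both bracketings gives (d)
and (f).

The cell 2-representation. Write L = L'_G with G = G_R, and P_X = X L. Adjunction gives dim Hom(P_X,
P_Y) = m_{X,Y} = P_Y(X), so maps P'_X → P_Y factor through P_X. Hence P_X is projective in C_R and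
Hom(P_X, M) has dimension M(X) for M in C_R. The central fact is the dual equality dim Hom(M, P_X) =
M(X) (`CellData.finrank_hom_eq`). The bound ≤ is reduced to X = G and simple M; the bound ≥ holds
because X^* M is generated by P_G, whose only simple quotient is L. Comparing the two equalities
along a monomorphism shows that P_X is injective, which is (g).

For M = L_X the equality gives dim Hom(X^* L_X, L) = 1, so X^* L_X is a quotient of P_G, and it has
the same dimension at G; this is (h). If H L_X ≠ 0, then H is a summand of H∘X∘X^*, so H L_X is a
summand of (H∘X) P_G, a sum of objects P_Y; this is (i). Parts (c) and (e) follow by adjunction. For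
(j), compute dim Hom(F P_G, L_F) twice, using F∘G ≅ m_{G,G} F and then P_G ≅ F^* L_F. Thus
m_{F^*,F^*} divides m_{G,G}, and (f) finishes the proof. -/

include k in
-- Fitting's lemma through the minimal polynomial. Write it as X^n q with q prime to X; a Bézout
-- identity turns the two factors into complementary idempotents of k[g], and these are trivial.
theorem isNilpotent_of_not_isUnit (h : ∀ e : R, e * e = e → e = 0 ∨ e = 1) {g : R}
    (hg : ¬ IsUnit g) : IsNilpotent g := by
  have hint : IsIntegral k g := Algebra.IsIntegral.isIntegral g
  have hm : minpoly k g ≠ 0 := minpoly.ne_zero hint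
  obtain ⟨q, hq, hq0⟩ := Polynomial.exists_eq_pow_rootMultiplicity_mul_and_not_dvd (minpoly k g) hm 0
  set n := (minpoly k g).rootMultiplicity 0
  rw [map_zero, sub_zero] at hq hq0
  have hcop : IsCoprime ((Polynomial.X : Polynomial k) ^ n) q :=
    ((Polynomial.irreducible_X.coprime_iff_not_dvd).2 hq0).pow_left
  obtain ⟨a, b, hab⟩ := hcop
  have hz : Polynomial.aeval g (Polynomial.X ^ n * q) = 0 := by rw [← hq, minpoly.aeval]
  have hab' : Polynomial.aeval g (a * Polynomial.X ^ n) + Polynomial.aeval g (b * q) = 1 := by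
    rw [← map_add, hab, map_one]
  have hprod : Polynomial.aeval g (a * Polynomial.X ^ n) * Polynomial.aeval g (b * q) = 0 := by
    rw [← map_mul, show a * Polynomial.X ^ n * (b * q) = (a * b) * (Polynomial.X ^ n * q) by ring,
      map_mul, hz, mul_zero]
  have hid : Polynomial.aeval g (a * Polynomial.X ^ n) * Polynomial.aeval g (a * Polynomial.X ^ n)
      = Polynomial.aeval g (a * Polynomial.X ^ n) := by
    have := congrArg (Polynomial.aeval g (a * Polynomial.X ^ n) * ·) hab'
    rwa [mul_add, hprod, add_zero, mul_one] at this
  rcases h _ hid with h0 | h1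
  · refine ⟨n, ?_⟩
    rw [h0, zero_add] at hab'
    have : Polynomial.aeval g ((Polynomial.X : Polynomial k) ^ n) * Polynomial.aeval g (b * q) = 0 := by
      rw [← map_mul, show (Polynomial.X : Polynomial k) ^ n * (b * q) = b * (Polynomial.X ^ n * q) by ring,
        map_mul, hz, mul_zero]
    rw [hab', mul_one, map_pow, Polynomial.aeval_X] at this
    exact this
  · exfalso
    -- For n = 0 the nonzero constant term of the minimal polynomial makes g invertible; for n > 0
    -- the relation a(g) g^n = 1 does.
    rcases Nat.eq_zero_or_pos n with hn | hn
    · apply hg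
      have hc : (minpoly k g).coeff 0 ≠ 0 := by
        intro h
        rw [← Polynomial.X_dvd_iff, hq, hn, pow_zero, one_mul] at h
        exact hq0 h
      obtain ⟨r, hr⟩ : Polynomial.X ∣ minpoly k g - Polynomial.C ((minpoly k g).coeff 0) := by
        rw [Polynomial.X_dvd_iff]; simp
      have h2 : g * Polynomial.aeval g r = - algebraMap k R ((minpoly k g).coeff 0) := by
        have := congrArg (Polynomial.aeval g) hr
        simpa using this.symm
      have h3 : Polynomial.aeval g r * g = - algebraMap k R ((minpoly k g).coeff 0) := by
        rw [← h2]
        have := congrArg (Polynomial.aeval g) (mul_comm r Polynomial.X)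
        simpa using this
      have hu : IsUnit (- algebraMap k R ((minpoly k g).coeff 0)) :=
        ((isUnit_iff_ne_zero.2 hc).map _).neg
      have hcomm : Commute g (Polynomial.aeval g r) := h2.trans h3.symm
      exact (hcomm.isUnit_mul_iff.1 (h2 ▸ hu)).1
    · apply hg
      have hcomm : Commute (Polynomial.aeval g a * g ^ (n - 1)) g := by
        have h1 : Commute (Polynomial.aeval g a) g := by
          have := congrArg (Polynomial.aeval g) (mul_comm a Polynomial.X)
          rw [map_mul, map_mul, Polynomial.aeval_X] at this
          exact this
        exact h1.mul_left ((Commute.refl g).pow_left _)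
      refine (hcomm.isUnit_mul_iff.1 ?_).2
      rw [mul_assoc, ← pow_succ, Nat.sub_add_cancel hn]
      simp only [map_mul, map_pow, Polynomial.aeval_X] at h1
      rw [h1]; exact isUnit_one

theorem exists_sub_algebraMap_isNilpotent [Nontrivial R] (h : ∀ e : R, e * e = e → e = 0 ∨ e = 1)
    (f : R) : ∃ c : k, IsNilpotent (f - algebraMap k R c) := by
  obtain ⟨c, hc⟩ := spectrum.nonempty_of_isAlgClosed_of_finiteDimensional k f
  refine ⟨c, isNilpotent_of_not_isUnit (k := k) h fun hu => hc ?_⟩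
  have := hu.neg
  rwa [neg_sub] at this

include k in
theorem isLocalRing_of_idempotents [Nontrivial R] (h : ∀ e : R, e * e = e → e = 0 ∨ e = 1) :
    IsLocalRing R := by
  refine IsLocalRing.of_isUnit_or_isUnit_one_sub_self fun f => ?_
  obtain hf | hf := em (IsUnit f)
  · exact Or.inl hf
  · exact Or.inr (isNilpotent_of_not_isUnit (k := k) h hf).isUnit_one_sub

theorem exists_isUnit_of_isUnit_sum {R : Type*} [Ring R] [IsLocalRing R] {ι : Type*}
    (s : Finset ι) (f : ι → R) (h : IsUnit (∑ a ∈ s, f a)) : ∃ a ∈ s, IsUnit (f a) := by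
  classical
  induction s using Finset.induction_on with
  | empty => simp at h
  | insert a s ha ih =>
    rw [Finset.sum_insert ha] at h
    rcases IsLocalRing.isUnit_or_isUnit_of_isUnit_add h with h | h
    · exact ⟨a, by simp, h⟩
    · obtain ⟨b, hb, hb'⟩ := ih h
      exact ⟨b, by simp [hb], hb'⟩

end Algebra

/-! ### Krull-Schmidt categories -/

/-- `k`-finitary categories: additive, idempotent complete, with finite-dimensional morphism
spaces and finitely many indecomposable objects. -/
class FinitaryCategory (k : Type*) [Field k] (A : Type*) [Category A] [Preadditive A] [Linear k A] :
    Prop where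
  idempotentComplete : IsIdempotentComplete A
  finiteDimensional : ∀ F G : A, FiniteDimensional k (F ⟶ G)
  hasFiniteBiproducts : HasFiniteBiproducts A
  finite_indecomposables : ∃ s : Set A, s.Finite ∧
    ∀ F : A, Indecomposable F → ∃ G ∈ s, Nonempty (F ≅ G)

section KrullSchmidt

variable {A : Type*} [Category A] [Preadditive A]

/-- The complement is obtained by splitting the complementary idempotent. Summands can then be
replaced by retracts, which are transported by every functor. -/
theorem isSummand_iff [HasBinaryBiproducts A] [IsIdempotentComplete A] {G X : A} :
    IsSummand G X ↔ Nonempty (Retract G X) := by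
  constructor
  · rintro ⟨Y, ⟨e⟩⟩
    exact ⟨⟨biprod.inl ≫ e.inv, e.hom ≫ biprod.fst, by simp⟩⟩
  · rintro ⟨r⟩
    obtain ⟨Y, i, p, h1, h2⟩ := IsIdempotentComplete.idempotents_split X (𝟙 X - r.r ≫ r.i)
      (by simp [Preadditive.comp_sub, Preadditive.sub_comp])
    have hi : i ≫ r.r = 0 := by
      have : i ≫ (𝟙 X - r.r ≫ r.i) = i := by rw [← h2, ← Category.assoc, h1, Category.id_comp]
      calc i ≫ r.r = (i ≫ (𝟙 X - r.r ≫ r.i)) ≫ r.r := by rw [this]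
        _ = 0 := by simp [Preadditive.sub_comp]
    have hp : r.i ≫ p = 0 := by
      have : (𝟙 X - r.r ≫ r.i) ≫ p = p := by rw [← h2, Category.assoc, h1, Category.comp_id]
      calc r.i ≫ p = r.i ≫ ((𝟙 X - r.r ≫ r.i) ≫ p) := by rw [this]
        _ = 0 := by simp [Preadditive.sub_comp]
    refine ⟨Y, ⟨⟨biprod.lift r.r p, biprod.desc r.i i, ?_, ?_⟩⟩⟩
    · rw [biprod.lift_desc, h2]; abel
    · ext <;> simp [hi, hp, h1]

theorem _root_.CategoryTheory.Indecomposable.idempotent [HasBinaryBiproducts A] [IsIdempotentComplete A] {F : A}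
    (hF : Indecomposable F) (e : F ⟶ F) (he : e ≫ e = e) : e = 0 ∨ e = 𝟙 F := by
  obtain ⟨Y, i, p, h1, h2⟩ := IsIdempotentComplete.idempotents_split F e he
  obtain ⟨Z, ⟨f⟩⟩ := isSummand_iff.2 ⟨(⟨i, p, h1⟩ : Retract Y F)⟩
  obtain ⟨Y', i', p', h1', h2'⟩ := IsIdempotentComplete.idempotents_split F (𝟙 F - e)
    (by simp [Preadditive.comp_sub, Preadditive.sub_comp, he])
  have hi : i ≫ p' = 0 := by
    have a1 : i ≫ e = i := by rw [← h2, ← Category.assoc, h1, Category.id_comp]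
    have a2 : (𝟙 F - e) ≫ p' = p' := by rw [← h2', Category.assoc, h1', Category.comp_id]
    rw [← a2, ← Category.assoc, Preadditive.comp_sub, a1]; simp
  have hi' : i' ≫ p = 0 := by
    have a1 : i' ≫ (𝟙 F - e) = i' := by rw [← h2', ← Category.assoc, h1', Category.id_comp]
    have a2 : e ≫ p = p := by rw [← h2, Category.assoc, h1, Category.comp_id]
    rw [← a1, ← a2, Category.assoc, ← Category.assoc (𝟙 F - e), Preadditive.sub_comp, he]; simp
  have iso : F ≅ Y ⊞ Y' := ⟨biprod.lift p p', biprod.desc i i', by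
    rw [biprod.lift_desc, h2, h2']; abel, by ext <;> simp [hi, hi', h1, h1']⟩
  rcases hF.2 _ _ iso with h | h
  · left; rw [← h2, h.eq_of_tgt p 0, zero_comp]
  · right
    have : 𝟙 F - e = 0 := by rw [← h2', h.eq_of_tgt p' 0, zero_comp]
    exact (sub_eq_zero.1 this).symm

variable (k : Type*) [Field k] [Linear k A]

section

variable [IsAlgClosed k] [HasBinaryBiproducts A] [FinitaryCategory k A]

include k in
theorem _root_.CategoryTheory.Indecomposable.isLocalRing {F : A} (hF : Indecomposable F) : IsLocalRing (End F) := by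
  have := FinitaryCategory.idempotentComplete k (A := A)
  have : FiniteDimensional k (End F) := FinitaryCategory.finiteDimensional F F
  have : Nontrivial (End F) := ⟨1, 0, fun h => hF.1 ((IsZero.iff_id_eq_zero _).2 h)⟩
  exact isLocalRing_of_idempotents (k := k) fun e he => hF.idempotent e he

include k in
theorem _root_.CategoryTheory.Indecomposable.exists_isIso_of_sum {F : A} (hF : Indecomposable F) {ι : Type*}
    (s : Finset ι) (f : ι → (F ⟶ F)) (h : ∑ a ∈ s, f a = 𝟙 F) : ∃ a ∈ s, IsIso (f a) := by
  have := hF.isLocalRing k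
  obtain ⟨a, ha, hu⟩ := exists_isUnit_of_isUnit_sum (R := End F) s f (by
    have h' : ∑ a ∈ s, (show End F from f a) = 1 := h
    exact h' ▸ isUnit_one)
  exact ⟨a, ha, (isUnit_iff_isIso (f a)).1 hu⟩

include k in
theorem _root_.CategoryTheory.Indecomposable.retract_of_sum {F : A} (hF : Indecomposable F) {ι : Type*} [Fintype ι]
    {X : ι → A} (f : ∀ a, F ⟶ X a) (g : ∀ a, X a ⟶ F) (h : ∑ a, f a ≫ g a = 𝟙 F) :
    ∃ a, Nonempty (Retract F (X a)) := by
  obtain ⟨a, -, ha⟩ := hF.exists_isIso_of_sum k _ _ h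
  exact ⟨a, ⟨⟨f a, g a ≫ inv (f a ≫ g a), by rw [← Category.assoc, IsIso.hom_inv_id]⟩⟩⟩

include k in
theorem _root_.CategoryTheory.Indecomposable.iso_of_retract {F G : A} (hF : Indecomposable F) (hG : Indecomposable G)
    (r : Retract F G) : Nonempty (F ≅ G) := by
  have := FinitaryCategory.idempotentComplete k (A := A)
  rcases hG.idempotent (r.r ≫ r.i) (by simp) with h | h
  · exfalso
    apply hF.1
    rw [IsZero.iff_id_eq_zero]
    calc 𝟙 F = r.i ≫ (r.r ≫ r.i) ≫ r.r := by simp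
      _ = 0 := by rw [h]; simp
  · exact ⟨⟨r.i, r.r, r.retract, h⟩⟩

include k in
theorem _root_.CategoryTheory.Indecomposable.scalar_or {F : A} (hF : Indecomposable F) (f : F ⟶ F) :
    ∃ c : k, ¬ IsIso (f - c • 𝟙 F) := by
  have := FinitaryCategory.idempotentComplete k (A := A)
  have : FiniteDimensional k (End F) := FinitaryCategory.finiteDimensional F F
  have : Nontrivial (End F) := ⟨1, 0, fun h => hF.1 ((IsZero.iff_id_eq_zero _).2 h)⟩
  obtain ⟨c, hc⟩ := exists_sub_algebraMap_isNilpotent (k := k) (R := End F)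
    (fun e he => hF.idempotent e he) f
  refine ⟨c, fun h => ?_⟩
  have hu := (isUnit_iff_isIso (f - c • 𝟙 F)).2 h
  rw [Algebra.algebraMap_eq_smul_one] at hc
  exact hc.not_isUnit hu

end

/-- `X` is the direct sum of the `E a`. -/
def IsDirectSum {ι : Type} [Fintype ι] (X : A) (E : ι → A) : Prop :=
  ∃ (s : ∀ a, E a ⟶ X) (p : ∀ a, X ⟶ E a), (∀ a, s a ≫ p a = 𝟙 _) ∧
    (∀ a b, a ≠ b → s a ≫ p b = 0) ∧ ∑ a, p a ≫ s a = 𝟙 X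

variable [HasFiniteBiproducts A]

/-- Induction on dim End(X): for a proper summand Y, the embedding f ↦ p ≫ f ≫ i of End(Y) into
End(X) misses the identity, so the dimension drops. -/
theorem exists_indecomposable_decomposition [FinitaryCategory k A] (X : A) :
    ∃ (ι : Type) (_ : Fintype ι) (E : ι → A), (∀ a, Indecomposable (E a)) ∧ IsDirectSum X E := by
  induction hn : Module.finrank k (X ⟶ X) using Nat.strong_induction_on generalizing X with
  | _ n ih =>
  by_cases hX : IsZero X
  · exact ⟨PEmpty, inferInstance, fun a => a.elim, fun a => a.elim, fun a => a.elim, fun a => a.elim,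
      fun a => a.elim, fun a => a.elim, hX.eq_of_src _ _⟩
  by_cases hI : Indecomposable X
  · exact ⟨PUnit, inferInstance, fun _ => X, fun _ => hI, fun _ => 𝟙 X, fun _ => 𝟙 X, by simp,
      fun a b h => absurd (Subsingleton.elim a b) h, by simp⟩
  have : ∃ Y Z : A, Nonempty (X ≅ Y ⊞ Z) ∧ ¬ IsZero Y ∧ ¬ IsZero Z := by
    by_contra hcon
    refine hI ⟨hX, fun Y Z e => ?_⟩
    by_contra h
    rw [not_or] at h
    exact hcon ⟨Y, Z, ⟨e⟩, h.1, h.2⟩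
  obtain ⟨Y, Z, ⟨e⟩, hY, hZ⟩ := this
  have key : ∀ (Y Z : A) (i : Y ⟶ X) (p : X ⟶ Y) (j : Z ⟶ X) (q : X ⟶ Z), i ≫ p = 𝟙 Y →
      j ≫ q = 𝟙 Z → j ≫ p = 0 → ¬ IsZero Z →
      Module.finrank k (Y ⟶ Y) < Module.finrank k (X ⟶ X) := by
    intro Y Z i p j q hip hjq hjp hZ
    have : FiniteDimensional k (X ⟶ X) := FinitaryCategory.finiteDimensional X X
    have : FiniteDimensional k (Y ⟶ Y) := FinitaryCategory.finiteDimensional Y Y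
    let φ : (Y ⟶ Y) →ₗ[k] (X ⟶ X) :=
      (Linear.leftComp k X p).comp (Linear.rightComp k Y i)
    have hφ : ∀ f, φ f = p ≫ f ≫ i := fun f => rfl
    have hinj : Function.Injective φ := by
      intro f g h
      have := congrArg (fun t => i ≫ t ≫ p) h
      simp only [hφ, Category.assoc, hip, Category.comp_id] at this
      simpa [← Category.assoc, hip] using this
    rw [← LinearMap.finrank_range_of_inj hinj]
    refine Submodule.finrank_lt fun htop => hZ ?_
    obtain ⟨f, hf⟩ : 𝟙 X ∈ LinearMap.range φ := by rw [htop]; trivial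
    rw [hφ] at hf
    rw [IsZero.iff_id_eq_zero, ← hjq]
    have := congrArg (fun t => j ≫ t ≫ q) hf
    simp only [Category.assoc, Category.id_comp] at this
    rw [← this, ← Category.assoc, hjp, zero_comp]
  obtain ⟨ι, _, E, hE, s, p, h1, h2, h3⟩ := ih _ (hn ▸ key Y Z (biprod.inl ≫ e.inv)
    (e.hom ≫ biprod.fst) (biprod.inr ≫ e.inv) (e.hom ≫ biprod.snd) (by simp) (by simp) (by simp) hZ)
    Y rfl
  obtain ⟨κ, _, E', hE', s', p', h1', h2', h3'⟩ := ih _ (hn ▸ key Z Y (biprod.inr ≫ e.inv)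
    (e.hom ≫ biprod.snd) (biprod.inl ≫ e.inv) (e.hom ≫ biprod.fst) (by simp) (by simp) (by simp) hY)
    Z rfl
  refine ⟨ι ⊕ κ, inferInstance, Sum.elim E E', ?_,
    Sum.rec (fun a => s a ≫ biprod.inl ≫ e.inv) (fun a => s' a ≫ biprod.inr ≫ e.inv),
    Sum.rec (fun a => e.hom ≫ biprod.fst ≫ p a) (fun a => e.hom ≫ biprod.snd ≫ p' a), ?_, ?_, ?_⟩
  · rintro (a | a)
    · exact hE a
    · exact hE' a
  · rintro (a | a)
    · simp [h1]
    · simp [h1']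
  · rintro (a | a) (b | b) hab
    · change (s a ≫ biprod.inl ≫ e.inv) ≫ e.hom ≫ biprod.fst ≫ p b = 0
      simpa using h2 a b (by simpa using hab)
    · change (s a ≫ biprod.inl ≫ e.inv) ≫ e.hom ≫ biprod.snd ≫ p' b = 0
      simp
    · change (s' a ≫ biprod.inr ≫ e.inv) ≫ e.hom ≫ biprod.fst ≫ p b = 0
      simp
    · change (s' a ≫ biprod.inr ≫ e.inv) ≫ e.hom ≫ biprod.snd ≫ p' b = 0
      simpa using h2' a b (by simpa using hab)
  · rw [Fintype.sum_sum_type]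
    have e1 : ∑ a, (e.hom ≫ biprod.fst ≫ p a) ≫ (s a ≫ biprod.inl ≫ e.inv) =
        e.hom ≫ (biprod.fst ≫ (∑ a, p a ≫ s a) ≫ biprod.inl) ≫ e.inv := by
      simp [Preadditive.comp_sum, Preadditive.sum_comp]
    have e2 : ∑ a, (e.hom ≫ biprod.snd ≫ p' a) ≫ (s' a ≫ biprod.inr ≫ e.inv) =
        e.hom ≫ (biprod.snd ≫ (∑ a, p' a ≫ s' a) ≫ biprod.inr) ≫ e.inv := by
      simp [Preadditive.comp_sum, Preadditive.sum_comp]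
    refine (congrArg₂ (· + ·) e1 e2).trans ?_
    rw [h3, h3', ← Preadditive.comp_add, ← Preadditive.add_comp]
    simp [biprod.total]

/-- `E` generates `A`: identities of all objects are sums of morphisms which factor through
`E`. -/
def IsAddGenerator (E : A) : Prop :=
  ∀ Z : A, ∃ (ι : Type) (_ : Fintype ι) (f : ι → (Z ⟶ E)) (g : ι → (E ⟶ Z)), ∑ a, f a ≫ g a = 𝟙 Z

/-- The sum of representatives of all indecomposables works. This is where the finiteness of their
number enters; it yields weak kernels and a finite length function. -/
theorem exists_isAddGenerator [FinitaryCategory k A] : ∃ E : A, IsAddGenerator E := by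
  obtain ⟨s, hs, h⟩ := FinitaryCategory.finite_indecomposables (k := k) (A := A)
  have := hs.to_subtype
  refine ⟨⨁ (fun a : s => (a : A)), fun Z => ?_⟩
  obtain ⟨ι, _, E, hE, i, p, h1, -, h3⟩ := exists_indecomposable_decomposition k Z
  choose G hG e using fun a => h (E a) (hE a)
  refine ⟨ι, inferInstance,
    fun a => p a ≫ (e a).some.hom ≫ biproduct.ι (fun a : s => (a : A)) ⟨G a, hG a⟩,
    fun a => biproduct.π (fun a : s => (a : A)) ⟨G a, hG a⟩ ≫ (e a).some.inv ≫ i a, ?_⟩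
  rw [← h3]
  refine Finset.sum_congr rfl fun a _ => ?_
  simp

end KrullSchmidt

/-! ### The abelianization is abelian -/

namespace Freyd

section Basic

variable {k : Type*} [Field k] {A : Type*} [Category A] [Preadditive A] [Linear k A]

/-- The morphism given by a commutative square. -/
def mkHom {X Y : Freyd k A} (a : X.left ⟶ Y.left) (b : X.right ⟶ Y.right)
    (h : X.hom ≫ b = a ≫ Y.hom) : X ⟶ Y :=
  ofSq ⟨(a, b), h⟩

theorem exists_mkHom {X Y : Freyd k A} (f : X ⟶ Y) :
    ∃ (a : X.left ⟶ Y.left) (b : X.right ⟶ Y.right) (h : X.hom ≫ b = a ≫ Y.hom),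
      f = mkHom a b h := by
  obtain ⟨⟨⟨a, b⟩, h⟩, rfl⟩ := ofSq_surjective f
  exact ⟨a, b, h, rfl⟩

theorem mkHom_eq_zero_iff {X Y : Freyd k A} {a : X.left ⟶ Y.left} {b : X.right ⟶ Y.right}
    {h : X.hom ≫ b = a ≫ Y.hom} :
    mkHom a b h = 0 ↔ ∃ ξ : X.right ⟶ Y.left, ξ ≫ Y.hom = b :=
  Submodule.Quotient.mk_eq_zero _

theorem mkHom_eq_iff {X Y : Freyd k A} {a a' : X.left ⟶ Y.left} {b b' : X.right ⟶ Y.right}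
    {h : X.hom ≫ b = a ≫ Y.hom} {h' : X.hom ≫ b' = a' ≫ Y.hom} :
    mkHom a b h = mkHom a' b' h' ↔ ∃ ξ : X.right ⟶ Y.left, ξ ≫ Y.hom = b - b' :=
  (Submodule.Quotient.eq _).trans Iff.rfl

theorem mkHom_ext {X Y : Freyd k A} {a a' : X.left ⟶ Y.left} {b b' : X.right ⟶ Y.right}
    {h : X.hom ≫ b = a ≫ Y.hom} {h' : X.hom ≫ b' = a' ≫ Y.hom} (hb : b = b') :
    mkHom a b h = mkHom a' b' h' :=
  mkHom_eq_iff.2 ⟨0, by simp [hb]⟩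

theorem mkHom_id (X : Freyd k A) : mkHom (𝟙 X.left) (𝟙 X.right) (by simp) = 𝟙 X := rfl

theorem mkHom_comp {X Y Z : Freyd k A} {a : X.left ⟶ Y.left} {b : X.right ⟶ Y.right}
    {h : X.hom ≫ b = a ≫ Y.hom} {a' : Y.left ⟶ Z.left} {b' : Y.right ⟶ Z.right}
    {h' : Y.hom ≫ b' = a' ≫ Z.hom} :
    mkHom a b h ≫ mkHom a' b' h' = mkHom (a ≫ a') (b ≫ b') (by
      rw [← Category.assoc, h, Category.assoc, h', Category.assoc]) := rfl

theorem mkHom_add {X Y : Freyd k A} {a a' : X.left ⟶ Y.left} {b b' : X.right ⟶ Y.right}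
    {h : X.hom ≫ b = a ≫ Y.hom} {h' : X.hom ≫ b' = a' ≫ Y.hom} :
    mkHom a b h + mkHom a' b' h' = mkHom (a + a') (b + b') (by simp [h, h']) := rfl

theorem mkHom_smul {X Y : Freyd k A} (c : k) {a : X.left ⟶ Y.left} {b : X.right ⟶ Y.right}
    {h : X.hom ≫ b = a ≫ Y.hom} :
    c • mkHom a b h = mkHom (c • a) (c • b) (by simp [h]) := rfl

variable [HasFiniteBiproducts A]

/-- `X ↦ (0 ⟶ X)` as a functor. -/
def projF (k : Type*) [Field k] (A : Type*) [Category A] [Preadditive A] [Linear k A]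
    [HasFiniteBiproducts A] : A ⥤ Freyd k A where
  obj X := proj k X
  map f := mkHom (X := proj k _) (Y := proj k _) 0 f
    ((isZero_zero A).eq_of_src _ _)
  map_id _ := by rw [← mkHom_id]; exact mkHom_ext rfl
  map_comp {X Y Z} f g := by
    have h : ∀ {X Y : A} (f : X ⟶ Y), (proj k X).hom ≫ f = (0 : (0 : A) ⟶ 0) ≫ (proj k Y).hom :=
      fun f => (isZero_zero A).eq_of_src _ _
    exact (mkHom_ext rfl).trans (mkHom_comp (X := proj k X) (Y := proj k Y) (Z := proj k Z)
      (h := h f) (h' := h g)).symm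

/-- The morphism from a projective object given by a morphism to the target of the diagram. -/
def fromProj {X : A} {M : Freyd k A} (f : X ⟶ M.right) : (projF k A).obj X ⟶ M :=
  mkHom (X := proj k X) 0 f (((isZero_zero A).eq_of_src _ _))

theorem fromProj_surjective {X : A} {M : Freyd k A} (g : (projF k A).obj X ⟶ M) :
    ∃ f : X ⟶ M.right, fromProj f = g := by
  obtain ⟨a, b, h, rfl⟩ := exists_mkHom g
  exact ⟨b, mkHom_ext rfl⟩

theorem fromProj_eq_zero_iff {X : A} {M : Freyd k A} (f : X ⟶ M.right) :
    fromProj f = (0 : (projF k A).obj X ⟶ M) ↔ ∃ ξ : X ⟶ M.left, ξ ≫ M.hom = f :=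
  mkHom_eq_zero_iff

theorem fromProj_comp {X : A} {M N : Freyd k A} (f : X ⟶ M.right) (a : M.left ⟶ N.left)
    (b : M.right ⟶ N.right) (h : M.hom ≫ b = a ≫ N.hom) :
    fromProj f ≫ mkHom a b h = fromProj (f ≫ b) :=
  mkHom_ext rfl

theorem projF_map_comp_fromProj {X Y : A} {M : Freyd k A} (f : X ⟶ Y) (g : Y ⟶ M.right) :
    (projF k A).map f ≫ fromProj (M := M) g = fromProj (f ≫ g) :=
  mkHom_ext rfl

instance : (projF k A).Full where
  map_surjective g := by
    obtain ⟨f, rfl⟩ := fromProj_surjective g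
    exact ⟨f, rfl⟩

instance : (projF k A).Faithful where
  map_injective {X Y f g} h := by
    obtain ⟨ξ, hξ⟩ := mkHom_eq_iff.1 h
    exact (sub_eq_zero.1 (hξ.symm.trans (comp_zero (X := X) (Y := 0) (Z := Y) (f := ξ))))

instance : (projF k A).Additive where
  map_add {X Y _ _} := (mkHom_ext rfl).trans
    (mkHom_add (X := proj k X) (Y := proj k Y) (h := (isZero_zero A).eq_of_src _ _)
      (h' := (isZero_zero A).eq_of_src _ _)).symm

instance : (projF k A).Linear k where
  map_smul {X Y} _ c := (mkHom_ext rfl).trans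
    (mkHom_smul (X := proj k X) (Y := proj k Y) c (h := (isZero_zero A).eq_of_src _ _)).symm

/-- The projective presentation of `M`. -/
def cover (M : Freyd k A) : (projF k A).obj M.right ⟶ M := fromProj (𝟙 M.right)

theorem projF_map_comp_cover {X : A} {M : Freyd k A} (f : X ⟶ M.right) :
    (projF k A).map f ≫ cover M = fromProj f := by
  rw [cover, projF_map_comp_fromProj, Category.comp_id]

theorem cover_comp_mkHom {M N : Freyd k A} (a : M.left ⟶ N.left)
    (b : M.right ⟶ N.right) (h : M.hom ≫ b = a ≫ N.hom) :
    cover M ≫ mkHom a b h = fromProj b := by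
  rw [cover, fromProj_comp, Category.id_comp]

theorem projF_map_hom_comp_cover (M : Freyd k A) : (projF k A).map M.hom ≫ cover M = 0 := by
  rw [projF_map_comp_cover, fromProj_eq_zero_iff]
  exact ⟨𝟙 _, Category.id_comp _⟩

instance (M : Freyd k A) : Epi (cover M) :=
  Preadditive.epi_of_cancel_zero _ fun {N} g hg => by
    obtain ⟨a, b, h, rfl⟩ := exists_mkHom g
    rw [cover_comp_mkHom, fromProj_eq_zero_iff] at hg
    exact mkHom_eq_zero_iff.2 hg

theorem exists_desc {M N : Freyd k A} (g : (projF k A).obj M.right ⟶ N)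
    (hg : (projF k A).map M.hom ≫ g = 0) : ∃ h : M ⟶ N, cover M ≫ h = g := by
  obtain ⟨x, rfl⟩ := fromProj_surjective g
  rw [projF_map_comp_fromProj, fromProj_eq_zero_iff] at hg
  obtain ⟨ξ, hξ⟩ := hg
  exact ⟨mkHom ξ x hξ.symm, cover_comp_mkHom _ _ _⟩

theorem hom_ext {M N : Freyd k A} {f g : M ⟶ N}
    (h : ∀ (X : A) (x : (projF k A).obj X ⟶ M), x ≫ f = x ≫ g) : f = g := by
  rw [← cancel_epi (cover M)]
  exact h _ _

theorem mono_of_proj {M N : Freyd k A} (f : M ⟶ N)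
    (h : ∀ (X : A) (x : (projF k A).obj X ⟶ M), x ≫ f = 0 → x = 0) : Mono f :=
  Preadditive.mono_of_cancel_zero _ fun {Z} g hg => hom_ext fun X x => by
    rw [comp_zero]
    exact h _ _ (by rw [Category.assoc, hg, comp_zero])

/-- The cokernel of M ⟶ N is presented by adding the generators of M to the relations of N. The last
clause is exactness at N tested on projectives; applied to an epimorphism it gives the projectivity
of `projF`. -/
theorem exists_cokernel {M N : Freyd k A} (f : M ⟶ N) :
    ∃ (C : Freyd k A) (q : N ⟶ C), f ≫ q = 0 ∧ Epi q ∧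
      (∀ {Z : Freyd k A} (g : N ⟶ Z), f ≫ g = 0 → ∃ h : C ⟶ Z, q ≫ h = g) ∧
      ∀ (Z : A) (z : (projF k A).obj Z ⟶ N), z ≫ q = 0 → ∃ t : (projF k A).obj Z ⟶ M, t ≫ f = z := by
  obtain ⟨y, hy⟩ := fromProj_surjective (cover M ≫ f)
  let C : Freyd k A := ⟨N.left ⊞ M.right, N.right, biprod.desc N.hom y⟩
  let q : N ⟶ C := mkHom (biprod.inl) (𝟙 _) (by simp [C])
  have hq : cover N ≫ q = cover C := cover_comp_mkHom _ _ _
  have hqx : ∀ {Z : A} (z : Z ⟶ N.right),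
      fromProj (M := N) z ≫ q = fromProj (k := k) (M := C) z := fun z => by
    rw [← projF_map_comp_cover, Category.assoc, hq]
    exact projF_map_comp_cover (M := C) z
  refine ⟨C, q, ?_, ?_, ?_, ?_⟩
  · rw [← cancel_epi (cover M), ← Category.assoc, ← hy, hqx, comp_zero, fromProj_eq_zero_iff]
    exact ⟨biprod.inr, by simp [C]⟩
  · exact epi_of_epi_fac hq
  · intro Z g hg
    obtain ⟨h, hh⟩ := exists_desc (M := C) (cover N ≫ g) (by
      have e : C.hom = biprod.fst ≫ N.hom + biprod.snd ≫ y := by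
        ext <;> simp [C]
      rw [e, Functor.map_add, Preadditive.add_comp, Functor.map_comp, Functor.map_comp,
        Category.assoc, Category.assoc, ← Category.assoc ((projF k A).map N.hom),
        projF_map_hom_comp_cover, zero_comp, comp_zero, zero_add,
        ← Category.assoc ((projF k A).map y), projF_map_comp_cover, hy, Category.assoc, hg,
        comp_zero, comp_zero])
    refine ⟨h, ?_⟩
    rw [← cancel_epi (cover N), ← Category.assoc, hq, hh]
  · intro Z z hz
    obtain ⟨z, rfl⟩ := fromProj_surjective z
    rw [hqx, fromProj_eq_zero_iff] at hz
    obtain ⟨ξ, hξ⟩ := hz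
    refine ⟨(projF k A).map (ξ ≫ biprod.snd) ≫ cover M, ?_⟩
    rw [Category.assoc, ← hy, projF_map_comp_fromProj, ← sub_eq_zero,
      ← projF_map_comp_cover, ← projF_map_comp_cover, ← Preadditive.sub_comp, ← Functor.map_sub,
      projF_map_comp_cover, fromProj_eq_zero_iff]
    refine ⟨- (ξ ≫ biprod.fst), ?_⟩
    rw [← hξ]
    have e : C.hom = biprod.fst ≫ N.hom + biprod.snd ≫ y := by
      ext <;> simp [C]
    rw [e]
    simp

theorem proj_lift {X : A} {M N : Freyd k A} (f : M ⟶ N) [Epi f] (x : (projF k A).obj X ⟶ N) :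
    ∃ y : (projF k A).obj X ⟶ M, y ≫ f = x := by
  obtain ⟨C, q, hq, -, -, h⟩ := exists_cokernel f
  apply h
  rw [(cancel_epi f).1 (hq.trans comp_zero.symm), comp_zero]

instance proj_projective (X : A) : Projective ((projF k A).obj X) where
  factors x e _ := proj_lift e x

instance (X : A) : Projective ((projF k A).obj X) := proj_projective X

end Basic

section Abelian

variable {k : Type*} [Field k] {A : Type*} [Category A] [Preadditive A] [Linear k A]
  [HasFiniteBiproducts A]

instance homFiniteDimensional [FinitaryCategory k A] (M N : Freyd k A) :
    FiniteDimensional k (M ⟶ N) := by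
  have : FiniteDimensional k (M.left ⟶ N.left) := FinitaryCategory.finiteDimensional _ _
  have : FiniteDimensional k (M.right ⟶ N.right) := FinitaryCategory.finiteDimensional _ _
  exact inferInstanceAs (FiniteDimensional k (squares M N ⧸ null M N))

variable [FinitaryCategory k A]

/-- A basis of the finite-dimensional space of maps from the additive generator E to M killed by f
assembles to one map from a power of E, through which all maps from projectives killed by f factor.
-/
theorem exists_weakKernel {M N : Freyd k A} (f : M ⟶ N) :
    ∃ (W : A) (w : (projF k A).obj W ⟶ M), w ≫ f = 0 ∧
      ∀ (Z : A) (z : (projF k A).obj Z ⟶ M), z ≫ f = 0 → ∃ t : (projF k A).obj Z ⟶ (projF k A).obj W, t ≫ w = z := by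
  obtain ⟨E, hE⟩ := exists_isAddGenerator (A := A) k
  let V := LinearMap.ker (Linear.rightComp k ((projF k A).obj E) f)
  let b := Module.finBasis k V
  let w : (projF k A).obj (⨁ fun _ : Fin (Module.finrank k V) => E) ⟶ M :=
    ∑ a, (projF k A).map (biproduct.π (fun _ => E) a) ≫ (b a : (projF k A).obj E ⟶ M)
  have hw : ∀ a, (projF k A).map (biproduct.ι (fun _ => E) a) ≫ w = b a := by
    intro a
    simp only [w, Preadditive.comp_sum]
    rw [Finset.sum_eq_single a]
    · rw [← Category.assoc, ← Functor.map_comp, biproduct.ι_π_self, CategoryTheory.Functor.map_id]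
      rw [Category.id_comp]
    · intro c _ hc
      rw [← Category.assoc, ← Functor.map_comp, biproduct.ι_π_ne _ (Ne.symm hc), Functor.map_zero,
        zero_comp]
    · simp
  have hV : ∀ v : (projF k A).obj E ⟶ M, v ≫ f = 0 → ∃ t : (projF k A).obj E ⟶ _, t ≫ w = v := by
    intro v hv
    refine ⟨∑ a, b.repr ⟨v, hv⟩ a • (projF k A).map (biproduct.ι (fun _ => E) a), ?_⟩
    simp only [Preadditive.sum_comp, Linear.smul_comp, hw]
    have := congrArg Subtype.val (b.sum_repr ⟨v, hv⟩)
    rw [Submodule.coe_sum] at this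
    exact this
  refine ⟨_, w, ?_, fun Z z hz => ?_⟩
  · simp only [w, Preadditive.sum_comp, Category.assoc]
    refine Finset.sum_eq_zero fun a _ => ?_
    have : (b a : (projF k A).obj E ⟶ M) ≫ f = 0 := (b a).2
    rw [this, comp_zero]
  · obtain ⟨ι, _, p, s, h⟩ := hE Z
    choose t ht using fun a => hV ((projF k A).map (s a) ≫ z) (by rw [Category.assoc, hz, comp_zero])
    refine ⟨∑ a, (projF k A).map (p a) ≫ t a, ?_⟩
    simp only [Preadditive.sum_comp, Category.assoc, ht]
    simp only [← Category.assoc, ← Functor.map_comp]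
    rw [← Preadditive.sum_comp, ← Functor.map_sum, h, CategoryTheory.Functor.map_id]
    rw [Category.id_comp]

/-- Two successive weak kernels, of f and then of the resulting map w, form a presentation of the
kernel. -/
theorem exists_kernel {M N : Freyd k A} (f : M ⟶ N) :
    ∃ (K : Freyd k A) (i : K ⟶ M), i ≫ f = 0 ∧ Mono i ∧
      (∀ {Z : Freyd k A} (g : Z ⟶ M), g ≫ f = 0 → ∃ h : Z ⟶ K, h ≫ i = g) := by
  obtain ⟨W, w, hw, hW⟩ := exists_weakKernel f
  obtain ⟨V, v, hv, hV⟩ := exists_weakKernel w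
  obtain ⟨v, rfl⟩ := (projF k A).map_surjective v
  let K : Freyd k A := ⟨V, W, v⟩
  obtain ⟨i, hi⟩ := exists_desc (M := K) w hv
  refine ⟨K, i, ?_, ?_, ?_⟩
  · rw [← cancel_epi (cover K), ← Category.assoc, hi, hw, comp_zero]
  · refine mono_of_proj _ fun X x hx => ?_
    obtain ⟨y, rfl⟩ := proj_lift (cover K) x
    rw [Category.assoc, hi] at hx
    obtain ⟨t, rfl⟩ := hV _ _ hx
    have : (projF k A).map v ≫ cover K = 0 := projF_map_hom_comp_cover K
    rw [Category.assoc, this, comp_zero]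
  · intro Z g hg
    obtain ⟨t, ht⟩ := hW _ (cover Z ≫ g) (by rw [Category.assoc, hg, comp_zero])
    obtain ⟨s, hs⟩ := hV _ ((projF k A).map Z.hom ≫ t) (by
      rw [Category.assoc, ht, ← Category.assoc, projF_map_hom_comp_cover, zero_comp])
    obtain ⟨h, hh⟩ := exists_desc (M := Z) (t ≫ cover K) (by
      have : (projF k A).map v ≫ cover K = 0 := projF_map_hom_comp_cover K
      rw [← Category.assoc, ← hs, Category.assoc, this, comp_zero])
    refine ⟨h, ?_⟩
    rw [← cancel_epi (cover Z), ← Category.assoc, hh, Category.assoc, hi, ht]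

instance : HasZeroObject (Freyd k A) :=
  ⟨⟨0, 0, 0⟩, (IsZero.iff_id_eq_zero _).2 (mkHom_eq_zero_iff |>.2 ⟨0, by
    exact (isZero_zero A).eq_of_src _ _⟩)⟩

instance : HasBinaryBiproducts (Freyd k A) where
  has_binary_biproduct M N := by
    let B : Freyd k A := ⟨M.left ⊞ N.left, M.right ⊞ N.right, biprod.map M.hom N.hom⟩
    let b : BinaryBicone M N :=
      { pt := B
        fst := mkHom (biprod.fst) (biprod.fst) (by simp [B])
        snd := mkHom (biprod.snd) (biprod.snd) (by simp [B])
        inl := mkHom (biprod.inl) (biprod.inl) (by simp [B])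
        inr := mkHom (biprod.inr) (biprod.inr) (by simp [B])
        inl_fst := mkHom_ext (by simp [B])
        inl_snd := mkHom_eq_zero_iff.2 ⟨0, by simp [B]⟩
        inr_fst := mkHom_eq_zero_iff.2 ⟨0, by simp [B]⟩
        inr_snd := mkHom_ext (by simp [B]) }
    refine HasBinaryBiproduct.mk ⟨b, isBinaryBilimitOfTotal _ ?_⟩
    refine mkHom_eq_iff.2 ⟨0, ?_⟩
    change _ = (biprod.fst ≫ biprod.inl + biprod.snd ≫ biprod.inr) - 𝟙 (M.right ⊞ N.right)
    rw [biprod.total]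
    simp

instance : HasFiniteProducts (Freyd k A) := hasFiniteProducts_of_has_binary_and_terminal

instance : HasKernels (Freyd k A) where
  has_limit f := by
    obtain ⟨K, i, h0, hm, h⟩ := exists_kernel f
    exact ⟨⟨⟨_, KernelFork.IsLimit.ofι' i h0 fun g hg => ⟨_, (h g hg).choose_spec⟩⟩⟩⟩

instance : HasCokernels (Freyd k A) where
  has_colimit f := by
    obtain ⟨C, q, h0, he, h, -⟩ := exists_cokernel f
    exact ⟨⟨⟨_, CokernelCofork.IsColimit.ofπ' q h0 fun g hg => ⟨_, (h g hg).choose_spec⟩⟩⟩⟩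

instance : IsNormalMonoCategory (Freyd k A) where
  normalMonoOfMono {M N} f _ := by
    obtain ⟨C, q, h0, he, -, h⟩ := exists_cokernel f
    have key : ∀ {Z : Freyd k A} (g : Z ⟶ N), g ≫ q = 0 → ∃ l : Z ⟶ M, l ≫ f = g := by
      intro Z g hg
      obtain ⟨t, ht⟩ := h _ (cover Z ≫ g) (by rw [Category.assoc, hg, comp_zero])
      obtain ⟨l, hl⟩ := exists_desc (M := Z) t (by
        rw [← cancel_mono f, Category.assoc, ht, ← Category.assoc, projF_map_hom_comp_cover,
          zero_comp, zero_comp])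
      exact ⟨l, by rw [← cancel_epi (cover Z), ← Category.assoc, hl, ht]⟩
    exact ⟨⟨C, q, h0, KernelFork.IsLimit.ofι' f h0 fun g hg => ⟨_, (key g hg).choose_spec⟩⟩⟩

instance : IsNormalEpiCategory (Freyd k A) where
  normalEpiOfEpi {M N} f _ := by
    obtain ⟨K, i, h0, hm, h⟩ := exists_kernel f
    have key : ∀ {Z : Freyd k A} (g : M ⟶ Z), i ≫ g = 0 → ∃ l : N ⟶ Z, f ≫ l = g := by
      intro Z g hg
      have hk : ∀ {X : A} (x : (projF k A).obj X ⟶ M), x ≫ f = 0 → x ≫ g = 0 := by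
        intro X x hx
        obtain ⟨y, rfl⟩ := h x hx
        rw [Category.assoc, hg, comp_zero]
      obtain ⟨y, hy⟩ := proj_lift f (cover N)
      obtain ⟨l, hl⟩ := exists_desc (M := N) (y ≫ g) (by
        rw [← Category.assoc]
        exact hk (X := N.left) _ (by
          rw [Category.assoc, hy]; exact projF_map_hom_comp_cover N))
      refine ⟨l, hom_ext fun X x => ?_⟩
      obtain ⟨z, hz⟩ := proj_lift (cover N) (x ≫ f)
      rw [← Category.assoc, ← hz, Category.assoc, hl, ← sub_eq_zero, ← Category.assoc,
        ← Preadditive.sub_comp]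
      exact hk _ (by rw [Preadditive.sub_comp, Category.assoc, hy, hz, sub_self])
    exact ⟨⟨K, i, h0, CokernelCofork.IsColimit.ofπ' f h0 fun g hg => ⟨_, (key g hg).choose_spec⟩⟩⟩

instance instAbelian : Abelian (Freyd k A) where

end Abelian

end Freyd

/-! ### Dimensions of morphism spaces -/

section Linear

variable {k : Type*} [Field k]

theorem finrank_eq_add_of_exact {U V W : Type*} [AddCommGroup U] [Module k U] [AddCommGroup V]
    [Module k V] [AddCommGroup W] [Module k W] [FiniteDimensional k V]
    (φ : U →ₗ[k] V) (ψ : V →ₗ[k] W)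
    (hφ : Function.Injective φ) (hψ : Function.Surjective ψ) (h : ∀ v, ψ v = 0 ↔ ∃ u, φ u = v) :
    Module.finrank k V = Module.finrank k U + Module.finrank k W := by
  rw [← LinearMap.finrank_range_add_finrank_ker ψ, LinearMap.range_eq_top.2 hψ, finrank_top,
    add_comm, ← LinearMap.finrank_range_of_inj hφ]
  have : LinearMap.ker ψ = LinearMap.range φ := Submodule.ext h
  rw [this]

theorem finrank_le_add_of_exact {U V W : Type*} [AddCommGroup U] [Module k U] [AddCommGroup V]
    [Module k V] [AddCommGroup W] [Module k W] [FiniteDimensional k U] [FiniteDimensional k V]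
    [FiniteDimensional k W] (φ : U →ₗ[k] V) (ψ : V →ₗ[k] W) (h : ∀ v, ψ v = 0 → ∃ u, φ u = v) :
    Module.finrank k V ≤ Module.finrank k U + Module.finrank k W := by
  rw [← LinearMap.finrank_range_add_finrank_ker ψ, add_comm]
  refine add_le_add ((Submodule.finrank_mono (t := LinearMap.range φ) ?_).trans
    (LinearMap.finrank_range_le φ)) (Submodule.finrank_le _)
  intro v hv
  exact h v hv

theorem finrank_ne_zero_iff_exists {V : Type*} [AddCommGroup V] [Module k V]
    [FiniteDimensional k V] : Module.finrank k V ≠ 0 ↔ ∃ v : V, v ≠ 0 := by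
  rw [← Nat.pos_iff_ne_zero, Module.finrank_pos_iff_exists_ne_zero]

end Linear

section HomDim

variable (k : Type*) [Field k] {B : Type*} [Category B] [Preadditive B] [Linear k B]

/-- Isomorphic objects have isomorphic morphism spaces. -/
def homLinearEquiv {X X' Y Y' : B} (e : X ≅ X') (f : Y ≅ Y') : (X ⟶ Y) ≃ₗ[k] (X' ⟶ Y') where
  toFun g := e.inv ≫ g ≫ f.hom
  invFun g := e.hom ≫ g ≫ f.inv
  left_inv g := by simp
  right_inv g := by simp
  map_add' g h := by simp
  map_smul' c g := by simp

theorem finrank_hom_congr {X X' Y Y' : B} (e : X ≅ X') (f : Y ≅ Y') :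
    Module.finrank k (X ⟶ Y) = Module.finrank k (X' ⟶ Y') :=
  (homLinearEquiv k e f).finrank_eq

theorem finrank_hom_of_isDirectSum {X Y : B} {ι : Type} [Fintype ι] {E : ι → B}
    (h : IsDirectSum X E) (hfd : ∀ Z : B, FiniteDimensional k (Z ⟶ Y)) :
    Module.finrank k (X ⟶ Y) = ∑ a, Module.finrank k (E a ⟶ Y) := by
  classical
  obtain ⟨s, p, h1, h2, h3⟩ := h
  rw [← Module.finrank_pi_fintype k]
  refine LinearEquiv.finrank_eq
    { toFun := fun f a => s a ≫ f
      invFun := fun g => ∑ a, p a ≫ g a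
      left_inv := fun f => ?_
      right_inv := fun g => ?_
      map_add' := fun f g => by ext a; simp
      map_smul' := fun c f => by ext a; simp }
  · dsimp only
    simp only [← Category.assoc]
    rw [← Preadditive.sum_comp, h3, Category.id_comp]
  · ext a
    dsimp only
    rw [Preadditive.comp_sum, Finset.sum_eq_single a]
    · rw [← Category.assoc, h1, Category.id_comp]
    · intro b _ hb
      rw [← Category.assoc, h2 a b hb.symm, zero_comp]
    · simp

theorem finrank_hom_le_of_epi {X X' Y : B} (f : X ⟶ X') [Epi f] [FiniteDimensional k (X ⟶ Y)] :
    Module.finrank k (X' ⟶ Y) ≤ Module.finrank k (X ⟶ Y) :=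
  LinearMap.finrank_le_finrank_of_injective (f := Linear.leftComp k Y f)
    fun _ _ h => (cancel_epi f).1 h

theorem finrank_hom_le_of_mono {X Y Y' : B} (f : Y ⟶ Y') [Mono f] [FiniteDimensional k (X ⟶ Y')] :
    Module.finrank k (X ⟶ Y) ≤ Module.finrank k (X ⟶ Y') :=
  LinearMap.finrank_le_finrank_of_injective (f := Linear.rightComp k X f)
    fun _ _ h => (cancel_mono f).1 h

theorem finrank_hom_zero_iff {X Y : B} [FiniteDimensional k (X ⟶ Y)] :
    Module.finrank k (X ⟶ Y) = 0 ↔ ∀ f : X ⟶ Y, f = 0 := by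
  rw [← not_iff_not, not_forall]
  exact finrank_ne_zero_iff_exists

end HomDim

/-! ### Simple objects of the abelianization -/

namespace Freyd

variable {k : Type*} [Field k] {A : Type*} [Category A] [Preadditive A] [Linear k A]
  [HasFiniteBiproducts A]

/-- The dimension of the value of `M` at `X`, that is, of `Hom (0 ⟶ X, M)`. -/
def dimAt (X : A) (M : Freyd k A) : ℕ := Module.finrank k ((projF k A).obj X ⟶ M)

theorem projF_isZero_iff {X : A} : IsZero ((projF k A).obj X) ↔ IsZero X := by
  rw [IsZero.iff_id_eq_zero, IsZero.iff_id_eq_zero, ← CategoryTheory.Functor.map_id,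
    ← (projF k A).map_zero, (projF k A).map_injective.eq_iff]

variable [FinitaryCategory k A]

theorem dimAt_ne_zero_iff {X : A} {M : Freyd k A} :
    dimAt X M ≠ 0 ↔ ∃ x : (projF k A).obj X ⟶ M, x ≠ 0 :=
  finrank_ne_zero_iff_exists

theorem dimAt_eq_zero_iff {X : A} {M : Freyd k A} :
    dimAt X M = 0 ↔ ∀ x : (projF k A).obj X ⟶ M, x = 0 :=
  finrank_hom_zero_iff k

theorem dimAt_congr {X Y : A} {M N : Freyd k A} (e : X ≅ Y) (f : M ≅ N) :
    dimAt X M = dimAt Y N :=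
  finrank_hom_congr k ((projF k A).mapIso e) f

theorem IsDirectSum.map {A B : Type*} [Category A] [Preadditive A] [Category B] [Preadditive B]
    (Φ : A ⥤ B) [Φ.Additive] {ι : Type} [Fintype ι] {X : A} {E : ι → A} (h : IsDirectSum X E) :
    IsDirectSum (Φ.obj X) fun a => Φ.obj (E a) := by
  obtain ⟨s, p, h1, h2, h3⟩ := h
  refine ⟨fun a => Φ.map (s a), fun a => Φ.map (p a), fun a => ?_, fun a b hab => ?_, ?_⟩
  · rw [← Φ.map_comp, h1, Φ.map_id]
  · rw [← Φ.map_comp, h2 a b hab, Φ.map_zero]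
  · simp only [← Φ.map_comp]
    rw [← Φ.map_sum, h3, Φ.map_id]

theorem exists_indecomposable_dimAt {X : A} {M : Freyd k A} (h : dimAt X M ≠ 0) :
    ∃ Z : A, Indecomposable Z ∧ Nonempty (Retract Z X) ∧ dimAt Z M ≠ 0 := by
  obtain ⟨ι, _, E, hE, hs⟩ := exists_indecomposable_decomposition k X
  have h2 : dimAt X M = ∑ a, dimAt (E a) M :=
    finrank_hom_of_isDirectSum k (IsDirectSum.map (projF k A) hs) fun _ => inferInstance
  rw [h2] at h
  obtain ⟨a, -, ha⟩ := Finset.exists_ne_zero_of_sum_ne_zero h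
  obtain ⟨s, p, h1, -⟩ := hs
  exact ⟨E a, hE a, ⟨⟨s a, p a, h1 a⟩⟩, ha⟩

theorem dimAt_of_exact (X : A) {M N Q : Freyd k A} (f : M ⟶ N) (g : N ⟶ Q) [Mono f] [Epi g]
    (w : f ≫ g = 0) (h : ∀ x : (projF k A).obj X ⟶ N, x ≫ g = 0 → ∃ y, y ≫ f = x) :
    dimAt X N = dimAt X M + dimAt X Q := by
  refine finrank_eq_add_of_exact (Linear.rightComp k _ f) (Linear.rightComp k _ g)
    (fun _ _ h => (cancel_mono f).1 h) (fun x => proj_lift g x) fun v => ⟨h v, ?_⟩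
  rintro ⟨u, rfl⟩
  change (u ≫ f) ≫ g = 0
  rw [Category.assoc, w, comp_zero]

theorem dimAt_kernel (X : A) {M N : Freyd k A} (f : M ⟶ N) [Epi f] :
    dimAt X M = dimAt X (kernel f) + dimAt X N :=
  dimAt_of_exact X (kernel.ι f) f (kernel.condition f) fun x hx =>
    ⟨kernel.lift f x hx, kernel.lift_ι _ _ _⟩

theorem dimAt_cokernel (X : A) {M N : Freyd k A} (f : M ⟶ N) [Mono f] :
    dimAt X N = dimAt X M + dimAt X (cokernel f) := by
  refine dimAt_of_exact X f (cokernel.π f) (cokernel.condition f) fun x hx => ?_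
  obtain ⟨C, q, hq, -, hd, h⟩ := exists_cokernel f
  refine h _ _ ?_
  have : cokernel.π f ≫ cokernel.desc f q hq = q := cokernel.π_desc _ _ _
  rw [← this, ← Category.assoc, hx, zero_comp]

theorem dimAt_le_of_mono (X : A) {M N : Freyd k A} (f : M ⟶ N) [Mono f] :
    dimAt X M ≤ dimAt X N := finrank_hom_le_of_mono k f

theorem dimAt_le_of_epi (X : A) {M N : Freyd k A} (f : M ⟶ N) [Epi f] :
    dimAt X N ≤ dimAt X M := by
  rw [dimAt_kernel X f]; exact Nat.le_add_left _ _

theorem dimAt_le_cokernel (X : A) {M N : Freyd k A} (f : M ⟶ N) :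
    dimAt X N ≤ dimAt X M + dimAt X (cokernel f) := by
  refine finrank_le_add_of_exact (Linear.rightComp k _ f) (Linear.rightComp k _ (cokernel.π f))
    fun x hx => ?_
  obtain ⟨C, q, hq, -, hd, h⟩ := exists_cokernel f
  refine h _ _ ?_
  have : cokernel.π f ≫ cokernel.desc f q hq = q := cokernel.π_desc _ _ _
  have hx : x ≫ cokernel.π f = 0 := hx
  rw [← this, ← Category.assoc, hx, zero_comp]

theorem isZero_iff_dimAt {M : Freyd k A} : IsZero M ↔ ∀ X : A, dimAt X M = 0 := by
  constructor
  · intro h X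
    exact dimAt_eq_zero_iff.2 fun x => h.eq_of_tgt _ _
  · intro h
    rw [IsZero.iff_id_eq_zero]
    refine hom_ext fun X x => ?_
    rw [comp_zero, Category.comp_id, dimAt_eq_zero_iff.1 (h X) x]

theorem exists_dimAt_ne_zero {M : Freyd k A} (h : ¬ IsZero M) :
    ∃ Z : A, Indecomposable Z ∧ dimAt Z M ≠ 0 := by
  rw [isZero_iff_dimAt, not_forall] at h
  obtain ⟨X, hX⟩ := h
  obtain ⟨Z, hZ, -, h⟩ := exists_indecomposable_dimAt hX
  exact ⟨Z, hZ, h⟩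

/-- The total dimension of `M`, measured at a generator of `A`. -/
def size (M : Freyd k A) : ℕ := dimAt (exists_isAddGenerator (A := A) k).choose M

theorem size_eq_zero_iff {M : Freyd k A} : size M = 0 ↔ IsZero M := by
  constructor
  · intro h
    obtain ⟨E, hE, h0⟩ : ∃ E : A, IsAddGenerator E ∧ dimAt E M = 0 :=
      ⟨_, (exists_isAddGenerator (A := A) k).choose_spec, h⟩
    rw [isZero_iff_dimAt]
    intro X
    rw [dimAt_eq_zero_iff] at *
    intro x
    obtain ⟨ι, _, f, g, hfg⟩ := hE X
    calc x = (projF k A).map (∑ a, f a ≫ g a) ≫ x := by simp [hfg]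
      _ = ∑ a, (projF k A).map (f a) ≫ ((projF k A).map (g a) ≫ x) := by
        rw [Functor.map_sum, Preadditive.sum_comp]; simp
      _ = 0 := Finset.sum_eq_zero fun a _ => by
        rw [h0 ((projF k A).map (g a) ≫ x), comp_zero]
  · intro h
    exact isZero_iff_dimAt.1 h _

theorem size_kernel {M N : Freyd k A} (f : M ⟶ N) [Epi f] :
    size M = size (kernel f) + size N := dimAt_kernel _ f

theorem size_cokernel {M N : Freyd k A} (f : M ⟶ N) [Mono f] :
    size N = size M + size (cokernel f) := dimAt_cokernel _ f

theorem size_le_of_epi {M N : Freyd k A} (f : M ⟶ N) [Epi f] : size N ≤ size M :=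
  dimAt_le_of_epi _ f

theorem isIso_of_isZero_kernel {M N : Freyd k A} (f : M ⟶ N) [Epi f] (h : IsZero (kernel f)) :
    IsIso f := by
  have := Preadditive.mono_of_kernel_zero (f := f) (h.eq_of_src _ _)
  exact isIso_of_mono_of_epi f

theorem isIso_of_epi_of_size {M N : Freyd k A} (f : M ⟶ N) [Epi f] (h : size M ≤ size N) :
    IsIso f := by
  refine isIso_of_isZero_kernel f (size_eq_zero_iff.1 ?_)
  have := size_kernel f
  omega

theorem epi_of_isZero_cokernel {M N : Freyd k A} (f : M ⟶ N) (h : IsZero (cokernel f)) : Epi f :=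
  Preadditive.epi_of_cokernel_zero (h.eq_of_tgt _ _)

theorem exists_simple_quotient {M : Freyd k A} (h : ¬ IsZero M) :
    ∃ (S : Freyd k A) (p : M ⟶ S), Simple S ∧ Epi p := by
  induction hn : size M using Nat.strong_induction_on generalizing M with
  | _ n ih =>
  by_cases hs : Simple M
  · exact ⟨M, 𝟙 M, hs, inferInstance⟩
  have : ∃ (Y : Freyd k A) (f : Y ⟶ M), Mono f ∧ f ≠ 0 ∧ ¬ IsIso f := by
    by_contra hcon
    refine hs ⟨fun {Y} f _ => ⟨fun hi h0 => h ?_, fun h0 => ?_⟩⟩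
    · rw [IsZero.iff_id_eq_zero, ← cancel_epi f, h0, zero_comp, zero_comp]
    · by_contra hi
      exact hcon ⟨Y, f, inferInstance, h0, hi⟩
  obtain ⟨Y, f, _, h0, hi⟩ := this
  have h1 := size_cokernel f
  have h2 : size Y ≠ 0 := fun h => h0 ((size_eq_zero_iff.1 h).eq_of_src _ _)
  have h3 : ¬ IsZero (cokernel f) := fun h => hi (by
    have := epi_of_isZero_cokernel f h
    exact isIso_of_mono_of_epi f)
  obtain ⟨S, p, hS, hp⟩ := ih _ (by omega) h3 rfl
  exact ⟨S, cokernel.π f ≫ p, hS, epi_comp _ _⟩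

variable [IsAlgClosed k]

/-- Lifting g through f ≫ g gives an endomorphism a of F with (1 - a) ≫ g = 0. Since End(F) is local
and g ≠ 0, a is invertible, so f splits. In substance: a map to P'_F that is onto a nonzero quotient
is onto. -/
theorem exists_section_of_epi_comp {F : A} (hF : Indecomposable F) {Y Z : Freyd k A}
    (f : Y ⟶ (projF k A).obj F) (g : (projF k A).obj F ⟶ Z) [Epi (f ≫ g)] (hZ : ¬ IsZero Z) :
    ∃ s : (projF k A).obj F ⟶ Y, s ≫ f = 𝟙 _ := by
  obtain ⟨e, he⟩ := proj_lift (f ≫ g) g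
  obtain ⟨a, ha⟩ := (projF k A).map_surjective (e ≫ f)
  have hg : Epi g := epi_of_epi f g
  obtain ⟨b, -, hb⟩ := hF.exists_isIso_of_sum k (ι := Bool) Finset.univ
    (fun b => if b then a else 𝟙 F - a) (by simp)
  cases b
  · exfalso
    simp only [Bool.false_eq_true, if_false] at hb
    have h0 : (projF k A).map (𝟙 F - a) ≫ g = 0 := by
      rw [Functor.map_sub, ha, Preadditive.sub_comp, Category.assoc, he,
        CategoryTheory.Functor.map_id, Category.id_comp, sub_self]
    have : g = 0 := by
      rw [← cancel_epi ((projF k A).map (𝟙 F - a)), h0, comp_zero]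
    exact hZ (by
      rw [IsZero.iff_id_eq_zero, ← cancel_epi g, this, zero_comp, zero_comp])
  · simp only [if_true] at hb
    exact ⟨(projF k A).map (inv a) ≫ e, by
      rw [Category.assoc, ← ha, ← Functor.map_comp, IsIso.inv_hom_id, CategoryTheory.Functor.map_id]⟩

theorem exists_isSimpleQuotient {F : A} (hF : Indecomposable F) :
    ∃ L : Freyd k A, IsSimpleQuotient L ((projF k A).obj F) := by
  obtain ⟨S, p, h⟩ := exists_simple_quotient (M := (projF k A).obj F)
    (fun h => hF.1 (projF_isZero_iff.1 h))
  exact ⟨S, h.1, p, h.2⟩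

theorem isSimpleQuotient_of_dimAt_ne_zero {F : A} {S : Freyd k A} (hS : Simple S)
    (h : dimAt F S ≠ 0) : IsSimpleQuotient S ((projF k A).obj F) := by
  obtain ⟨x, hx⟩ := dimAt_ne_zero_iff.1 h
  exact ⟨hS, x, epi_of_nonzero_to_simple hx⟩

/-- Indecomposable objects whose projectives have a common nonzero quotient are isomorphic. -/
theorem iso_of_epi_of_epi {F Z : A} (hF : Indecomposable F) (hZ : Indecomposable Z)
    {M : Freyd k A} (hM : ¬ IsZero M) (p : (projF k A).obj F ⟶ M) (q : (projF k A).obj Z ⟶ M)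
    [Epi p] [Epi q] : Nonempty (Z ≅ F) := by
  obtain ⟨y, hy⟩ := proj_lift q p
  have : Epi (y ≫ q) := by rw [hy]; infer_instance
  obtain ⟨s, hs⟩ := exists_section_of_epi_comp hZ y q hM
  obtain ⟨s, rfl⟩ := (projF k A).map_surjective s
  obtain ⟨y, rfl⟩ := (projF k A).map_surjective y
  refine hZ.iso_of_retract k hF ⟨s, y, (projF k A).map_injective ?_⟩
  rw [Functor.map_comp, hs, CategoryTheory.Functor.map_id]

theorem iso_of_dimAt_ne_zero {F Z : A} (hF : Indecomposable F) (hZ : Indecomposable Z)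
    {L : Freyd k A} (hL : IsSimpleQuotient L ((projF k A).obj F)) (h : dimAt Z L ≠ 0) :
    Nonempty (Z ≅ F) := by
  obtain ⟨hS, p, hp⟩ := hL
  obtain ⟨-, q, hq⟩ := isSimpleQuotient_of_dimAt_ne_zero hS h
  exact iso_of_epi_of_epi hF hZ (Simple.not_isZero L) p q

include k in
theorem isIso_of_section {F : A} (hF : Indecomposable F) {a s : F ⟶ F} (h : s ≫ a = 𝟙 F) :
    IsIso a := by
  have := FinitaryCategory.idempotentComplete k (A := A)
  rcases hF.idempotent (a ≫ s) (by rw [Category.assoc, ← Category.assoc s, h, Category.id_comp])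
    with h0 | h1
  · exact absurd ((IsZero.iff_id_eq_zero _).2 (by
      calc 𝟙 F = s ≫ (a ≫ s) ≫ a := by rw [Category.assoc, h, Category.comp_id, h]
        _ = 0 := by rw [h0]; simp)) hF.1
  · exact ⟨s, h1, h⟩

/-- Let `p` be an epimorphism from the projective cover of `F` such that nonzero morphisms to the
target are epimorphisms. Then all of them are multiples of `p`. -/
theorem exists_smul_eq {F : A} (hF : Indecomposable F) {M : Freyd k A}
    (p : (projF k A).obj F ⟶ M) [Epi p] (h : ∀ x : (projF k A).obj F ⟶ M, x ≠ 0 → Epi x)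
    (hM : ¬ IsZero M) (x : (projF k A).obj F ⟶ M) : ∃ c : k, c • p = x := by
  obtain ⟨e, rfl⟩ := proj_lift p x
  obtain ⟨a, rfl⟩ := (projF k A).map_surjective e
  obtain ⟨c, hc⟩ := hF.scalar_or k a
  refine ⟨c, ?_⟩
  by_contra hne
  apply hc
  have h1 : (projF k A).map (a - c • 𝟙 F) ≫ p = (projF k A).map a ≫ p - c • p := by
    rw [Functor.map_sub, Functor.map_smul, CategoryTheory.Functor.map_id, Preadditive.sub_comp,
      Linear.smul_comp, Category.id_comp]
  have := h ((projF k A).map (a - c • 𝟙 F) ≫ p) (by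
    rw [h1]; exact fun h0 => hne (sub_eq_zero.1 h0).symm)
  obtain ⟨s, hs⟩ := exists_section_of_epi_comp hF ((projF k A).map (a - c • 𝟙 F)) p hM
  obtain ⟨s, rfl⟩ := (projF k A).map_surjective s
  exact isIso_of_section (k := k) hF (s := s) ((projF k A).map_injective (by
    rw [Functor.map_comp, hs, CategoryTheory.Functor.map_id]))

theorem dimAt_eq_one_of_epi {F : A} (hF : Indecomposable F) {M : Freyd k A}
    (p : (projF k A).obj F ⟶ M) [Epi p] (h : ∀ x : (projF k A).obj F ⟶ M, x ≠ 0 → Epi x)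
    (hM : ¬ IsZero M) : dimAt F M = 1 := by
  refine finrank_eq_one p (fun h0 => hM ?_) (exists_smul_eq hF p h hM)
  rw [IsZero.iff_id_eq_zero, ← cancel_epi p, h0, zero_comp, zero_comp]

theorem dimAt_simpleQuotient {F : A} (hF : Indecomposable F) {L : Freyd k A}
    (hL : IsSimpleQuotient L ((projF k A).obj F)) : dimAt F L = 1 := by
  obtain ⟨hS, p, hp⟩ := hL
  exact dimAt_eq_one_of_epi hF p (fun x hx => epi_of_nonzero_to_simple hx) (Simple.not_isZero L)

/-- If ker p were not contained in ker q it would map onto S, hence onto the whole projective,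
forcing p = 0. -/
theorem simpleQuotient_unique {F : A} (hF : Indecomposable F) {L S : Freyd k A}
    (hL : IsSimpleQuotient L ((projF k A).obj F)) (hS : IsSimpleQuotient S ((projF k A).obj F)) :
    Nonempty (L ≅ S) := by
  obtain ⟨hL, p, hp⟩ := hL
  obtain ⟨hS, q, hq⟩ := hS
  by_cases h : kernel.ι p ≫ q = 0
  · have h1 : p ≫ Abelian.epiDesc p q h = q := Abelian.comp_epiDesc p q h
    have h2 : Abelian.epiDesc p q h ≠ 0 := by
      intro h0
      rw [h0, comp_zero] at h1
      exact Simple.not_isZero S (by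
        rw [IsZero.iff_id_eq_zero, ← cancel_epi q, ← h1, zero_comp, zero_comp])
    have := isIso_of_hom_simple h2
    exact ⟨asIso (Abelian.epiDesc p q h)⟩
  · have := epi_of_nonzero_to_simple h
    obtain ⟨s, hs⟩ := exists_section_of_epi_comp hF (kernel.ι p) q (Simple.not_isZero S)
    exfalso
    apply Simple.not_isZero L
    have : p = 0 := by
      rw [← Category.id_comp p, ← hs, Category.assoc, kernel.condition, comp_zero]
    rw [IsZero.iff_id_eq_zero, ← cancel_epi p, this, zero_comp, zero_comp]

theorem exists_simpleQuotient_of_simple {S : Freyd k A} (hS : Simple S) :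
    ∃ F : A, Indecomposable F ∧ IsSimpleQuotient S ((projF k A).obj F) := by
  obtain ⟨Z, hZ, h⟩ := exists_dimAt_ne_zero (Simple.not_isZero S)
  exact ⟨Z, hZ, isSimpleQuotient_of_dimAt_ne_zero hS h⟩

/-- A nonzero quotient of an indecomposable projective object has simple top. -/
theorem finrank_hom_simpleQuotient {F : A} (hF : Indecomposable F) {L M : Freyd k A}
    (hL : IsSimpleQuotient L ((projF k A).obj F)) (p : (projF k A).obj F ⟶ M) [Epi p]
    (hM : ¬ IsZero M) : Module.finrank k (M ⟶ L) = 1 := by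
  apply le_antisymm
  · rw [← dimAt_simpleQuotient hF hL]
    exact finrank_hom_le_of_epi k p
  · rw [Nat.one_le_iff_ne_zero, finrank_ne_zero_iff_exists]
    obtain ⟨S, q, hS, hq⟩ := exists_simple_quotient hM
    obtain ⟨e⟩ := simpleQuotient_unique hF ⟨hS, p ≫ q, epi_comp _ _⟩ hL
    refine ⟨q ≫ e.hom, fun h0 => Simple.not_isZero S ?_⟩
    rw [IsZero.iff_id_eq_zero, ← cancel_epi q, ← cancel_mono e.hom]
    simp [h0]

/-- Hom(-, Y) is subadditive and the value at X is additive on short exact sequences, so the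
inequality only has to be checked on simple objects. -/
theorem finrank_hom_le_dimAt (X : A) (Y : Freyd k A)
    (h : ∀ S : Freyd k A, Simple S → Module.finrank k (S ⟶ Y) ≤ dimAt X S) (M : Freyd k A) :
    Module.finrank k (M ⟶ Y) ≤ dimAt X M := by
  induction hn : size M using Nat.strong_induction_on generalizing M with
  | _ n ih =>
  by_cases hM : IsZero M
  · rw [(finrank_hom_zero_iff k).2 fun f => hM.eq_of_src _ _]
    exact Nat.zero_le _
  obtain ⟨S, p, hS, hp⟩ := exists_simple_quotient hM
  have h1 := size_kernel p
  have h2 : size S ≠ 0 := fun h => Simple.not_isZero S (size_eq_zero_iff.1 h)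
  have h3 := ih _ (by omega) (kernel p) rfl
  rw [dimAt_kernel X p]
  refine le_trans ?_ ((add_comm _ _).trans_le (add_le_add h3 (h S hS)))
  refine finrank_le_add_of_exact (Linear.leftComp k Y p) (Linear.leftComp k Y (kernel.ι p))
    fun f hf => ?_
  exact ⟨Abelian.epiDesc p f hf, Abelian.comp_epiDesc p f hf⟩

/-- `Y` is generated by the morphisms from `P`. -/
def IsGeneratedBy {B : Type*} [Category B] [HasZeroMorphisms B] (P Y : B) : Prop :=
  ∀ ⦃Z : B⦄ (f : Y ⟶ Z), (∀ a : P ⟶ Y, a ≫ f = 0) → f = 0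

theorem IsGeneratedBy.of_epi {B : Type*} [Category B] [HasZeroMorphisms B] {P Y Z : B}
    (h : IsGeneratedBy P Y) (f : Y ⟶ Z) [Epi f] : IsGeneratedBy P Z := fun W g hg => by
  rw [← cancel_epi f, comp_zero]
  exact h _ fun a => by rw [← Category.assoc, hg]

/-- Divide Y by the image of a map a from P that is nonzero on a simple quotient of Y. That quotient
is L, so Hom(-, L) loses at least one dimension, while the value at X loses at most that of P. -/
theorem IsGeneratedBy.dimAt_le {P L : Freyd k A}
    (hP : ∀ (S : Freyd k A) (f : P ⟶ S), Simple S → f ≠ 0 → Nonempty (S ≅ L))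
    {Y : Freyd k A} (h : IsGeneratedBy P Y) (X : A) :
    dimAt X Y ≤ dimAt X P * Module.finrank k (Y ⟶ L) := by
  induction hn : size Y using Nat.strong_induction_on generalizing Y with
  | _ n ih =>
  by_cases hY : IsZero Y
  · rw [isZero_iff_dimAt.1 hY]
    exact Nat.zero_le _
  obtain ⟨S, p, hS, hp⟩ := exists_simple_quotient hY
  obtain ⟨a, ha⟩ : ∃ a : P ⟶ Y, a ≫ p ≠ 0 := by
    by_contra hcon
    push Not at hcon
    have := h p hcon
    exact Simple.not_isZero S (by
      rw [IsZero.iff_id_eq_zero, ← cancel_epi p, this, zero_comp, zero_comp])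
  obtain ⟨e⟩ := hP S _ hS ha
  have h1 := size_kernel (cokernel.π a)
  have h2 : size (kernel (cokernel.π a)) ≠ 0 := by
    rw [Ne, size_eq_zero_iff]
    intro h0
    have : kernel.lift (cokernel.π a) a (cokernel.condition a) ≫ kernel.ι _ = a :=
      kernel.lift_ι _ _ _
    rw [h0.eq_of_tgt (kernel.lift (cokernel.π a) a (cokernel.condition a)) 0, zero_comp] at this
    exact ha (by rw [← this, zero_comp])
  have h3 := ih _ (by omega) (h.of_epi (cokernel.π a)) rfl
  have h4 : Module.finrank k (cokernel a ⟶ L) + 1 ≤ Module.finrank k (Y ⟶ L) := by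
    let φ : (cokernel a ⟶ L) →ₗ[k] (Y ⟶ L) := Linear.leftComp k L (cokernel.π a)
    have hφ : Function.Injective φ := fun _ _ h => (cancel_epi (cokernel.π a)).1 h
    rw [← LinearMap.finrank_range_of_inj hφ]
    refine Submodule.finrank_lt fun htop => ?_
    obtain ⟨f, hf⟩ : p ≫ e.hom ∈ LinearMap.range φ := by rw [htop]; trivial
    have hf : cokernel.π a ≫ f = p ≫ e.hom := hf
    apply ha
    rw [← cancel_mono e.hom, Category.assoc, ← hf, ← Category.assoc, cokernel.condition,
      zero_comp, zero_comp]
  calc dimAt X Y ≤ dimAt X P + dimAt X (cokernel a) := dimAt_le_cokernel X a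
    _ ≤ dimAt X P * 1 + dimAt X P * Module.finrank k (cokernel a ⟶ L) := by
      rw [mul_one]; exact Nat.add_le_add_left h3 _
    _ = dimAt X P * (Module.finrank k (cokernel a ⟶ L) + 1) := by ring
    _ ≤ _ := Nat.mul_le_mul_left _ h4

end Freyd

/-! ### The action of `1`-morphisms -/

section Act

variable {k : Type*} [Field k] {C : Type u} [Bicategory.{w, v} C]
  [∀ i j : C, Preadditive (i ⟶ j)] [∀ i j : C, Linear k (i ⟶ j)]
  [∀ i j : C, HasFiniteBiproducts (i ⟶ j)]

instance [IsFinitary k C] (i j : C) : FinitaryCategory k (i ⟶ j) where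
  idempotentComplete := IsFinitary.idempotentComplete (k := k) i j
  finiteDimensional F G := IsFinitary.finiteDimensional F G
  hasFiniteBiproducts := inferInstance
  finite_indecomposables := IsFinitary.finite_indecomposables (k := k) i j

/-- The unit of the adjunction between composition functors. -/
def whiskerUnit {i j l : C} {F : j ⟶ l} {F' : l ⟶ j} (adj : Bicategory.Adjunction F F')
    (X : i ⟶ j) : X ⟶ (X ≫ F) ≫ F' :=
  (ρ_ X).inv ≫ X ◁ adj.unit ≫ (α_ X F F').inv

/-- The counit of the adjunction between composition functors. -/
def whiskerCounit {i j l : C} {F : j ⟶ l} {F' : l ⟶ j} (adj : Bicategory.Adjunction F F')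
    (Y : i ⟶ l) : (Y ≫ F') ≫ F ⟶ Y :=
  (α_ Y F' F).hom ≫ Y ◁ adj.counit ≫ (ρ_ Y).hom

section

variable {i j l : C} {F : j ⟶ l} {F' : l ⟶ j} (adj : Bicategory.Adjunction F F')

theorem whiskerUnit_naturality {X Y : i ⟶ j} (f : X ⟶ Y) :
    f ≫ whiskerUnit adj Y = whiskerUnit adj X ≫ f ▷ F ▷ F' := by
  rw [whiskerUnit, whiskerUnit, rightUnitor_inv_naturality_assoc, ← whisker_exchange_assoc]
  simp

theorem whiskerCounit_naturality {X Y : i ⟶ l} (f : X ⟶ Y) :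
    f ▷ F' ▷ F ≫ whiskerCounit adj Y = whiskerCounit adj X ≫ f := by
  rw [whiskerCounit, whiskerCounit, Category.assoc, Category.assoc, ← rightUnitor_naturality,
    whisker_exchange_assoc]
  simp

theorem whisker_left_triangle (X : i ⟶ j) :
    whiskerUnit adj X ▷ F ≫ whiskerCounit adj (X ≫ F) = 𝟙 _ := by
  have := adj.homEquiv₂.symm_apply_apply (𝟙 (X ≫ F))
  rw [Bicategory.Adjunction.homEquiv₂_apply, Bicategory.Adjunction.homEquiv₂_symm_apply,
    id_whiskerRight, Category.comp_id] at this
  exact this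

theorem whisker_right_triangle (Y : i ⟶ l) :
    whiskerUnit adj (Y ≫ F') ≫ whiskerCounit adj Y ▷ F' = 𝟙 _ := by
  have := adj.homEquiv₂.apply_symm_apply (𝟙 (Y ≫ F'))
  rw [Bicategory.Adjunction.homEquiv₂_apply, Bicategory.Adjunction.homEquiv₂_symm_apply,
    id_whiskerRight, Category.id_comp] at this
  simpa [whiskerUnit, whiskerCounit] using this

end

variable [IsFinitary k C]

theorem whisker_square {i j l : C} (F : j ⟶ l) {X Y : Freyd k (i ⟶ j)} {a : X.left ⟶ Y.left}
    {b : X.right ⟶ Y.right} (h : X.hom ≫ b = a ≫ Y.hom) :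
    X.hom ▷ F ≫ b ▷ F = a ▷ F ≫ Y.hom ▷ F := by
  rw [← comp_whiskerRight, h, comp_whiskerRight]

theorem act_map_mkHom {i j l : C} (F : j ⟶ l) {X Y : Freyd k (i ⟶ j)} (a : X.left ⟶ Y.left)
    (b : X.right ⟶ Y.right) (h : X.hom ≫ b = a ≫ Y.hom) :
    (act F).map (Freyd.mkHom a b h) =
      Freyd.mkHom (X := (act F).obj X) (Y := (act F).obj Y) (a ▷ F) (b ▷ F)
        (whisker_square F h) := rfl

instance {i j l : C} (F : j ⟶ l) :
    (act F : Freyd k (i ⟶ j) ⥤ Freyd k (i ⟶ l)).Additive where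
  map_add {X Y f g} := by
    obtain ⟨a, b, h, rfl⟩ := Freyd.exists_mkHom f
    obtain ⟨a', b', h', rfl⟩ := Freyd.exists_mkHom g
    rw [Freyd.mkHom_add, act_map_mkHom, act_map_mkHom, act_map_mkHom]
    exact (Freyd.mkHom_ext (X := (act F).obj X) (Y := (act F).obj Y)
      (IsFinitary.add_whiskerRight (k := k) b b' F)).trans
      (Freyd.mkHom_add (X := (act F).obj X) (Y := (act F).obj Y) (h := whisker_square F h)
        (h' := whisker_square F h')).symm

instance {i j l : C} (F : j ⟶ l) :
    (act F : Freyd k (i ⟶ j) ⥤ Freyd k (i ⟶ l)).Linear k where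
  map_smul {X Y} f c := by
    obtain ⟨a, b, h, rfl⟩ := Freyd.exists_mkHom f
    rw [Freyd.mkHom_smul, act_map_mkHom, act_map_mkHom]
    exact (Freyd.mkHom_ext (X := (act F).obj X) (Y := (act F).obj Y)
      (IsFinitary.smul_whiskerRight c b F)).trans
      (Freyd.mkHom_smul (X := (act F).obj X) (Y := (act F).obj Y) c
        (h := whisker_square F h)).symm

theorem hom_whisker_exchange {i j l : C} (M : Freyd k (i ⟶ j)) {F G : j ⟶ l} (β : F ⟶ G) :
    M.hom ▷ F ≫ M.right ◁ β = M.left ◁ β ≫ M.hom ▷ G := (whisker_exchange _ _).symm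

/-- The object `F M` as a functor of `F`. -/
def actOn {i j l : C} (M : Freyd k (i ⟶ j)) : (j ⟶ l) ⥤ Freyd k (i ⟶ l) where
  obj F := (act F).obj M
  map {F G} β := Freyd.mkHom (X := (act F).obj M) (Y := (act G).obj M)
    (M.left ◁ β) (M.right ◁ β) (hom_whisker_exchange M β)
  map_id F := by
    rw [← Freyd.mkHom_id]
    exact Freyd.mkHom_ext (by simp; rfl)
  map_comp {F G H} β γ := (Freyd.mkHom_ext (Bicategory.whiskerLeft_comp _ _ _)).trans
    (Freyd.mkHom_comp (X := (act F).obj M) (Y := (act G).obj M) (Z := (act H).obj M)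
      (h := hom_whisker_exchange M β) (h' := hom_whisker_exchange M γ)).symm

instance {i j l : C} (M : Freyd k (i ⟶ j)) :
    (actOn M : (j ⟶ l) ⥤ Freyd k (i ⟶ l)).Additive where
  map_add {F G β γ} := (Freyd.mkHom_ext (IsFinitary.whiskerLeft_add (k := k) _ _ _)).trans
    (Freyd.mkHom_add (X := (act F).obj M) (Y := (act G).obj M)
      (h := hom_whisker_exchange M β) (h' := hom_whisker_exchange M γ)).symm

theorem actOn_naturality {i j l : C} {M N : Freyd k (i ⟶ j)} (f : M ⟶ N) {F G : j ⟶ l}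
    (β : F ⟶ G) : (act F).map f ≫ (actOn N).map β = (actOn M).map β ≫ (act G).map f := by
  obtain ⟨a, b, h, rfl⟩ := Freyd.exists_mkHom f
  exact Freyd.mkHom_ext (X := (act F).obj M) (Y := (act G).obj N) (whisker_exchange _ _).symm

/-- The actions of isomorphic `1`-morphisms are isomorphic. -/
def actIso {i j l : C} {F G : j ⟶ l} (e : F ≅ G) :
    (act F : Freyd k (i ⟶ j) ⥤ Freyd k (i ⟶ l)) ≅ act G :=
  NatIso.ofComponents (fun M => (actOn M).mapIso e) fun f => actOn_naturality f e.hom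

/-- The action is compatible with composition. -/
def actComp {i j l m : C} (F : j ⟶ l) (G : l ⟶ m) (M : Freyd k (i ⟶ j)) :
    (act (F ≫ G)).obj M ≅ (act G).obj ((act F).obj M) where
  hom := Freyd.mkHom (X := (act (F ≫ G)).obj M) (Y := (act G).obj ((act F).obj M))
    (α_ M.left F G).inv (α_ M.right F G).inv (associator_inv_naturality_left _ _ _)
  inv := Freyd.mkHom (Y := (act (F ≫ G)).obj M) (X := (act G).obj ((act F).obj M))
    (α_ M.left F G).hom (α_ M.right F G).hom (associator_naturality_left _ _ _)
  hom_inv_id := (Freyd.mkHom_ext (X := (act (F ≫ G)).obj M) (Y := (act (F ≫ G)).obj M)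
    (Iso.inv_hom_id (α_ M.right F G))).trans (Freyd.mkHom_id _)
  inv_hom_id := (Freyd.mkHom_ext (X := (act G).obj ((act F).obj M))
    (Y := (act G).obj ((act F).obj M)) (Iso.hom_inv_id (α_ M.right F G))).trans (Freyd.mkHom_id _)

theorem zero_whiskerRight (k : Type*) [Field k] [∀ i j : C, Linear k (i ⟶ j)] [IsFinitary k C]
    {i j l : C} (X Y : i ⟶ j) (F : j ⟶ l) : (0 : X ⟶ Y) ▷ F = 0 := by
  have := IsFinitary.add_whiskerRight (k := k) (0 : X ⟶ Y) 0 F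
  simpa using this

/-- The action on projective objects. -/
def actProj {i j l : C} (X : i ⟶ j) (F : j ⟶ l) :
    (act F).obj ((Freyd.projF k (i ⟶ j)).obj X) ≅ (Freyd.projF k (i ⟶ l)).obj (X ≫ F) where
  hom := Freyd.mkHom (X := (act F).obj (Freyd.proj k X)) (Y := Freyd.proj k (X ≫ F)) 0 (𝟙 _) (by
    change ((0 : 0 ⟶ X) ▷ F) ≫ 𝟙 _ = 0 ≫ 0
    rw [zero_whiskerRight k]; simp)
  inv := Freyd.mkHom (Y := (act F).obj (Freyd.proj k X)) (X := Freyd.proj k (X ≫ F)) 0 (𝟙 _)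
    ((isZero_zero _).eq_of_src _ _)
  hom_inv_id := (Freyd.mkHom_ext (X := (act F).obj (Freyd.proj k X))
    (Y := (act F).obj (Freyd.proj k X)) (Category.comp_id (𝟙 (X ≫ F)))).trans (Freyd.mkHom_id _)
  inv_hom_id := (Freyd.mkHom_ext (X := Freyd.proj k (X ≫ F))
    (Y := Freyd.proj k (X ≫ F)) (Category.comp_id (𝟙 (X ≫ F)))).trans (Freyd.mkHom_id _)

/-- Adjoint `1`-morphisms act by adjoint functors. -/
def actAdjunction {i j l : C} {F : j ⟶ l} {F' : l ⟶ j} (adj : Bicategory.Adjunction F F') :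
    (act F : Freyd k (i ⟶ j) ⥤ Freyd k (i ⟶ l)) ⊣ act F' where
  unit :=
    { app := fun M => Freyd.mkHom (Y := (act F').obj ((act F).obj M))
        (whiskerUnit adj M.left) (whiskerUnit adj M.right) (whiskerUnit_naturality adj M.hom)
      naturality := fun M N f => by
        obtain ⟨a, b, h, rfl⟩ := Freyd.exists_mkHom f
        exact Freyd.mkHom_ext (Y := (act F').obj ((act F).obj N)) (whiskerUnit_naturality adj b) }
  counit :=
    { app := fun M => Freyd.mkHom (X := (act F).obj ((act F').obj M))
        (whiskerCounit adj M.left) (whiskerCounit adj M.right) (whiskerCounit_naturality adj M.hom)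
      naturality := fun M N f => by
        obtain ⟨a, b, h, rfl⟩ := Freyd.exists_mkHom f
        exact Freyd.mkHom_ext (X := (act F).obj ((act F').obj M))
          (whiskerCounit_naturality adj b) }
  left_triangle_components M := Freyd.mkHom_ext (X := (act F).obj M) (Y := (act F).obj M)
    (whisker_left_triangle adj M.right)
  right_triangle_components M := Freyd.mkHom_ext (X := (act F').obj M) (Y := (act F').obj M)
    (whisker_right_triangle adj M.right)

theorem finrank_hom_of_adjunction {A B : Type*} [Category A] [Preadditive A] [Linear k A]
    [Category B] [Preadditive B] [Linear k B] {Φ : A ⥤ B} {Ψ : B ⥤ A} [Ψ.Additive] [Ψ.Linear k]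
    (adj : Φ ⊣ Ψ) (X : A) (Y : B) :
    Module.finrank k (Φ.obj X ⟶ Y) = Module.finrank k (X ⟶ Ψ.obj Y) :=
  LinearEquiv.finrank_eq
    { adj.homEquiv X Y with
      map_add' := fun f g => by simp [Adjunction.homEquiv_unit]
      map_smul' := fun c f => by simp [Adjunction.homEquiv_unit] }

end Act

/-! ### The involution -/

theorem indecomposable_iff_idempotent {A : Type*} [Category A] [Preadditive A]
    [HasBinaryBiproducts A] [IsIdempotentComplete A] {F : A} :
    Indecomposable F ↔ ¬ IsZero F ∧ ∀ e : F ⟶ F, e ≫ e = e → e = 0 ∨ e = 𝟙 F := by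
  refine ⟨fun h => ⟨h.1, h.idempotent⟩, fun h => ⟨h.1, fun Y Z f => ?_⟩⟩
  rcases h.2 (f.hom ≫ biprod.fst ≫ biprod.inl ≫ f.inv) (by simp) with h0 | h1
  · left
    rw [IsZero.iff_id_eq_zero]
    have := congrArg (fun t => biprod.inl ≫ f.inv ≫ t ≫ f.hom ≫ biprod.fst) h0
    simpa using this
  · right
    rw [IsZero.iff_id_eq_zero]
    have := congrArg (fun t => biprod.inr ≫ f.inv ≫ t ≫ f.hom ≫ biprod.snd) h1
    simpa using this.symm

section Star

variable {C : Type u} [Bicategory.{w, v} C] (T : FiatStructure C)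

theorem star_map_injective {i j : C} {F G : i ⟶ j} {α β : F ⟶ G} (h : T.map α = T.map β) :
    α = β := by
  have h1 := T.starStar_naturality α
  rw [h, T.starStar_naturality β] at h1
  exact ((cancel_epi _).1 h1).symm

theorem star_map_surjective {i j : C} {F G : i ⟶ j} (γ : T.star G ⟶ T.star F) :
    ∃ α : F ⟶ G, T.map α = γ := by
  refine ⟨(T.starStar F).inv ≫ T.map γ ≫ (T.starStar G).hom, star_map_injective T ?_⟩
  rw [← cancel_mono (T.starStar G).hom, T.starStar_naturality]
  simp

/-- The involution as a contravariant functor. -/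
def starF (i j : C) : (i ⟶ j)ᵒᵖ ⥤ (j ⟶ i) where
  obj F := T.star F.unop
  map f := T.map f.unop
  map_id _ := T.map_id _
  map_comp _ _ := T.map_comp _ _

instance (i j : C) : (starF T i j).Full where
  map_surjective γ := by
    obtain ⟨α, h⟩ := star_map_surjective T γ
    exact ⟨α.op, h⟩

instance (i j : C) : (starF T i j).Faithful where
  map_injective h := Quiver.Hom.unop_inj (star_map_injective T h)

instance (i j : C) : (starF T i j).EssSurj where
  mem_essImage F := ⟨Opposite.op (T.star F), ⟨T.starStar F⟩⟩

instance (i j : C) : (starF T i j).IsEquivalence where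

/-- The involution on isomorphisms. -/
def starIso {i j : C} {F G : i ⟶ j} (e : F ≅ G) : T.star F ≅ T.star G :=
  (starF T i j).mapIso e.symm.op

/-- The involution on retracts. -/
def starRetract {i j : C} {F G : i ⟶ j} (r : Retract F G) : Retract (T.star F) (T.star G) where
  i := T.map r.r
  r := T.map r.i
  retract := by rw [← T.map_comp, r.retract, T.map_id]

variable [∀ i j : C, Preadditive (i ⟶ j)] [∀ i j : C, HasFiniteBiproducts (i ⟶ j)]

/-- Additivity of * on 2-morphisms is not an axiom: it follows because * is a contravariant
equivalence and so preserves biproducts. -/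
instance (i j : C) : (starF T i j).Additive := by
  have : HasBinaryProducts (i ⟶ j)ᵒᵖ := inferInstance
  have : (starF T i j).PreservesZeroMorphisms := inferInstance
  exact Functor.additive_of_preserves_binary_products _

theorem star_map_add {i j : C} {F G : i ⟶ j} (α β : F ⟶ G) :
    T.map (α + β) = T.map α + T.map β :=
  (starF T i j).map_add (f := α.op) (g := β.op)

theorem star_map_zero {i j : C} (F G : i ⟶ j) : T.map (0 : F ⟶ G) = 0 :=
  (starF T i j).map_zero _ _

theorem star_map_sum {i j : C} {F G : i ⟶ j} {ι : Type*} (s : Finset ι) (f : ι → (F ⟶ G)) :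
    T.map (∑ a ∈ s, f a) = ∑ a ∈ s, T.map (f a) :=
  map_sum (AddMonoidHom.mk' (fun f : F ⟶ G => T.map f) (star_map_add T)) f s

theorem star_map_sub {i j : C} {F G : i ⟶ j} (α β : F ⟶ G) :
    T.map (α - β) = T.map α - T.map β :=
  map_sub (AddMonoidHom.mk' (fun f : F ⟶ G => T.map f) (star_map_add T)) α β

theorem star_isZero {i j : C} {F : i ⟶ j} (h : IsZero (T.star F)) : IsZero F := by
  rw [IsZero.iff_id_eq_zero] at *
  apply star_map_injective T
  rw [T.map_id, h, star_map_zero]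

theorem star_indecomposable [∀ i j : C, IsIdempotentComplete (i ⟶ j)] {i j : C} {F : i ⟶ j}
    (h : Indecomposable F) : Indecomposable (T.star F) := by
  rw [indecomposable_iff_idempotent] at *
  refine ⟨fun h0 => h.1 (star_isZero T h0), fun e he => ?_⟩
  obtain ⟨a, rfl⟩ := star_map_surjective T e
  rcases h.2 a (star_map_injective T (by rw [T.map_comp, he])) with h0 | h1
  · left; rw [h0, star_map_zero]
  · right; rw [h1, T.map_id]

end Star

/-! ### Exactness and two-sided adjointness of the action -/

section FiatAction

variable {k : Type*} [Field k] {C : Type u} [Bicategory.{w, v} C]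
  [∀ i j : C, Preadditive (i ⟶ j)] [∀ i j : C, Linear k (i ⟶ j)]
  [∀ i j : C, HasFiniteBiproducts (i ⟶ j)] [IsFinitary k C] (T : FiatStructure C)

/-- The action of `F` is left adjoint to the action of `F^*`. -/
def actAdj {i j l : C} (F : j ⟶ l) :
    (act F : Freyd k (i ⟶ j) ⥤ Freyd k (i ⟶ l)) ⊣ act (T.star F) :=
  actAdjunction (T.adjunction F).some

/-- The action of `F` is right adjoint to the action of `F^*`. -/
def actAdjStar {i j l : C} (F : j ⟶ l) :
    (act (T.star F) : Freyd k (i ⟶ l) ⥤ Freyd k (i ⟶ j)) ⊣ act F :=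
  (actAdjunction (T.adjunction (T.star F)).some).ofNatIsoRight (actIso (T.starStar F))

include T in
theorem act_map_epi {i j l : C} (F : j ⟶ l) {M N : Freyd k (i ⟶ j)} (f : M ⟶ N) [Epi f] :
    Epi ((act F).map f) := by
  have := Functor.preservesEpimorphisms_of_adjunction (actAdj (k := k) (i := i) T F)
  infer_instance

include T in
theorem act_map_mono {i j l : C} (F : j ⟶ l) {M N : Freyd k (i ⟶ j)} (f : M ⟶ N) [Mono f] :
    Mono ((act F).map f) := by
  have := Functor.preservesMonomorphisms_of_adjunction (actAdjStar (k := k) (i := i) T F)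
  infer_instance

include T in
-- As a left adjoint, F preserves the cokernel of f; if F sends this cokernel to zero, F f is an
-- epimorphism.
theorem act_map_epi_of_isZero {i j l : C} (F : j ⟶ l) {M N Z : Freyd k (i ⟶ j)} (f : M ⟶ N)
    (g : N ⟶ Z) (w : f ≫ g = 0) (hc : IsColimit (CokernelCofork.ofπ g w))
    (h : IsZero ((act F).obj Z)) : Epi ((act F).map f) := by
  have := (actAdj (k := k) (i := i) T F).leftAdjoint_preservesColimits
  refine Preadditive.epi_of_isZero_cokernel' _ (CokernelCofork.mapIsColimit _ hc (act F)) h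

theorem finrank_hom_act {i j l : C} (F : j ⟶ l) (M : Freyd k (i ⟶ j)) (N : Freyd k (i ⟶ l)) :
    Module.finrank k ((act F).obj M ⟶ N) = Module.finrank k (M ⟶ (act (T.star F)).obj N) :=
  finrank_hom_of_adjunction (actAdj T F) M N

theorem finrank_hom_act_star {i j l : C} (F : j ⟶ l) (M : Freyd k (i ⟶ l))
    (N : Freyd k (i ⟶ j)) :
    Module.finrank k ((act (T.star F)).obj M ⟶ N) = Module.finrank k (M ⟶ (act F).obj N) :=
  finrank_hom_of_adjunction (actAdjStar T F) M N

/-- Hom(P'_X, F M) = Hom(F^* P'_X, M), and F^* P'_X is again projective, namely P'_{F^*∘X}. This is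
the bridge between modules and composites of 1-morphisms. -/
theorem dimAt_act {i j l : C} (F : j ⟶ l) (M : Freyd k (i ⟶ j)) (X : i ⟶ l) :
    Freyd.dimAt X ((act F).obj M) = Freyd.dimAt (X ≫ T.star F) M := by
  rw [Freyd.dimAt, ← finrank_hom_act_star T]
  exact finrank_hom_congr k (actProj X (T.star F)) (Iso.refl M)

end FiatAction

/-! ### Cell preorders in terms of retracts -/

section Preorders

variable {C : Type u} [Bicategory.{w, v} C]

/-- Composition with a fixed `1`-morphism on the left preserves retracts. -/
def retractWhiskerLeft {i j l : C} (F : i ⟶ j) {G H : j ⟶ l} (r : Retract G H) :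
    Retract (F ≫ G) (F ≫ H) where
  i := F ◁ r.i
  r := F ◁ r.r
  retract := by rw [← whiskerLeft_comp, r.retract, whiskerLeft_id]

/-- Composition with a fixed `1`-morphism on the right preserves retracts. -/
def retractWhiskerRight {i j l : C} {G H : i ⟶ j} (r : Retract G H) (F : j ⟶ l) :
    Retract (G ≫ F) (H ≫ F) where
  i := r.i ▷ F
  r := r.r ▷ F
  retract := by rw [← comp_whiskerRight, r.retract, id_whiskerRight]

/-- `G` is a retract of some `H ∘ F`. -/
def RLe {i j l : C} (F : i ⟶ j) (G : i ⟶ l) : Prop := ∃ H : j ⟶ l, Nonempty (Retract G (F ≫ H))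

/-- `G` is a retract of some `F ∘ H`. -/
def LLe {i j l : C} (F : i ⟶ j) (G : l ⟶ j) : Prop := ∃ H : l ⟶ i, Nonempty (Retract G (H ≫ F))

/-- `G` is a retract of some `H₂ ∘ F ∘ H₁`. -/
def JLe {i j l m : C} (F : i ⟶ j) (G : l ⟶ m) : Prop :=
  ∃ (H₁ : l ⟶ i) (H₂ : j ⟶ m), Nonempty (Retract G (H₁ ≫ F ≫ H₂))

theorem RLe.of_retract {i j l : C} {F : i ⟶ j} {G : i ⟶ l} {H : j ⟶ l} (r : Retract G (F ≫ H)) :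
    RLe F G := ⟨H, ⟨r⟩⟩

theorem LLe.of_retract {i j l : C} {F : i ⟶ j} {G : l ⟶ j} {H : l ⟶ i} (r : Retract G (H ≫ F)) :
    LLe F G := ⟨H, ⟨r⟩⟩

theorem RLe.of_iso {i j : C} {F G : i ⟶ j} (e : F ≅ G) : RLe F G :=
  ⟨𝟙 j, ⟨.ofIso (e.symm ≪≫ (ρ_ F).symm)⟩⟩

theorem LLe.of_iso {i j : C} {F G : i ⟶ j} (e : F ≅ G) : LLe F G :=
  ⟨𝟙 i, ⟨.ofIso (e.symm ≪≫ (λ_ F).symm)⟩⟩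

theorem RLe.refl {i j : C} (F : i ⟶ j) : RLe F F := .of_iso (Iso.refl F)

theorem LLe.refl {i j : C} (F : i ⟶ j) : LLe F F := .of_iso (Iso.refl F)

theorem RLe.trans {i j l m : C} {F : i ⟶ j} {G : i ⟶ l} {H : i ⟶ m} (h : RLe F G) (h' : RLe G H) :
    RLe F H := by
  obtain ⟨X, ⟨r⟩⟩ := h
  obtain ⟨Y, ⟨s⟩⟩ := h'
  exact ⟨X ≫ Y, ⟨(s.trans (retractWhiskerRight r Y)).trans (.ofIso (α_ F X Y))⟩⟩

theorem LLe.trans {i j l m : C} {F : i ⟶ j} {G : l ⟶ j} {H : m ⟶ j} (h : LLe F G) (h' : LLe G H) :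
    LLe F H := by
  obtain ⟨X, ⟨r⟩⟩ := h
  obtain ⟨Y, ⟨s⟩⟩ := h'
  exact ⟨Y ≫ X, ⟨(s.trans (retractWhiskerLeft Y r)).trans (.ofIso (α_ Y X F).symm)⟩⟩

theorem RLe.jle {i j l : C} {F : i ⟶ j} {G : i ⟶ l} (h : RLe F G) : JLe F G := by
  obtain ⟨X, ⟨r⟩⟩ := h
  exact ⟨𝟙 i, X, ⟨r.trans (.ofIso (λ_ _).symm)⟩⟩

theorem LLe.jle {i j l : C} {F : i ⟶ j} {G : l ⟶ j} (h : LLe F G) : JLe F G := by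
  obtain ⟨X, ⟨r⟩⟩ := h
  exact ⟨X, 𝟙 j, ⟨r.trans (retractWhiskerLeft X (.ofIso (ρ_ F).symm))⟩⟩

theorem JLe.trans {i j i' j' l m : C} {F : i ⟶ j} {G : i' ⟶ j'} {H : l ⟶ m} (h : JLe F G)
    (h' : JLe G H) : JLe F H := by
  obtain ⟨X, X', ⟨r⟩⟩ := h
  obtain ⟨Y, Y', ⟨s⟩⟩ := h'
  refine ⟨Y ≫ X, X' ≫ Y', ⟨(s.trans (retractWhiskerLeft Y (retractWhiskerRight r Y'))).trans
    (.ofIso ?_)⟩⟩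
  exact whiskerLeftIso Y (α_ X (F ≫ X') Y' ≪≫ whiskerLeftIso X (α_ F X' Y')) ≪≫
    (α_ Y X _).symm

theorem JLe.refl {i j : C} (F : i ⟶ j) : JLe F F := (RLe.refl F).jle

theorem JLe.of_retract {i j : C} {F G : i ⟶ j} (r : Retract G F) : JLe F G :=
  ⟨𝟙 i, 𝟙 j, ⟨r.trans (.ofIso ((ρ_ F).symm ≪≫ (λ_ _).symm))⟩⟩

theorem RLe.comp {i j l : C} (F : i ⟶ j) (H : j ⟶ l) : RLe F (F ≫ H) := ⟨H, ⟨.refl _⟩⟩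

theorem LLe.comp {i j l : C} (H : l ⟶ i) (F : i ⟶ j) : LLe F (H ≫ F) := ⟨H, ⟨.refl _⟩⟩

section Star

variable (T : FiatStructure C)

theorem RLe.star {i j l : C} {F : i ⟶ j} {G : i ⟶ l} (h : RLe F G) :
    LLe (T.star F) (T.star G) := by
  obtain ⟨X, ⟨r⟩⟩ := h
  exact ⟨T.star X, ⟨(starRetract T r).trans (.ofIso (T.mapComp F X))⟩⟩

theorem LLe.star {i j l : C} {F : i ⟶ j} {G : l ⟶ j} (h : LLe F G) :
    RLe (T.star F) (T.star G) := by
  obtain ⟨X, ⟨r⟩⟩ := h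
  exact ⟨T.star X, ⟨(starRetract T r).trans (.ofIso (T.mapComp X F))⟩⟩

theorem JLe.star {i j l m : C} {F : i ⟶ j} {G : l ⟶ m} (h : JLe F G) :
    JLe (T.star F) (T.star G) := by
  obtain ⟨X, Y, ⟨r⟩⟩ := h
  exact ⟨T.star Y, T.star X, ⟨((starRetract T r).trans (.ofIso (T.mapComp X (F ≫ Y)))).trans
    (.ofIso (whiskerRightIso (T.mapComp F Y) (T.star X) ≪≫ α_ _ _ _))⟩⟩

theorem LLe.of_star_right {i j l : C} {F : i ⟶ j} {G : l ⟶ j} (h : RLe (T.star F) (T.star G)) :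
    LLe F G :=
  ((LLe.of_iso (T.starStar F).symm).trans (h.star T)).trans (.of_iso (T.starStar G))

end Star

variable [∀ i j : C, Preadditive (i ⟶ j)] [∀ i j : C, HasFiniteBiproducts (i ⟶ j)]

section

variable [∀ i j : C, IsIdempotentComplete (i ⟶ j)]

theorem leR_iff {i j l : C} {F : i ⟶ j} {G : i ⟶ l} : LeR F G ↔ RLe F G := by
  simp only [LeR, RLe, isSummand_iff]

theorem leL_iff {i j l : C} {F : i ⟶ j} {G : l ⟶ j} : LeL F G ↔ LLe F G := by
  simp only [LeL, LLe, isSummand_iff]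

theorem leLR_iff {i j l m : C} {F : i ⟶ j} {G : l ⟶ m} : LeLR F G ↔ JLe F G := by
  simp only [LeLR, JLe, isSummand_iff]

end

/-- The axioms of a strongly regular two-sided cell in terms of retracts. -/
structure StronglyRegular (Q : ∀ i j : C, Set (i ⟶ j)) : Prop where
  indec : ∀ {i j : C} {F : i ⟶ j}, F ∈ Q i j → Indecomposable F
  mem : ∀ {i j l m i' j' : C} {F : i ⟶ j} {G : l ⟶ m} {F' : i' ⟶ j'}, F ∈ Q i j → F' ∈ Q i' j' →
    Indecomposable G → JLe F G → JLe G F' → G ∈ Q l m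
  regular : ∀ {i j l : C} {F : i ⟶ j} {G : i ⟶ l}, F ∈ Q i j → G ∈ Q i l → RLe F G → RLe G F
  inter : ∀ {i j l m : C} (F : i ⟶ j) (G : l ⟶ m), F ∈ Q i j → G ∈ Q l m →
    ∃ K ∈ Q i m, RLe F K ∧ LLe G K
  unique : ∀ {i m : C} {K K' : i ⟶ m}, K ∈ Q i m → K' ∈ Q i m → RLe K K' → RLe K' K →
    LLe K K' → LLe K' K → Nonempty (K' ≅ K)

theorem IsStronglyRegular.stronglyRegular [∀ i j : C, IsIdempotentComplete (i ⟶ j)]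
    {Q : ∀ i j : C, Set (i ⟶ j)} (h : IsStronglyRegular Q) : StronglyRegular Q := by
  obtain ⟨⟨i₀, j₀, F₀, h0, hmem⟩, hreg, hinter⟩ := h
  simp only [leLR_iff] at hmem
  simp only [leR_iff] at hreg
  simp only [rightCell, leftCell, leL_iff, leR_iff, Set.mem_ofPred_eq] at hinter
  have hmem' : ∀ {i j l m i' j' : C} {F : i ⟶ j} {G : l ⟶ m} {F' : i' ⟶ j'}, F ∈ Q i j →
      F' ∈ Q i' j' → Indecomposable G → JLe F G → JLe G F' → G ∈ Q l m :=
    fun {_ _ _ _ _ _ F G F'} hF hF' hG h1 h2 => (hmem _ _ G).2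
      ⟨hG, ((hmem _ _ F).1 hF).2.1.trans h1, h2.trans ((hmem _ _ F').1 hF').2.2⟩
  refine ⟨fun hF => ((hmem _ _ _).1 hF).1, hmem', fun {_ _ _ F G} => hreg F G,
    fun F G hF hG => ?_, fun {_ _ K K'} hK hK' h1 h2 h3 h4 => ?_⟩
  · obtain ⟨K, ⟨⟨h1, h2, h3⟩, -, h4, -⟩, -⟩ := hinter F G hF hG
    exact ⟨K, hmem' hF hF h1 h2.jle h3.jle, h2, h4⟩
  -- K and K' both lie in the intersection of the right and the left cell of K, which is a single
  -- isomorphism class.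
  · obtain ⟨K'', -, hu⟩ := hinter K K hK hK
    have i1 := ((hmem _ _ K).1 hK).1
    have i2 := ((hmem _ _ K').1 hK').1
    obtain ⟨e⟩ := hu K' ⟨i2, h1, h2⟩ ⟨i2, h3, h4⟩
    obtain ⟨e'⟩ := hu K ⟨i1, .refl _, .refl _⟩ ⟨i1, .refl _, .refl _⟩
    exact ⟨e ≪≫ e'.symm⟩

end Preorders

/-! ### Morphisms which factor through small objects -/

section Small

variable {A : Type*} [Category A] [Preadditive A]

/-- `f` factors through an object satisfying `N`. -/
def FactorsThrough (N : A → Prop) {X Y : A} (f : X ⟶ Y) : Prop :=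
  ∃ (Z : A) (s : X ⟶ Z) (t : Z ⟶ Y), N Z ∧ s ≫ t = f

theorem FactorsThrough.comp_left {N : A → Prop} {W X Y : A} {f : X ⟶ Y} (h : FactorsThrough N f)
    (g : W ⟶ X) : FactorsThrough N (g ≫ f) := by
  obtain ⟨Z, s, t, hZ, rfl⟩ := h
  exact ⟨Z, g ≫ s, t, hZ, by simp⟩

theorem FactorsThrough.comp_right {N : A → Prop} {W X Y : A} {f : X ⟶ Y} (h : FactorsThrough N f)
    (g : Y ⟶ W) : FactorsThrough N (f ≫ g) := by
  obtain ⟨Z, s, t, hZ, rfl⟩ := h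
  exact ⟨Z, s, t ≫ g, hZ, by simp⟩

theorem FactorsThrough.add [HasBinaryBiproducts A] {N : A → Prop}
    (hN : ∀ Z Z', N Z → N Z' → N (Z ⊞ Z')) {X Y : A} {f g : X ⟶ Y} (hf : FactorsThrough N f)
    (hg : FactorsThrough N g) : FactorsThrough N (f + g) := by
  obtain ⟨Z, s, t, hZ, rfl⟩ := hf
  obtain ⟨Z', s', t', hZ', rfl⟩ := hg
  exact ⟨Z ⊞ Z', biprod.lift s s', biprod.desc t t', hN _ _ hZ hZ', by simp⟩

theorem FactorsThrough.add_sum [HasBinaryBiproducts A] {N : A → Prop}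
    (hN : ∀ Z Z', N Z → N Z' → N (Z ⊞ Z')) {X Y : A} {f : X ⟶ Y} (hf : FactorsThrough N f)
    {ι : Type*} (s : Finset ι) (g : ι → (X ⟶ Y)) (hg : ∀ a ∈ s, FactorsThrough N (g a)) :
    FactorsThrough N (f + ∑ a ∈ s, g a) := by
  induction s using Finset.cons_induction with
  | empty => simpa
  | cons a s ha ih =>
    rw [Finset.sum_cons, add_left_comm]
    exact (hg a (by simp)).add hN (ih fun b hb => hg b (by simp [hb]))

/-- Up to morphisms which factor through an object satisfying `N`, the object `X` is the direct sum
of `n` copies of `G`. -/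
def IsSumMod (N : A → Prop) (X G : A) (n : ℕ) : Prop :=
  ∃ (s : Fin n → (G ⟶ X)) (p : Fin n → (X ⟶ G)), (∀ a, s a ≫ p a = 𝟙 G) ∧
    (∀ a b, a ≠ b → s a ≫ p b = 0) ∧ FactorsThrough N (𝟙 X - ∑ a, p a ≫ s a)

theorem IsSumMod.of_fintype {N : A → Prop} {X G : A} {ι : Type*} [Fintype ι] (s : ι → (G ⟶ X))
    (p : ι → (X ⟶ G)) (h1 : ∀ a, s a ≫ p a = 𝟙 G) (h2 : ∀ a b, a ≠ b → s a ≫ p b = 0)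
    (h3 : FactorsThrough N (𝟙 X - ∑ a, p a ≫ s a)) : IsSumMod N X G (Fintype.card ι) := by
  let e := Fintype.equivFin ι
  refine ⟨fun a => s (e.symm a), fun a => p (e.symm a), fun a => h1 _, fun a b hab =>
    h2 _ _ (fun h => hab (e.symm.injective h)), ?_⟩
  rwa [e.symm.sum_comp (fun a => p a ≫ s a)]

theorem IsSumMod.of_iso {N : A → Prop} {X X' G G' : A} {n : ℕ} (h : IsSumMod N X G n)
    (e : X ≅ X') (e' : G ≅ G') : IsSumMod N X' G' n := by
  obtain ⟨s, p, h1, h2, h3⟩ := h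
  refine ⟨fun a => e'.inv ≫ s a ≫ e.hom, fun a => e.inv ≫ p a ≫ e'.hom, fun a => ?_,
    fun a b hab => ?_, ?_⟩
  · simp [reassoc_of% (h1 a)]
  · simp [reassoc_of% (h2 a b hab)]
  · convert (h3.comp_left e.inv).comp_right e.hom using 1
    simp [Preadditive.comp_sub, Preadditive.sub_comp, Preadditive.comp_sum, Preadditive.sum_comp]

theorem IsSumMod.map {B : Type*} [Category B] [Preadditive B] {N : A → Prop} {N' : B → Prop}
    (Φ : A ⥤ B) [Φ.Additive] (hN : ∀ Z, N Z → N' (Φ.obj Z)) {X G : A} {n : ℕ}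
    (h : IsSumMod N X G n) : IsSumMod N' (Φ.obj X) (Φ.obj G) n := by
  obtain ⟨s, p, h1, h2, Z, f, g, hZ, h3⟩ := h
  refine ⟨fun a => Φ.map (s a), fun a => Φ.map (p a), fun a => ?_, fun a b hab => ?_,
    Φ.obj Z, Φ.map f, Φ.map g, hN Z hZ, ?_⟩
  · rw [← Φ.map_comp, h1, Φ.map_id]
  · rw [← Φ.map_comp, h2 a b hab, Φ.map_zero]
  · rw [← Φ.map_comp, h3, Φ.map_sub, Φ.map_id, Φ.map_sum]
    simp

theorem IsSumMod.trans [HasBinaryBiproducts A] {N : A → Prop} (hN : ∀ Z Z', N Z → N Z' → N (Z ⊞ Z'))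
    {X G H : A} {n m : ℕ} (h : IsSumMod N X G n) (h' : IsSumMod N G H m) :
    IsSumMod N X H (n * m) := by
  obtain ⟨s, p, h1, h2, Z, f, g, hZ, h3⟩ := h
  obtain ⟨s', p', h1', h2', Z', f', g', hZ', h3'⟩ := h'
  have key : IsSumMod N X H (Fintype.card (Fin n × Fin m)) := by
    refine .of_fintype (fun a => s' a.2 ≫ s a.1) (fun a => p a.1 ≫ p' a.2) (fun a => ?_)
      (fun a b hab => ?_) ?_
    · simp [reassoc_of% (h1 a.1), h1']
    · by_cases hc : a.1 = b.1
      · rw [hc]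
        have : a.2 ≠ b.2 := fun h => hab (Prod.ext hc h)
        simp [reassoc_of% (h1 b.1), h2' _ _ this]
      · simp [reassoc_of% (h2 _ _ hc)]
    · have h4 : FactorsThrough N (𝟙 G - ∑ b, p' b ≫ s' b) := ⟨Z', f', g', hZ', h3'⟩
      have h5 := FactorsThrough.add_sum hN ⟨Z, f, g, hZ, h3⟩ Finset.univ
        (fun a => p a ≫ (𝟙 G - ∑ b, p' b ≫ s' b) ≫ s a)
        fun a _ => (h4.comp_right (s a)).comp_left (p a)
      convert h5 using 1
      rw [Fintype.sum_prod_type]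
      simp [Preadditive.comp_sub, Preadditive.sub_comp, Preadditive.comp_sum,
        Preadditive.sum_comp]
  simpa using key

/-- The remainder 𝟙 - ∑ p ≫ s factors through an object that has no nonzero maps to Y after applying
Φ, so for Hom(Φ -, Y) the object X is an honest direct sum of n copies of G. -/
theorem finrank_hom_of_isSumMod (k : Type*) [Field k] {N : A → Prop} {B : Type*} [Category B]
    [Preadditive B] [Linear k B] (Φ : A ⥤ B) [Φ.Additive] {X G : A} {n : ℕ}
    (h : IsSumMod N X G n) (Y : B) (hN : ∀ Z, N Z → ∀ f : Φ.obj Z ⟶ Y, f = 0)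
    [FiniteDimensional k (Φ.obj G ⟶ Y)] :
    Module.finrank k (Φ.obj X ⟶ Y) = n * Module.finrank k (Φ.obj G ⟶ Y) := by
  obtain ⟨s, p, h1, h2, Z, f, g, hZ, h3⟩ := h
  have h4 : ∀ x : Φ.obj X ⟶ Y, ∑ a, Φ.map (p a) ≫ Φ.map (s a) ≫ x = x := fun x => by
    have h5 : Φ.map (f ≫ g) ≫ x = 0 := by
      rw [Φ.map_comp, Category.assoc, hN Z hZ (Φ.map g ≫ x), comp_zero]
    rw [h3, Φ.map_sub, Φ.map_id, Preadditive.sub_comp, Category.id_comp, sub_eq_zero,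
      Φ.map_sum, Preadditive.sum_comp] at h5
    simpa using h5.symm
  let e : (Φ.obj X ⟶ Y) ≃ₗ[k] (Fin n → (Φ.obj G ⟶ Y)) :=
    { toFun := fun x a => Φ.map (s a) ≫ x
      invFun := fun y => ∑ a, Φ.map (p a) ≫ y a
      map_add' := fun x y => by ext a; simp
      map_smul' := fun c x => by ext a; simp
      left_inv := h4
      right_inv := fun y => by
        ext a
        change Φ.map (s a) ≫ ∑ b, Φ.map (p b) ≫ y b = y a
        rw [Preadditive.comp_sum, Finset.sum_eq_single a]
        · rw [← Category.assoc, ← Φ.map_comp, h1, Φ.map_id, Category.id_comp]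
        · intro b _ hb
          rw [← Category.assoc, ← Φ.map_comp, h2 a b hb.symm, Φ.map_zero, zero_comp]
        · simp }
  rw [e.finrank_eq, Module.finrank_pi_fintype]
  simp

/-- Decompositions into indecomposable objects which either satisfy `N` or are isomorphic
to `G`. -/
theorem exists_isSumMod (k : Type*) [Field k] [Linear k A] [HasFiniteBiproducts A]
    [FinitaryCategory k A] {N : A → Prop} (hN0 : ∀ Z, IsZero Z → N Z)
    (hN : ∀ Z Z', N Z → N Z' → N (Z ⊞ Z')) {X G : A}
    (h : ∀ Z, Indecomposable Z → Retract Z X → N Z ∨ Nonempty (Z ≅ G)) :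
    ∃ n, IsSumMod N X G n := by
  classical
  obtain ⟨ι, _, E, hE, s, p, h1, h2, h3⟩ := exists_indecomposable_decomposition k X
  obtain ⟨_⟩ : Nonempty (Fintype {a // Nonempty (E a ≅ G)}) := ⟨Fintype.ofFinite _⟩
  have e (a : {a // Nonempty (E a ≅ G)}) : E a ≅ G := a.2.some
  refine ⟨_, .of_fintype (ι := {a // Nonempty (E a ≅ G)}) (fun a => (e a).inv ≫ s a)
    (fun a => p a ≫ (e a).hom) (fun a => ?_) (fun a b hab => ?_) ?_⟩
  · simp [reassoc_of% (h1 a)]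
  · simp [reassoc_of% (h2 a b fun h => hab (Subtype.ext h))]
  · have h4 : FactorsThrough N (0 : X ⟶ X) := ⟨0, 0, 0, hN0 _ (isZero_zero A), by simp⟩
    have h5 := h4.add_sum hN (Finset.univ.filter fun a => ¬ Nonempty (E a ≅ G))
      (fun a => p a ≫ s a) fun a ha => by
        rcases h (E a) (hE a) ⟨s a, p a, h1 a⟩ with h6 | h6
        · exact ⟨E a, p a, s a, h6, rfl⟩
        · exact absurd h6 (Finset.mem_filter.1 ha).2
    convert h5 using 1
    rw [zero_add, ← h3, sub_eq_iff_eq_add',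
      ← Finset.sum_filter_add_sum_filter_not Finset.univ (fun a => Nonempty (E a ≅ G))]
    congr 1
    have h6 : ∑ a with Nonempty (E a ≅ G), p a ≫ s a =
        ∑ a : {a // Nonempty (E a ≅ G)}, p a ≫ s a := Finset.sum_subtype _ (by simp) _
    rw [h6]
    simp

theorem _root_.CategoryTheory.Indecomposable.retract_of_biprod (k : Type*) [Field k]
    [IsAlgClosed k] {B : Type*} [Category B] [Preadditive B] [Linear k B] [HasBinaryBiproducts A]
    [HasBinaryBiproducts B] [FinitaryCategory k B] (Φ : A ⥤ B) [Φ.Additive] {F : B}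
    (hF : Indecomposable F) {Z Z' : A} (r : Retract F (Φ.obj (Z ⊞ Z'))) :
    Nonempty (Retract F (Φ.obj Z)) ∨ Nonempty (Retract F (Φ.obj Z')) := by
  let f : ∀ b : Bool, F ⟶ Φ.obj (cond b Z Z')
    | true => r.i ≫ Φ.map biprod.fst
    | false => r.i ≫ Φ.map biprod.snd
  let g : ∀ b : Bool, Φ.obj (cond b Z Z') ⟶ F
    | true => Φ.map biprod.inl ≫ r.r
    | false => Φ.map biprod.inr ≫ r.r
  have hs : ∑ b, f b ≫ g b = 𝟙 F := by
    have h : (r.i ≫ Φ.map biprod.fst) ≫ Φ.map biprod.inl ≫ r.r +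
        (r.i ≫ Φ.map biprod.snd) ≫ Φ.map biprod.inr ≫ r.r = 𝟙 F := by
      have h0 : r.i ≫ Φ.map (𝟙 (Z ⊞ Z')) ≫ r.r = 𝟙 F := by simp
      rw [← biprod.total, Φ.map_add] at h0
      simpa using h0
    rwa [Fintype.sum_bool]
  obtain ⟨b, h⟩ := hF.retract_of_sum k f g hs
  cases b
  · exact .inr h
  · exact .inl h

end Small

/-! ### Killed `1`-morphisms -/

section Killed

variable {C : Type u} [Bicategory.{w, v} C]

/-- `Z ≰_LR Q`. -/
def Killed (Q : ∀ i j : C, Set (i ⟶ j)) {i j : C} (Z : i ⟶ j) : Prop :=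
  ∀ (l m : C) (F : l ⟶ m), F ∈ Q l m → ¬ JLe Z F

theorem Killed.of_jle {Q : ∀ i j : C, Set (i ⟶ j)} {i j l m : C} {Z : i ⟶ j} {Z' : l ⟶ m}
    (h : Killed Q Z) (hZ : JLe Z Z') : Killed Q Z' := fun _ _ F hF h' => h _ _ F hF (hZ.trans h')

theorem Killed.comp_right {Q : ∀ i j : C, Set (i ⟶ j)} {i j l : C} {Z : i ⟶ j}
    (h : Killed Q Z) (H : j ⟶ l) : Killed Q (Z ≫ H) := h.of_jle (RLe.comp Z H).jle

theorem Killed.comp_left {Q : ∀ i j : C, Set (i ⟶ j)} {i j l : C} {Z : i ⟶ j}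
    (h : Killed Q Z) (H : l ⟶ i) : Killed Q (H ≫ Z) := h.of_jle (LLe.comp H Z).jle

theorem Killed.of_retract {Q : ∀ i j : C, Set (i ⟶ j)} {i j : C} {Z X : i ⟶ j}
    (h : Killed Q X) (r : Retract Z X) : Killed Q Z := h.of_jle (.of_retract r)

variable [∀ i j : C, Preadditive (i ⟶ j)] [∀ i j : C, HasFiniteBiproducts (i ⟶ j)]

theorem StronglyRegular.not_killed {Q : ∀ i j : C, Set (i ⟶ j)} {i j : C} {F : i ⟶ j}
    (hF : F ∈ Q i j) : ¬ Killed Q F := fun h => h _ _ F hF (JLe.refl F)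

theorem StronglyRegular.mem_or_killed {Q : ∀ i j : C, Set (i ⟶ j)} (hQ : StronglyRegular Q)
    {i j l m : C} {F : i ⟶ j} {Z : l ⟶ m} (hF : F ∈ Q i j) (hZ : Indecomposable Z)
    (h : JLe F Z) : Z ∈ Q l m ∨ Killed Q Z := by
  by_cases hk : Killed Q Z
  · exact .inr hk
  · simp only [Killed, not_forall, not_not] at hk
    obtain ⟨_, _, F', hF', h'⟩ := hk
    exact .inl (hQ.mem hF hF' hZ h h')

variable (k : Type*) [Field k] [∀ i j : C, Linear k (i ⟶ j)] [IsFinitary k C]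

include k in
theorem postcomp_additive {i j l : C} (H : j ⟶ l) :
    ((postcomp i H : (i ⟶ j) ⥤ (i ⟶ l))).Additive where
  map_add {_ _ f g} := IsFinitary.add_whiskerRight (k := k) f g H

include k in
theorem precomp_additive {i j l : C} (H : i ⟶ j) :
    ((precomp l H : (j ⟶ l) ⥤ (i ⟶ l))).Additive where
  map_add {_ _ f g} := IsFinitary.whiskerLeft_add (k := k) H f g

variable [IsAlgClosed k]

include k in
-- An element of Q has a local endomorphism ring, so a summand of Y∘(Z ⊕ Z')∘X is a summand of one
-- of the two parts.
theorem StronglyRegular.killed_biprod {Q : ∀ i j : C, Set (i ⟶ j)} (hQ : StronglyRegular Q)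
    {i j : C} {Z Z' : i ⟶ j} (h : Killed Q Z) (h' : Killed Q Z') : Killed Q (Z ⊞ Z') := by
  rintro l m F hF ⟨X, Y, ⟨r⟩⟩
  let Φ : (i ⟶ j) ⥤ (l ⟶ m) := postcomp i Y ⋙ precomp m X
  have := postcomp_additive k (i := i) Y
  have := precomp_additive k (l := m) X
  rcases (hQ.indec hF).retract_of_biprod k Φ r with h1 | h1
  · exact h _ _ F hF ⟨X, Y, h1⟩
  · exact h' _ _ F hF ⟨X, Y, h1⟩

include k in
theorem StronglyRegular.killed_of_isZero {Q : ∀ i j : C, Set (i ⟶ j)} (hQ : StronglyRegular Q)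
    {i j : C} {Z : i ⟶ j} (h : IsZero Z) : Killed Q Z := by
  rintro l m F hF ⟨X, Y, ⟨r⟩⟩
  let Φ : (i ⟶ j) ⥤ (l ⟶ m) := postcomp i Y ⋙ precomp m X
  have := postcomp_additive k (i := i) Y
  have := precomp_additive k (l := m) X
  have h0 : IsZero (Φ.obj Z) := Φ.map_isZero h
  exact (hQ.indec hF).1 (h0.of_mono r.i)

theorem IsSumMod.star (T : FiatStructure C) {Q : ∀ i j : C, Set (i ⟶ j)}
    (hT : ∀ {i j : C} (Z : i ⟶ j), Killed Q Z → Killed Q (T.star Z)) {i j : C} {X G : i ⟶ j} {n : ℕ}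
    (h : IsSumMod (Killed Q) X G n) : IsSumMod (Killed Q) (T.star X) (T.star G) n := by
  obtain ⟨s, p, h1, h2, Z, f, g, hZ, h3⟩ := h
  refine ⟨fun a => T.map (p a), fun a => T.map (s a), fun a => ?_, fun a b hab => ?_,
    T.star Z, T.map g, T.map f, hT Z hZ, ?_⟩
  · rw [← T.map_comp, h1, T.map_id]
  · rw [← T.map_comp, h2 b a hab.symm, star_map_zero]
  · rw [← T.map_comp, h3, star_map_sub, T.map_id, star_map_sum]
    simp only [T.map_comp]

theorem dimAt_copies {A : Type*} [Category A] [Preadditive A] [Linear k A] [HasFiniteBiproducts A]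
    [FinitaryCategory k A] (n : ℕ) (G : A) (L : Freyd k A) :
    Freyd.dimAt (copies n G) L = n * Freyd.dimAt G L := by
  have h : IsDirectSum ((Freyd.projF k A).obj (copies n G)) fun _ => (Freyd.projF k A).obj G :=
    Freyd.IsDirectSum.map _ (X := copies n G) (E := fun _ : Fin n => G)
      ⟨biproduct.ι _, biproduct.π _, by simp, fun a b h => biproduct.ι_π_ne _ h, biproduct.total⟩
  rw [Freyd.dimAt, finrank_hom_of_isDirectSum k h fun _ => inferInstance]
  simp [Freyd.dimAt]

include k in
-- Let L be the simple top of P'_G. Killed objects have no summand isomorphic to G, so Hom(P'_-, L)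
-- vanishes on them and descends to the quotient by the ideal. There it takes dimension n on X and
-- n' on n' copies of G. Conversely, the splitting maps become inverse isomorphisms modulo the
-- ideal.
theorem isoMod_iff {Q : ∀ i j : C, Set (i ⟶ j)} (hQ : StronglyRegular Q) {i j : C} {X G : i ⟶ j}
    (hG : G ∈ Q i j) {n : ℕ} (h : IsSumMod (Killed Q) X G n) (n' : ℕ) :
    IsoMod Q X (copies n' G) ↔ n' = n := by
  have (i j : C) := FinitaryCategory.idempotentComplete k (A := i ⟶ j)
  obtain ⟨L, hL⟩ := Freyd.exists_isSimpleQuotient (k := k) (hQ.indec hG)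
  have hk {Z : i ⟶ j} (hZ : Killed Q Z) (f : (Freyd.projF k _).obj Z ⟶ L) : f = 0 := by
    by_contra hf
    obtain ⟨Y, hY, ⟨r⟩, h0⟩ := Freyd.exists_indecomposable_dimAt (Freyd.dimAt_ne_zero_iff.2 ⟨f, hf⟩)
    obtain ⟨e⟩ := Freyd.iso_of_dimAt_ne_zero (hQ.indec hG) hY hL h0
    exact StronglyRegular.not_killed hG (hZ.of_retract ((Retract.ofIso e.symm).trans r))
  have h1 := Freyd.dimAt_simpleQuotient (hQ.indec hG) hL
  constructor
  · rintro ⟨e⟩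
    let Ψ : (i ⟶ j) ⥤ (ModuleCat k)ᵒᵖ :=
      ((Freyd.projF k (i ⟶ j)).op ⋙ (linearYoneda k (Freyd k (i ⟶ j))).obj L).rightOp
    have hΨ : ∀ (X Y : i ⟶ j) (f g : X ⟶ Y), cellIdeal Q i j f g → Ψ.map f = Ψ.map g := by
      rintro X Y f g ⟨m, K, hK, s, t, h⟩
      have h0 (x : (Freyd.projF k _).obj (⨁ K) ⟶ L) : x = 0 := by
        have h1 : (Freyd.projF k _).map (𝟙 (⨁ K)) ≫ x = 0 := by
          rw [← biproduct.total, Functor.map_sum, Preadditive.sum_comp]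
          refine Finset.sum_eq_zero fun a _ => ?_
          have h2 : Killed Q (K a) := fun _ _ F hF h => (hK a).2 _ _ F hF (leLR_iff.2 h)
          rw [Functor.map_comp, Category.assoc, hk h2 ((Freyd.projF k _).map _ ≫ x), comp_zero]
        simpa using h1
      apply Quiver.Hom.unop_inj
      ext x
      change (Freyd.projF k _).obj Y ⟶ L at x
      change (Freyd.projF k _).map f ≫ x = (Freyd.projF k _).map g ≫ x
      rw [← sub_eq_zero, ← Preadditive.sub_comp, ← Functor.map_sub, h, Functor.map_comp,
        Category.assoc, h0 ((Freyd.projF k _).map t ≫ x), comp_zero]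
    let e' := (CategoryTheory.Quotient.lift _ Ψ hΨ).mapIso e
    have e'' := e'.unop.toLinearEquiv.finrank_eq
    have h2 : Freyd.dimAt (copies n' G) L = Freyd.dimAt X L := e''
    rw [dimAt_copies, h1, Freyd.dimAt, finrank_hom_of_isSumMod k _ h L fun Z hZ => hk hZ] at h2
    change _ = n * Freyd.dimAt G L at h2
    rwa [h1, mul_one, mul_one] at h2
  · rintro rfl
    obtain ⟨s, p, h2, h3, Z, f, g, hZ, h4⟩ := h
    obtain ⟨ι, _, E, hE, s', p', h5, h6, h7⟩ := exists_indecomposable_decomposition k Z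
    let e := Fintype.equivFin ι
    refine ⟨⟨(Quotient.functor _).map (biproduct.lift p), (Quotient.functor _).map
      (biproduct.desc s), ?_, ?_⟩⟩
    · rw [← Functor.map_comp, ← CategoryTheory.Functor.map_id]
      symm
      refine CategoryTheory.Quotient.sound _ ⟨Fintype.card ι, fun a => E (e.symm a), fun a => ⟨hE _,
        fun _ _ F hF h => (hZ.of_retract ⟨s' _, p' _, h5 (e.symm a)⟩) _ _ F hF (leLR_iff.1 h)⟩,
        biproduct.lift fun a => f ≫ p' (e.symm a), biproduct.desc fun a => s' (e.symm a) ≫ g, ?_⟩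
      have h8 : f ≫ g = ∑ a, f ≫ (p' a ≫ s' a) ≫ g := by
        rw [← Preadditive.comp_sum, ← Preadditive.sum_comp, h7, Category.id_comp]
      rw [biproduct.lift_desc, biproduct.lift_desc, ← h4, h8,
        ← e.symm.sum_comp (fun a => f ≫ (p' a ≫ s' a) ≫ g)]
      simp
    · rw [← Functor.map_comp, ← CategoryTheory.Functor.map_id]
      congr 1
      refine biproduct.hom_ext' _ _ fun a => biproduct.hom_ext _ _ fun b => ?_
      by_cases hab : a = b
      · subst hab
        simp [h2]
      · simp [h3 a b hab, biproduct.ι_π_ne _ hab]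

end Killed

/-! ### Generators of right cells -/

section Generator

theorem epi_of_proj_lift {k : Type*} [Field k] {A : Type*} [Category A] [Preadditive A] [Linear k A]
    [HasFiniteBiproducts A] {M N : Freyd k A} (f : M ⟶ N)
    (h : ∀ (X : A) (x : (Freyd.projF k A).obj X ⟶ N), ∃ y, y ≫ f = x) : Epi f where
  left_cancellation a b hab := Freyd.hom_ext fun X x => by
    obtain ⟨y, rfl⟩ := h X x
    rw [Category.assoc, hab, Category.assoc]

/-- An epimorphism is the cokernel of its kernel. -/
def isColimitOfEpi {B : Type*} [Category B] [Abelian B] {X Y : B} (p : X ⟶ Y) [Epi p] :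
    IsColimit (CokernelCofork.ofπ p (kernel.condition p)) :=
  Abelian.epiIsCokernelOfKernel (Fork.ofι (kernel.ι p) (by simp)) (kernelIsKernel p)

variable {k : Type*} [Field k] [IsAlgClosed k] {C : Type u} [Bicategory.{w, v} C]
  [∀ i j : C, Preadditive (i ⟶ j)] [∀ i j : C, Linear k (i ⟶ j)]
  [∀ i j : C, HasFiniteBiproducts (i ⟶ j)] [IsFinitary k C] (T : FiatStructure C)

theorem act_map_isZero_of_mono {i j l : C} (F : j ⟶ l) {M N : Freyd k (i ⟶ j)} (f : M ⟶ N) [Mono f]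
    (T : FiatStructure C) (h : IsZero ((act F).obj N)) : IsZero ((act F).obj M) := by
  have := act_map_mono T F f
  exact h.of_mono ((act F).map f)

theorem act_map_isZero_of_epi {i j l : C} (F : j ⟶ l) {M N : Freyd k (i ⟶ j)} (f : M ⟶ N) [Epi f]
    (T : FiatStructure C) (h : IsZero ((act F).obj M)) : IsZero ((act F).obj N) := by
  have := act_map_epi T F f
  exact h.of_epi ((act F).map f)

include T in
/-- The action of `1`-morphisms is exact in the middle. -/
theorem act_isZero_of_kernel {i j l : C} (F : j ⟶ l) {M N : Freyd k (i ⟶ j)} (p : M ⟶ N) [Epi p]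
    (h1 : IsZero ((act F).obj (kernel p))) (h2 : IsZero ((act F).obj N)) :
    IsZero ((act F).obj M) := by
  have := act_map_epi_of_isZero T F (kernel.ι p) p (kernel.condition p)
    (isColimitOfEpi p) h2
  exact h1.of_epi ((act F).map (kernel.ι p))

include T in
/-- A module whose simple subquotients are annihilated is annihilated. -/
theorem act_isZero_of_subquotients {i j l : C} (F : j ⟶ l) (M : Freyd k (i ⟶ j))
    (h : ∀ S, Simple S → IsSubquotient S M → IsZero ((act F).obj S)) :
    IsZero ((act F).obj M) := by
  induction hn : Freyd.size M using Nat.strong_induction_on generalizing M with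
  | _ n ih =>
  by_cases hM : IsZero M
  · exact (act F).map_isZero hM
  obtain ⟨S, p, hS, hp⟩ := Freyd.exists_simple_quotient hM
  have h1 : Freyd.size S ≠ 0 := fun h0 => Simple.not_isZero S (Freyd.size_eq_zero_iff.1 h0)
  have h2 := Freyd.size_kernel p
  refine act_isZero_of_kernel T F p (ih (Freyd.size (kernel p)) (by omega) _ ?_ rfl)
    (h S hS ⟨M, 𝟙 M, p, inferInstance, hp⟩)
  rintro S' hS' ⟨N, f, g, hf, hg⟩
  exact h S' hS' ⟨N, f ≫ kernel.ι p, g, mono_comp _ _, hg⟩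

/-- The image of `0 ⟶ 1` under `F` is `0 ⟶ F`. -/
def actProjId {i l : C} (F : i ⟶ l) :
    (act F).obj ((Freyd.projF k (i ⟶ i)).obj (𝟙 i)) ≅ (Freyd.projF k (i ⟶ l)).obj F :=
  actProj (𝟙 i) F ≪≫ (Freyd.projF k (i ⟶ l)).mapIso (λ_ F)

/-- `act` preserves retracts in the `1`-morphism. -/
def actRetract {i j l : C} {F G : j ⟶ l} (r : Retract F G) (M : Freyd k (i ⟶ j)) :
    Retract ((act F).obj M) ((act G).obj M) := r.map (actOn M)

theorem act_isZero_of_rle {i j l m : C} {F : j ⟶ l} {G : j ⟶ m} (h : RLe F G)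
    {M : Freyd k (i ⟶ j)} (hM : IsZero ((act F).obj M)) : IsZero ((act G).obj M) := by
  obtain ⟨X, ⟨r⟩⟩ := h
  have h1 : IsZero ((act (F ≫ X)).obj M) := ((act X).map_isZero hM).of_iso (actComp F X M)
  exact h1.of_mono (actRetract r M).i

namespace IsCellGenerator

variable {T}
variable {i : C} {R : ∀ l : C, Set (i ⟶ l)} {G : i ⟶ i} {L : Freyd k (i ⟶ i)}

include T in
-- F annihilates P'_1/K, so exactness identifies F K with F P'_1 ≅ P'_F. A lift of P'_G ⟶ L to K is
-- onto, because a simple quotient of its cokernel would be a second top of K.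
theorem exists_cover (h : IsCellGenerator R G L) :
    ∃ (K : Freyd k (i ⟶ i)) (p : K ⟶ L) (q : (Freyd.projF k (i ⟶ i)).obj G ⟶ K),
      Epi p ∧ Epi q ∧ ∀ l, ∀ F ∈ R l,
        Nonempty ((act F).obj K ≅ (Freyd.projF k (i ⟶ l)).obj F) := by
  obtain ⟨hG, ⟨hL, p₀, hp₀⟩, K, M, ι, π, z, hι, ⟨hc⟩, hM, ⟨-, p, hp, hu⟩, -⟩ := h
  change (Freyd.projF k (i ⟶ i)).obj G ⟶ L at p₀
  change K ⟶ (Freyd.projF k (i ⟶ i)).obj (𝟙 i) at ι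
  change Epi p₀ at hp₀
  change Mono ι at hι
  refine ⟨K, p, Projective.factorThru p₀ p, hp, ?_, fun l F hF => ?_⟩
  · refine Freyd.epi_of_isZero_cokernel _ (by_contra fun h0 => ?_)
    obtain ⟨S, s, hS, hs⟩ := Freyd.exists_simple_quotient h0
    obtain ⟨e, he⟩ := hu S (cokernel.π _ ≫ s) hS (epi_comp _ _)
    have h1 : p₀ = 0 := by
      rw [← cancel_mono e.hom, zero_comp, ← Projective.factorThru_comp p₀ p, Category.assoc, he,
        cokernel.condition_assoc, zero_comp]
    exact Simple.not_isZero L (IsZero.of_epi_eq_zero p₀ h1)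
  · have h0 := act_isZero_of_subquotients T F M fun S hS hSM => hM S hS hSM l F hF
    have h1 := act_map_epi_of_isZero T F ι π z hc h0
    have h2 := act_map_mono T F ι
    have h3 : IsIso ((act F).map ι) := isIso_of_mono_of_epi _
    exact ⟨asIso ((act F).map ι) ≪≫ actProjId F⟩

include T in
/-- `F L` is a quotient of `0 ⟶ F`. -/
theorem exists_epi (h : IsCellGenerator R G L) {l : C} {F : i ⟶ l} (hF : F ∈ R l) :
    ∃ p : (Freyd.projF k (i ⟶ l)).obj F ⟶ (act F).obj L, Epi p := by
  obtain ⟨K, p, q, hp, hq, hK⟩ := h.exists_cover (T := T)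
  obtain ⟨e⟩ := hK l F hF
  have := act_map_epi T F p
  exact ⟨e.inv ≫ (act F).map p, epi_comp _ _⟩

theorem not_isZero (h : IsCellGenerator R G L) {l : C} {F : i ⟶ l} (hF : F ∈ R l) :
    ¬ IsZero ((act F).obj L) := by
  obtain ⟨hG, -, K, M, ι, π, z, hι, -, -, -, h⟩ := h
  exact h l F hF

include T in
-- Applying F to P'_G ↠ K gives an epimorphism from P'_{F∘G} onto the projective P'_F, which splits.
theorem retract_comp (h : IsCellGenerator R G L) {l : C} {F : i ⟶ l} (hF : F ∈ R l) :
    Nonempty (Retract F (G ≫ F)) := by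
  obtain ⟨K, p, q, hp, hq, hK⟩ := h.exists_cover (T := T)
  obtain ⟨e⟩ := hK l F hF
  have := act_map_epi T F q
  have h1 : Epi ((actProj (k := k) G F).inv ≫ (act F).map q ≫ e.hom) := inferInstance
  obtain ⟨y, hy⟩ := Freyd.proj_lift ((actProj (k := k) G F).inv ≫ (act F).map q ≫ e.hom)
    (𝟙 ((Freyd.projF k (i ⟶ l)).obj F))
  exact ⟨⟨(Freyd.projF k (i ⟶ l)).preimage y, (Freyd.projF k (i ⟶ l)).preimage _,
    (Freyd.projF k (i ⟶ l)).map_injective (by simpa using hy)⟩⟩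

include T in
-- F L is a nonzero quotient of P'_F, so L(F^*∘F) = (F L)(F) ≠ 0; some indecomposable summand of
-- F^*∘F therefore maps onto L, and only G does.
theorem retract_comp_star (h : IsCellGenerator R G L) {l : C} {F : i ⟶ l} (hF : F ∈ R l) :
    Nonempty (Retract G (F ≫ T.star F)) := by
  obtain ⟨p, hp⟩ := h.exists_epi (T := T) hF
  have h1 : Freyd.dimAt F ((act F).obj L) ≠ 0 :=
    Freyd.dimAt_ne_zero_iff.2 ⟨p, fun h0 => h.not_isZero hF (IsZero.of_epi_eq_zero p h0)⟩
  rw [dimAt_act T] at h1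
  obtain ⟨Z, hZ, ⟨r⟩, h2⟩ := Freyd.exists_indecomposable_dimAt h1
  obtain ⟨e⟩ := Freyd.iso_of_dimAt_ne_zero h.1 hZ h.2.1 h2
  exact ⟨(Retract.ofIso e.symm).trans r⟩

end IsCellGenerator

/-- Generators exist: the set of indecomposables `R` has to be closed under `∼_R`. -/
theorem exists_isCellGenerator (T : FiatStructure C) {i : C} (R : ∀ l : C, Set (i ⟶ l))
    (hR : ∀ l, ∀ F ∈ R l, Indecomposable F)
    (hR' : ∀ l, ∀ F ∈ R l, ∀ l', ∀ F' ∈ R l', RLe F F') {l₀ : C} {F₀ : i ⟶ l₀} (hF₀ : F₀ ∈ R l₀) :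
    ∃ (G : i ⟶ i) (L : Freyd k (i ⟶ i)), IsCellGenerator R G L := by
  let P := (Freyd.projF k (i ⟶ i)).obj (𝟙 i)
  -- Sizes of the quotients of P'_1 annihilated by R. A quotient M of maximal size is chosen, and K
  -- is its kernel.
  let Good : ℕ → Prop := fun n => ∃ (M : Freyd k (i ⟶ i)) (π : P ⟶ M), Epi π ∧
    (∀ l, ∀ F ∈ R l, IsZero ((act F).obj M)) ∧ Freyd.size M = n
  have hbd : ∀ n, Good n → n ≤ Freyd.size P := by
    rintro n ⟨M, π, hπ, -, rfl⟩
    exact Freyd.size_le_of_epi π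
  have h0 : Good 0 := ⟨0, 0, ⟨fun _ _ _ => (isZero_zero _).eq_of_src _ _⟩,
    fun l F _ => (act F).map_isZero (isZero_zero _), Freyd.size_eq_zero_iff.2 (isZero_zero _)⟩
  obtain ⟨n, ⟨M, π, hπ, hM, hn⟩, hmax⟩ : ∃ n, Good n ∧ ∀ n', Good n' → n' ≤ n := by
    classical
    exact ⟨Nat.findGreatest Good (Freyd.size P), Nat.findGreatest_spec (Nat.zero_le _) h0,
      fun n' h' => Nat.le_findGreatest (hbd n' h') h'⟩
  have hc := isColimitOfEpi π
  have hK (l) (F) (hF : F ∈ R l) :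
      Nonempty ((act F).obj (kernel π) ≅ (Freyd.projF k (i ⟶ l)).obj F) := by
    have h1 := act_map_epi_of_isZero T F (kernel.ι π) π _ hc (hM l F hF)
    have h2 := act_map_mono T F (kernel.ι π)
    have h3 : IsIso ((act F).map (kernel.ι π)) := isIso_of_mono_of_epi _
    exact ⟨asIso ((act F).map (kernel.ι π)) ≪≫ actProjId F⟩
  have hK0 : ¬ IsZero (kernel π) := fun h => by
    obtain ⟨e⟩ := hK l₀ F₀ hF₀
    exact (hR l₀ F₀ hF₀).1 (Freyd.projF_isZero_iff.1 (((act F₀).map_isZero h).of_iso e.symm))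
  -- If one F annihilated a simple quotient S of K, all of R would. The quotient of P'_1 by ker(K ⟶
  -- S) would then also be annihilated, being an extension of M by a quotient of S, and it would be
  -- larger than M.
  have hS (S : Freyd k (i ⟶ i)) (q : kernel π ⟶ S) (hS : Simple S) (hq : Epi q) (l) (F)
      (hF : F ∈ R l) : ¬ IsZero ((act F).obj S) := by
    intro hFS
    have hS0 : Freyd.size S ≠ 0 := fun h0 => Simple.not_isZero S (Freyd.size_eq_zero_iff.1 h0)
    let κ := kernel.ι q ≫ kernel.ι π
    have e1 := Freyd.size_kernel q
    have e2 := Freyd.size_kernel π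
    have e3 := Freyd.size_cokernel κ
    let d : cokernel κ ⟶ M := cokernel.desc κ π (by simp [κ])
    have : Epi (cokernel.π κ ≫ d) := by simpa [d] using hπ
    have : Epi d := epi_of_epi (cokernel.π κ) d
    have e4 := Freyd.size_kernel d
    let t : kernel π ⟶ kernel d := kernel.lift d (kernel.ι π ≫ cokernel.π κ) (by simp [d])
    have ht : Epi t := epi_of_proj_lift t fun X x => by
      obtain ⟨y, hy⟩ := Freyd.proj_lift (cokernel.π κ) (x ≫ kernel.ι d)
      refine ⟨kernel.lift π y ?_, ?_⟩
      · have : cokernel.π κ ≫ d = π := by simp [d]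
        rw [← this, reassoc_of% hy, kernel.condition, comp_zero]
      · rw [← cancel_mono (kernel.ι d)]
        simp [t, hy]
    have hkt : kernel.ι q ≫ t = 0 := by
      rw [← cancel_mono (kernel.ι d), Category.assoc, kernel.lift_ι, zero_comp, ← Category.assoc]
      exact cokernel.condition κ
    let t' : S ⟶ kernel d := Abelian.epiDesc q t hkt
    have ht' : Epi (q ≫ t') := by
      rwa [Abelian.comp_epiDesc]
    have : Epi t' := epi_of_epi q t'
    have := hmax _ ⟨cokernel κ, cokernel.π κ, inferInstance, fun l' F' hF' =>
      act_isZero_of_kernel T F' d (act_map_isZero_of_epi F' t' T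
        (act_isZero_of_rle (hR' l F hF l' F' hF') hFS)) (hM l' F' hF'), rfl⟩
    change Freyd.size P = _ at e2
    change Freyd.size P = _ at e3
    omega
  obtain ⟨L, p, hL, hp⟩ := Freyd.exists_simple_quotient hK0
  obtain ⟨G, hG, hGL⟩ := Freyd.exists_simpleQuotient_of_simple hL
  refine ⟨G, L, hG, hGL, kernel π, M, kernel.ι π, π, kernel.condition π,
    inferInstanceAs (Mono (kernel.ι π)), ⟨hc⟩,
    ?_, ⟨hL, p, hp, ?_⟩, hS L p hL hp⟩
  · rintro S - ⟨N, f, g, hf, hg⟩ l F hF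
    exact act_map_isZero_of_epi F g T (act_map_isZero_of_mono F f T (hM l F hF))
  · intro S q hSs hq
    -- Otherwise ker p maps onto S. Then F₀(ker p) ⟶ F₀ K ≅ P'_{F₀} is onto the nonzero quotient F₀
    -- S, hence split, so F₀ p = 0, contradicting F₀ L ≠ 0.
    have h1 : kernel.ι p ≫ q = 0 := by
      by_contra h1
      have h2 : Epi (kernel.ι p ≫ q) := epi_of_nonzero_to_simple h1
      obtain ⟨e⟩ := hK l₀ F₀ hF₀
      have h3 := act_map_epi T F₀ (kernel.ι p ≫ q)
      have h4 : Epi (((act F₀).map (kernel.ι p) ≫ e.hom) ≫ e.inv ≫ (act F₀).map q) := by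
        simpa using h3
      obtain ⟨s, hs⟩ := Freyd.exists_section_of_epi_comp (hR _ _ hF₀)
        ((act F₀).map (kernel.ι p) ≫ e.hom) (e.inv ≫ (act F₀).map q)
        (hS S q hSs hq _ _ hF₀)
      have h5 : (act F₀).map p = 0 := by
        rw [← cancel_epi e.inv, comp_zero, ← Category.id_comp (e.inv ≫ _), ← hs]
        simp [← CategoryTheory.Functor.map_comp]
      have h6 := act_map_epi T F₀ p
      exact hS L p hL hp _ _ hF₀ (IsZero.of_epi_eq_zero _ h5)
    let e : L ⟶ S := Abelian.epiDesc p q h1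
    have he : p ≫ e = q := Abelian.comp_epiDesc _ _ _
    have h2 : e ≠ 0 := fun h0 => by
      rw [h0, comp_zero] at he
      exact Simple.not_isZero S (IsZero.of_epi_eq_zero q he.symm)
    have := isIso_of_hom_simple h2
    exact ⟨asIso e, he⟩

end Generator

/-! ### Multiplicities -/

namespace StronglyRegular

section Basic

variable {C : Type u} [Bicategory.{w, v} C]
  [∀ i j : C, Preadditive (i ⟶ j)] [∀ i j : C, HasFiniteBiproducts (i ⟶ j)]
  {Q : ∀ i j : C, Set (i ⟶ j)} (hQ : StronglyRegular Q)

include hQ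

theorem mem_rightCell_iff [∀ i j : C, IsIdempotentComplete (i ⟶ j)] {i j l : C} {F : i ⟶ j}
    {G : i ⟶ l} (hF : F ∈ Q i j) : G ∈ rightCell F l ↔ G ∈ Q i l ∧ RLe F G := by
  simp only [rightCell, Set.mem_ofPred_eq, leR_iff]
  exact ⟨fun h => ⟨hQ.mem hF hF h.1 h.2.1.jle h.2.2.jle, h.2.1⟩,
    fun h => ⟨hQ.indec h.1, h.2, hQ.regular hF h.1 h.2⟩⟩

end Basic

section Fiat

variable (k : Type*) [Field k] [IsAlgClosed k] {C : Type u} [Bicategory.{w, v} C]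
  [∀ i j : C, Preadditive (i ⟶ j)] [∀ i j : C, Linear k (i ⟶ j)]
  [∀ i j : C, HasFiniteBiproducts (i ⟶ j)] [IsFinitary k C] (T : FiatStructure C)
  {Q : ∀ i j : C, Set (i ⟶ j)} (hQ : StronglyRegular Q)

include k in
theorem idempotentComplete (i j : C) : IsIdempotentComplete (i ⟶ j) :=
  FinitaryCategory.idempotentComplete k

include T hQ

/-- Generators of right cells exist. -/
theorem exists_generator {i j : C} {F : i ⟶ j} (hF : F ∈ Q i j) :
    ∃ (G : i ⟶ i) (L : Freyd k (i ⟶ i)), IsCellGenerator (rightCell F) G L := by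
  have (i j : C) := idempotentComplete k i j
  refine exists_isCellGenerator T (rightCell F) (fun l F' h => h.1) (fun l F' h l' F'' h' => ?_)
    ((hQ.mem_rightCell_iff hF).2 ⟨hF, RLe.refl F⟩)
  rw [hQ.mem_rightCell_iff hF] at h h'
  exact (hQ.regular hF h.1 h.2).trans h'.2

include k

theorem exists_retracts {i j : C} {F : i ⟶ j} (hF : F ∈ Q i j) :
    ∃ G ∈ Q i i, RLe F G ∧ ∀ {l : C} {F' : i ⟶ l}, F' ∈ Q i l → RLe F F' →
      Nonempty (Retract F' (G ≫ F')) ∧ Nonempty (Retract G (F' ≫ T.star F')) := by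
  have (i j : C) := idempotentComplete k i j
  obtain ⟨G, L, h⟩ := exists_generator k T hQ hF
  have h1 {l : C} {F' : i ⟶ l} (hF' : F' ∈ Q i l) (hFF' : RLe F F') :=
    (hQ.mem_rightCell_iff hF).2 ⟨hF', hFF'⟩
  obtain ⟨r⟩ := h.retract_comp (T := T) (h1 hF (RLe.refl F))
  obtain ⟨s⟩ := h.retract_comp_star (T := T) (h1 hF (RLe.refl F))
  exact ⟨G, hQ.mem hF hF h.1 (RLe.of_retract s).jle (RLe.of_retract r).jle, RLe.of_retract s,
    fun hF' hFF' => ⟨h.retract_comp (T := T) (h1 hF' hFF'),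
      h.retract_comp_star (T := T) (h1 hF' hFF')⟩⟩

/-- With G from `exists_retracts`: since G is a summand of F^*∘F, both F^* ≤ G and, dually, F ≤ G^*;
since F is a summand of F∘G, also G^* ≤ F^*. So F ≤ F^* ≤ G lies between elements of Q. -/
theorem star_mem {i j : C} {F : i ⟶ j} (hF : F ∈ Q i j) : T.star F ∈ Q j i := by
  have (i j : C) := idempotentComplete k i j
  obtain ⟨G, hG, -, h⟩ := exists_retracts k T hQ hF
  obtain ⟨⟨r⟩, ⟨s⟩⟩ := h hF (RLe.refl F)
  have h1 : LLe (T.star F) G := .of_retract s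
  have h2 : JLe (T.star G) (T.star F) := (RLe.of_retract r).jle.star T
  have h3 : JLe F (T.star G) := ((RLe.of_iso (T.starStar F).symm).trans (h1.star T)).jle
  exact hQ.mem hF hG (star_indecomposable T (hQ.indec hF)) (h3.trans h2) h1.jle

theorem lregular {i j l : C} {F : i ⟶ j} {G : l ⟶ j} (hF : F ∈ Q i j) (hG : G ∈ Q l j)
    (h : LLe F G) : LLe G F :=
  .of_star_right T (hQ.regular (star_mem k T hQ hF) (star_mem k T hQ hG) (h.star T))

theorem mem_leftCell_iff {i j l : C} {F : i ⟶ j} {G : l ⟶ j} (hF : F ∈ Q i j) :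
    G ∈ leftCell F l ↔ G ∈ Q l j ∧ LLe F G := by
  have (i j : C) := idempotentComplete k i j
  simp only [leftCell, Set.mem_ofPred_eq, leL_iff]
  exact ⟨fun h => ⟨hQ.mem hF hF h.1 h.2.1.jle h.2.2.jle, h.2.1⟩,
    fun h => ⟨hQ.indec h.1, h.2, lregular k T hQ hF h.1 h.2⟩⟩

theorem killed_star {i j : C} {Z : i ⟶ j} (hZ : Killed Q Z) : Killed Q (T.star Z) :=
  fun _ _ _ hF h => hZ _ _ _ (star_mem k T hQ hF)
    ((JLe.of_retract (.ofIso (T.starStar Z))).trans (h.star T))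

/-- Elements in the same right and left cell are isomorphic. -/
theorem iso_of_le {i j : C} {F G : i ⟶ j} (hF : F ∈ Q i j) (hG : G ∈ Q i j) (h : RLe F G)
    (h' : LLe F G) : Nonempty (G ≅ F) :=
  hQ.unique hF hG h (hQ.regular hF hG h) h' (lregular k T hQ hF hG h')

/-- Every right cell contains a self-dual element. -/
theorem exists_selfDual {i j : C} {F : i ⟶ j} (hF : F ∈ Q i j) :
    ∃ D ∈ Q i i, Nonempty (D ≅ T.star D) ∧ RLe F D ∧
      ∀ {l : C} {F' : i ⟶ l}, F' ∈ Q i l → RLe F F' →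
      Nonempty (Retract F' (D ≫ F')) ∧ Nonempty (Retract D (F' ≫ T.star F')) := by
  obtain ⟨G, hG, hFG, h⟩ := exists_retracts k T hQ hF
  refine ⟨G, hG, ?_, hFG, h⟩
  -- Applied to G itself: G is a summand of G^*∘G, so G^* ≤_L G and dually G ≤_R G^*. Hence G and
  -- G^* share both cells and are isomorphic.
  obtain ⟨-, ⟨s⟩⟩ := h hG hFG
  have hG' := star_mem k T hQ hG
  have h1 : LLe (T.star G) G := .of_retract s
  have h2 : RLe G (T.star G) := (RLe.of_iso (T.starStar G).symm).trans (h1.star T)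
  obtain ⟨e⟩ := iso_of_le k T hQ hG hG' h2 (lregular k T hQ hG' hG h1)
  exact ⟨e.symm⟩

/-- Self-dual elements of a right cell. -/
theorem lle_of_selfDual {i j : C} {F : i ⟶ j} {D : i ⟶ i} (e : D ≅ T.star D) (h : RLe F D) :
    LLe (T.star F) D := (h.star T).trans (.of_iso e.symm)

theorem selfDual_unique {i : C} {D H : i ⟶ i} (hD : D ∈ Q i i) (hH : H ∈ Q i i)
    (eD : D ≅ T.star D) (eH : H ≅ T.star H) (h : RLe D H) : Nonempty (H ≅ D) :=
  iso_of_le k T hQ hD hH h (((LLe.of_iso eD).trans (h.star T)).trans (.of_iso eH.symm))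

theorem selfDual_retracts {i j : C} {F : i ⟶ j} {D : i ⟶ i} (hF : F ∈ Q i j) (hD : D ∈ Q i i)
    (eD : D ≅ T.star D) (h : RLe F D) :
    Nonempty (Retract F (D ≫ F)) ∧ Nonempty (Retract D (F ≫ T.star F)) := by
  obtain ⟨D', hD', ⟨eD'⟩, hF', h'⟩ := exists_selfDual k T hQ hF
  obtain ⟨e⟩ := selfDual_unique k T hQ hD' hD eD' eD ((hQ.regular hF hD' hF').trans h)
  obtain ⟨⟨r⟩, ⟨s⟩⟩ := h' hF (RLe.refl F)
  exact ⟨⟨r.trans (retractWhiskerRight (.ofIso e.symm) F)⟩, ⟨(Retract.ofIso e).trans s⟩⟩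

/-- An indecomposable summand of H∘F is ≥_R F and ≥_L H. If it is not killed it lies in Q, and by
regularity it lies in the right cell of F and the left cell of H, so it is isomorphic to Z. -/
theorem exists_isSumMod_comp {i j l : C} {F : i ⟶ j} {H : j ⟶ l} {Z : i ⟶ l} (hF : F ∈ Q i j)
    (hH : H ∈ Q j l) (hZ : Z ∈ Q i l) (h : RLe F Z) (h' : LLe H Z) :
    ∃ n, IsSumMod (Killed Q) (F ≫ H) Z n := by
  refine exists_isSumMod k (fun _ => hQ.killed_of_isZero k) (fun _ _ => hQ.killed_biprod k)
    fun Y hY r => ?_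
  have h1 := RLe.of_retract r
  have h2 := LLe.of_retract r
  rcases hQ.mem_or_killed hF hY h1.jle with h3 | h3
  · exact .inr (iso_of_le k T hQ hZ h3 ((hQ.regular hF hZ h).trans h1)
      ((lregular k T hQ hH hZ h').trans h2))
  · exact .inl h3

end Fiat

end StronglyRegular

section Mult

variable (k : Type*) [Field k] [IsAlgClosed k] {C : Type u} [Bicategory.{w, v} C]
  [∀ i j : C, Preadditive (i ⟶ j)] [∀ i j : C, Linear k (i ⟶ j)]
  [∀ i j : C, HasFiniteBiproducts (i ⟶ j)] [IsFinitary k C] (T : FiatStructure C)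
  (Q : ∀ i j : C, Set (i ⟶ j))

open Classical in
/-- The multiplicity `m_{F,H}`. -/
def mult ⦃i j l : C⦄ (F : i ⟶ j) (H : l ⟶ j) : ℕ :=
  -- For F and H in Q such an n exists, so the value 0 outside this case never enters; n depends
  -- neither on the choice of Z nor on that of the decomposition.
  if h : ∃ (n : ℕ) (Z : i ⟶ l), Z ∈ Q i l ∧ RLe F Z ∧ LLe (T.star H) Z ∧
    IsSumMod (Killed Q) (F ≫ T.star H) Z n then h.choose else 0

variable {Q} (hQ : StronglyRegular Q)

namespace StronglyRegular

include k hQ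

theorem isSumMod_unique {i j : C} {X G : i ⟶ j} (hG : G ∈ Q i j) {n n' : ℕ}
    (h : IsSumMod (Killed Q) X G n) (h' : IsSumMod (Killed Q) X G n') : n = n' := by
  rw [← isoMod_iff k hQ hG h', isoMod_iff k hQ hG h]

include T

theorem isSumMod_mult {i j l : C} {F : i ⟶ j} {H : l ⟶ j} {Z : i ⟶ l} (hF : F ∈ Q i j)
    (hH : H ∈ Q l j) (hZ : Z ∈ Q i l) (h : RLe F Z) (h' : LLe (T.star H) Z) :
    IsSumMod (Killed Q) (F ≫ T.star H) Z (mult T Q F H) := by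
  have hH' := star_mem k T hQ hH
  have h0 : ∃ (n : ℕ) (Z : i ⟶ l), Z ∈ Q i l ∧ RLe F Z ∧ LLe (T.star H) Z ∧
      IsSumMod (Killed Q) (F ≫ T.star H) Z n := by
    obtain ⟨n, hn⟩ := exists_isSumMod_comp k T hQ hF hH' hZ h h'
    exact ⟨n, Z, hZ, h, h', hn⟩
  rw [mult, dif_pos h0]
  obtain ⟨Z', hZ', h1, h2, h3⟩ := h0.choose_spec
  obtain ⟨e⟩ := iso_of_le k T hQ hZ hZ' ((hQ.regular hF hZ h).trans h1)
    ((lregular k T hQ hH' hZ h').trans h2)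
  exact h3.of_iso (Iso.refl _) e

/-- `F^* ∘ F` is a multiple of the self-dual element of the right cell of `F`. -/
theorem isSumMod_selfDual {i j : C} {F H : i ⟶ j} {D : i ⟶ i} (hF : F ∈ Q i j) (hH : H ∈ Q i j)
    (hFH : RLe F H) (hD : D ∈ Q i i) (eD : D ≅ T.star D) (h : RLe F D) :
    IsSumMod (Killed Q) (F ≫ T.star H) D (mult T Q F H) :=
  isSumMod_mult k T hQ hF hH hD h
    (lle_of_selfDual k T hQ eD ((hQ.regular hF hH hFH).trans h))

/-- The self-dual element D of the right cell is a summand of F^*∘F and is not killed. -/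
theorem mult_self_ne_zero {i j : C} {F : i ⟶ j} (hF : F ∈ Q i j) : mult T Q F F ≠ 0 := by
  obtain ⟨D, hD, ⟨eD⟩, hFD, h⟩ := exists_selfDual k T hQ hF
  obtain ⟨-, ⟨r⟩⟩ := h hF (RLe.refl F)
  intro h0
  have h1 := isSumMod_selfDual k T hQ hF hF (RLe.refl F) hD eD hFD
  rw [h0] at h1
  obtain ⟨s, p, -, -, Z, f, g, hZ, h2⟩ := h1
  have h3 : f ≫ g = 𝟙 _ := by simpa using h2
  exact not_killed hD (hZ.of_retract (r.trans ⟨f, g, h3⟩))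

/-- The involution sends H^*∘F to F^*∘H and fixes the self-dual element. -/
theorem mult_comm {i j : C} {F H : i ⟶ j} (hF : F ∈ Q i j) (hH : H ∈ Q i j) (hFH : RLe F H) :
    mult T Q F H = mult T Q H F := by
  obtain ⟨D, hD, ⟨eD⟩, hFD, h⟩ := exists_selfDual k T hQ hF
  have hHF := hQ.regular hF hH hFH
  have h1 := (isSumMod_selfDual k T hQ hF hH hFH hD eD hFD).star T fun _ => killed_star k T hQ
  have h2 := h1.of_iso (T.mapComp F (T.star H) ≪≫ whiskerRightIso (T.starStar H) (T.star F)) eD.symm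
  exact isSumMod_unique k hQ hD h2 (isSumMod_selfDual k T hQ hH hF hHF hD eD (hHF.trans hFD))

theorem isSumMod_comp_right {i j l : C} {X G : i ⟶ j} {n : ℕ} (h : IsSumMod (Killed Q) X G n)
    (H : j ⟶ l) : IsSumMod (Killed Q) (X ≫ H) (G ≫ H) n := by
  have := postcomp_additive k (i := i) H
  exact h.map (postcomp i H) fun _ hZ => hZ.comp_right H

theorem isSumMod_comp_left {i j l : C} {X G : i ⟶ j} {n : ℕ} (h : IsSumMod (Killed Q) X G n)
    (H : l ⟶ i) : IsSumMod (Killed Q) (H ≫ X) (H ≫ G) n := by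
  have := precomp_additive k (l := j) H
  exact h.map (precomp j H) fun _ hZ => hZ.comp_left H

/-- F∘D is some multiple n of F. Evaluating F^*∘F∘D in two ways gives n m_{F,F} = m_{F,F} m_{D,D},
and m_{F,F} ≠ 0 cancels. -/
theorem selfDual_comp {i j : C} {F : i ⟶ j} {D : i ⟶ i} (hF : F ∈ Q i j) (hD : D ∈ Q i i)
    (eD : D ≅ T.star D) (h : RLe F D) : IsSumMod (Killed Q) (D ≫ F) F (mult T Q D D) := by
  obtain ⟨n, hn⟩ := exists_isSumMod_comp k T hQ hD hF hF (hQ.regular hF hD h) (LLe.refl F)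
  have hb := fun Z Z' : i ⟶ i => hQ.killed_biprod k (Z := Z) (Z' := Z')
  have h1 := isSumMod_selfDual k T hQ hF hF (RLe.refl F) hD eD h
  have h2 := isSumMod_selfDual k T hQ hD hD (RLe.refl D) hD eD (RLe.refl D)
  have h3 := (isSumMod_comp_right k T hQ hn (T.star F)).trans hb h1
  have h4 := ((isSumMod_comp_left k T hQ h1 D).of_iso (α_ D F (T.star F)).symm
    (whiskerLeftIso D eD)).trans hb h2
  have h5 := isSumMod_unique k hQ hD h3 h4
  rw [mul_comm, mul_left_cancel_iff_of_pos (Nat.pos_of_ne_zero (mult_self_ne_zero k T hQ hF))] at h5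
  rwa [h5] at hn

theorem comp_selfDual {i j : C} {F : i ⟶ j} {D : i ⟶ i} (hF : F ∈ Q i j) (hD : D ∈ Q i i)
    (eD : D ≅ T.star D) (h : RLe F D) :
    IsSumMod (Killed Q) (T.star F ≫ D) (T.star F) (mult T Q D D) :=
  ((selfDual_comp k T hQ hF hD eD h).star T fun _ => killed_star k T hQ).of_iso
    (T.mapComp D F ≪≫ whiskerLeftIso _ eD.symm) (Iso.refl _)

theorem star_rle_of_lle {i j : C} {F : i ⟶ j} {H : j ⟶ j} (eH : H ≅ T.star H) (h : LLe F H) :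
    RLe (T.star F) H := (h.star T).trans (.of_iso eH.symm)

/-- Both sides are the multiplicity of F in F∘F^*∘F: one bracketing passes through F^*∘F, a multiple
of G, the other through F∘F^*, a multiple of H. -/
theorem mult_mul {i j : C} {F : i ⟶ j} {H : j ⟶ j} {G : i ⟶ i} (hF : F ∈ Q i j) (hH : H ∈ Q j j)
    (hG : G ∈ Q i i) (eH : H ≅ T.star H) (eG : G ≅ T.star G) (hFH : LLe F H) (hFG : RLe F G) :
    mult T Q F F * mult T Q G G = mult T Q (T.star F) (T.star F) * mult T Q H H := by
  have hF' := star_mem k T hQ hF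
  have hb := fun Z Z' : i ⟶ j => hQ.killed_biprod k (Z := Z) (Z' := Z')
  have hFH' := star_rle_of_lle k T hQ eH hFH
  have h1 := (isSumMod_comp_right k T hQ
    (isSumMod_selfDual k T hQ hF hF (RLe.refl F) hG eG hFG) F).trans hb
    (selfDual_comp k T hQ hF hG eG hFG)
  have h2 := isSumMod_comp_left k T hQ
    (isSumMod_selfDual k T hQ hF' hF' (RLe.refl _) hH eH hFH') F
  have h3 := (comp_selfDual k T hQ hF' hH eH hFH').of_iso
    (whiskerRightIso (T.starStar F) H) (T.starStar F)
  have h4 := (h2.trans hb h3).of_iso (whiskerLeftIso F (whiskerLeftIso _ (T.starStar F)) ≪≫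
    (α_ F (T.star F) F).symm) (Iso.refl _)
  exact isSumMod_unique k hQ hF h1 h4

end StronglyRegular

end Mult

/-! ### Modules over a right cell -/

section CellModules

variable {k : Type*} [Field k] [IsAlgClosed k] {C : Type u} [Bicategory.{w, v} C]
  [∀ i j : C, Preadditive (i ⟶ j)] [∀ i j : C, Linear k (i ⟶ j)]
  [∀ i j : C, HasFiniteBiproducts (i ⟶ j)] [IsFinitary k C] {T : FiatStructure C}
  {Q : ∀ i j : C, Set (i ⟶ j)}

/-- The composition factors of `M` are among the `L'_X` with `X ≤_R F`. -/
def IsSupportedBy {i j j' : C} (F : i ⟶ j) (M : Freyd k (i ⟶ j')) : Prop :=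
  ∀ X : i ⟶ j', Indecomposable X → Freyd.dimAt X M ≠ 0 → RLe X F

namespace IsSupportedBy

variable {i j j' : C} {F : i ⟶ j} {M N : Freyd k (i ⟶ j')}

theorem of_mono (hM : IsSupportedBy F M) (f : N ⟶ M) [Mono f] : IsSupportedBy F N :=
  fun X hX h => hM X hX fun h0 => h (Nat.le_zero.1 (h0 ▸ Freyd.dimAt_le_of_mono X f))

theorem of_epi (hM : IsSupportedBy F M) (f : M ⟶ N) [Epi f] : IsSupportedBy F N :=
  fun X hX h => hM X hX fun h0 => h (Nat.le_zero.1 (h0 ▸ Freyd.dimAt_le_of_epi X f))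

include T in
theorem act (hM : IsSupportedBy F M) {l : C} (H : j' ⟶ l) :
    IsSupportedBy F ((act H).obj M) := fun X _ h => by
  rw [dimAt_act T] at h
  obtain ⟨Z, hZ, ⟨r⟩, h0⟩ := Freyd.exists_indecomposable_dimAt h
  exact (RLe.of_retract r).trans (hM Z hZ h0)

/-- If `H M ≠ 0` then `M` does not vanish on the right cell of `F` at some element
above `H^*`. -/
theorem exists_of_act_ne_zero (hQ : StronglyRegular Q) (hM : IsSupportedBy F M) (hF : F ∈ Q i j)
    {l : C} {H : j' ⟶ l} (hH : T.star H ∈ Q l j') (h : ¬ IsZero ((Fiat.act H).obj M)) :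
    ∃ Z ∈ Q i j', RLe F Z ∧ LLe (T.star H) Z ∧ Freyd.dimAt Z M ≠ 0 := by
  obtain ⟨X, hX, h1⟩ := Freyd.exists_dimAt_ne_zero h
  rw [dimAt_act T] at h1
  obtain ⟨Z, hZ, ⟨r⟩, h2⟩ := Freyd.exists_indecomposable_dimAt h1
  have h3 := hM Z hZ h2
  have h4 := LLe.of_retract r
  have h5 := hQ.mem hH hF hZ h4.jle h3.jle
  exact ⟨Z, h5, hQ.regular h5 hF h3, h4, h2⟩

theorem dimAt_killed (hM : IsSupportedBy F M) (hF : F ∈ Q i j) {N : i ⟶ j'} (hN : Killed Q N) :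
    Freyd.dimAt N M = 0 := by
  by_contra h
  obtain ⟨Z, hZ, ⟨r⟩, h0⟩ := Freyd.exists_indecomposable_dimAt h
  exact hN _ _ F hF ((JLe.of_retract r).trans (hM Z hZ h0).jle)

include T in
theorem isZero_act_of_killed (hQ : StronglyRegular Q) (hM : IsSupportedBy F M) (hF : F ∈ Q i j)
    {l : C} {N : j' ⟶ l} (hN : Killed Q N) : IsZero ((Fiat.act N).obj M) := by
  by_contra h
  obtain ⟨X, hX, h1⟩ := Freyd.exists_dimAt_ne_zero h
  rw [dimAt_act T] at h1
  obtain ⟨Z, hZ, ⟨r⟩, h2⟩ := Freyd.exists_indecomposable_dimAt h1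
  exact hQ.killed_star k T hN _ _ F hF ((LLe.of_retract r).jle.trans (hM Z hZ h2).jle)

theorem dimAt_of_isSumMod (hM : IsSupportedBy F M) (hF : F ∈ Q i j) {X Z : i ⟶ j'} {n : ℕ}
    (h : IsSumMod (Killed Q) X Z n) : Freyd.dimAt X M = n * Freyd.dimAt Z M :=
  finrank_hom_of_isSumMod k (Freyd.projF k (i ⟶ j')) h M fun _ hN =>
    Freyd.dimAt_eq_zero_iff.1 (hM.dimAt_killed hF hN)

include T in
theorem finrank_act_of_isSumMod (hQ : StronglyRegular Q) (hM : IsSupportedBy F M) (hF : F ∈ Q i j)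
    {l : C} {X Z : j' ⟶ l} {n : ℕ} (h : IsSumMod (Killed Q) X Z n) (Y : Freyd k (i ⟶ l)) :
    Module.finrank k ((Fiat.act X).obj M ⟶ Y) = n * Module.finrank k ((Fiat.act Z).obj M ⟶ Y) :=
  have : FiniteDimensional k ((actOn M).obj Z ⟶ Y) :=
    inferInstanceAs (FiniteDimensional k ((Fiat.act Z).obj M ⟶ Y))
  finrank_hom_of_isSumMod k (actOn M) h Y fun _ hN _ =>
    (hM.isZero_act_of_killed (T := T) hQ hF hN).eq_of_src _ _

end IsSupportedBy

/-- The right cell of `F` in a strongly regular cell, together with its generator. -/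
structure CellData (T : FiatStructure C) (Q : ∀ i j : C, Set (i ⟶ j)) {i j : C} (F : i ⟶ j)
    (G : i ⟶ i) (L : Freyd k (i ⟶ i)) : Prop where
  stronglyRegular : StronglyRegular Q
  mem : F ∈ Q i j
  isCellGenerator : IsCellGenerator (rightCell F) G L
  mem_generator : G ∈ Q i i
  rle : RLe F G
  selfDual : Nonempty (G ≅ T.star G)

variable {i j₀ : C} {F : i ⟶ j₀} {G : i ⟶ i} {L : Freyd k (i ⟶ i)}

/-- The two retract lemmas hold for any generator, so each one, not just the one constructed above,
is the self-dual element of its right cell. -/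
theorem IsCellGenerator.cellData (h : IsCellGenerator (rightCell F) G L) (hQ : StronglyRegular Q)
    (hF : F ∈ Q i j₀) : CellData T Q F G L := by
  have (i j : C) := StronglyRegular.idempotentComplete k i j
  have h1 {l : C} {F' : i ⟶ l} (hF' : F' ∈ Q i l) (hFF' : RLe F F') :=
    (hQ.mem_rightCell_iff hF).2 ⟨hF', hFF'⟩
  obtain ⟨r⟩ := h.retract_comp (T := T) (h1 hF (RLe.refl F))
  obtain ⟨s⟩ := h.retract_comp_star (T := T) (h1 hF (RLe.refl F))
  have hG := hQ.mem hF hF h.1 (RLe.of_retract s).jle (RLe.of_retract r).jle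
  have hFG := RLe.of_retract s
  refine ⟨hQ, hF, h, hG, hFG, ?_⟩
  obtain ⟨s⟩ := h.retract_comp_star (T := T) (h1 hG hFG)
  have hG' := hQ.star_mem k T hG
  have h1 : LLe (T.star G) G := .of_retract s
  have h2 : RLe G (T.star G) := (RLe.of_iso (T.starStar G).symm).trans (h1.star T)
  obtain ⟨e⟩ := hQ.iso_of_le k T hG hG' h2 (hQ.lregular k T hG' hG h1)
  exact ⟨e.symm⟩

namespace CellData

variable (D : CellData T Q F G L)
include D

theorem mem_rightCell {j : C} {X : i ⟶ j} (hX : X ∈ Q i j) (hFX : RLe F X) : X ∈ rightCell F j :=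
  have (i j : C) := StronglyRegular.idempotentComplete k i j
  (D.stronglyRegular.mem_rightCell_iff D.mem).2 ⟨hX, hFX⟩

theorem of_mem_rightCell {j : C} {X : i ⟶ j} (h : X ∈ rightCell F j) : X ∈ Q i j ∧ RLe F X :=
  have (i j : C) := StronglyRegular.idempotentComplete k i j
  (D.stronglyRegular.mem_rightCell_iff D.mem).1 h

theorem rle_of_rle {j : C} {X : i ⟶ j} (hX : X ∈ Q i j) (hFX : RLe F X) : RLe X G :=
  (D.stronglyRegular.regular D.mem hX hFX).trans D.rle

theorem exists_epi {j : C} {X : i ⟶ j} (hX : X ∈ Q i j) (hFX : RLe F X) :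
    ∃ p : (Freyd.projF k (i ⟶ j)).obj X ⟶ (act X).obj L, Epi p :=
  D.isCellGenerator.exists_epi (T := T) (D.mem_rightCell hX hFX)

theorem not_isZero {j : C} {X : i ⟶ j} (hX : X ∈ Q i j) (hFX : RLe F X) :
    ¬ IsZero ((act X).obj L) :=
  D.isCellGenerator.not_isZero (D.mem_rightCell hX hFX)

theorem isSimpleQuotient : IsSimpleQuotient L ((Freyd.projF k (i ⟶ i)).obj G) :=
  D.isCellGenerator.2.1

theorem simple : Simple L := D.isSimpleQuotient.1

theorem finrank_hom_generator : Module.finrank k ((act G).obj L ⟶ L) = 1 := by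
  obtain ⟨p, hp⟩ := D.exists_epi D.mem_generator D.rle
  exact Freyd.finrank_hom_simpleQuotient D.isCellGenerator.1 D.isSimpleQuotient p
    (D.not_isZero D.mem_generator D.rle)

theorem dimAt_generator : Freyd.dimAt G L = 1 :=
  Freyd.dimAt_simpleQuotient D.isCellGenerator.1 D.isSimpleQuotient

theorem supported : IsSupportedBy F L := fun X hX h => by
  obtain ⟨e⟩ := Freyd.iso_of_dimAt_ne_zero D.isCellGenerator.1 hX D.isSimpleQuotient h
  exact (RLe.of_iso e).trans (D.stronglyRegular.regular D.mem D.mem_generator D.rle)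

theorem supported_act {j : C} (X : i ⟶ j) : IsSupportedBy F ((act X).obj L) :=
  D.supported.act (T := T) X

theorem mult_ne_zero : mult T Q G G ≠ 0 :=
  D.stronglyRegular.mult_self_ne_zero k T D.mem_generator

/-- `(X^* M)(G)` is a multiple of `M(X)`. -/
theorem dimAt_act_star {j : C} {X : i ⟶ j} (hX : X ∈ Q i j) (hFX : RLe F X)
    {M : Freyd k (i ⟶ j)} (hM : IsSupportedBy F M) :
    Freyd.dimAt G ((act (T.star X)).obj M) = mult T Q G G * Freyd.dimAt X M := by
  obtain ⟨e⟩ := D.selfDual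
  rw [dimAt_act T, Freyd.dimAt_congr (whiskerLeftIso G (T.starStar X)) (Iso.refl M),
    hM.dimAt_of_isSumMod D.mem
      (D.stronglyRegular.selfDual_comp k T hX D.mem_generator e (D.rle_of_rle hX hFX))]

/-- A nonzero map N ⟶ X L is by adjunction a nonzero map from X^* N onto L, whereas (X^* N)(G) =
m_{G,G} N(X) = 0 and L(G) = 1. Subobjects of X L are thus detected at X. -/
theorem isZero_of_mono {j : C} {X : i ⟶ j} (hX : X ∈ Q i j) (hFX : RLe F X)
    {N : Freyd k (i ⟶ j)} (f : N ⟶ (act X).obj L) [Mono f] (h : Freyd.dimAt X N = 0) :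
    IsZero N := by
  by_contra hN
  have h1 : Module.finrank k (N ⟶ (act X).obj L) ≠ 0 :=
    finrank_ne_zero_iff_exists.2 ⟨f, fun h0 => hN (IsZero.of_mono_eq_zero f h0)⟩
  rw [← finrank_hom_act_star T] at h1
  obtain ⟨g, hg⟩ := finrank_ne_zero_iff_exists.1 h1
  have := D.simple
  have : Epi g := epi_of_nonzero_to_simple hg
  have h2 := Freyd.dimAt_le_of_epi G g
  rw [D.dimAt_act_star hX hFX ((D.supported_act X).of_mono f), h, D.dimAt_generator] at h2
  omega

theorem finrank_hom_act_generator (M N : Freyd k (i ⟶ i)) :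
    Module.finrank k ((act G).obj M ⟶ N) = Module.finrank k (M ⟶ (act G).obj N) := by
  obtain ⟨e⟩ := D.selfDual
  rw [finrank_hom_act T]
  exact finrank_hom_congr k (Iso.refl M) ((actIso e.symm).app N)

/-- It suffices to treat simple S. If S embeds in G L then S(G) ≠ 0, so S ≅ L, and dim Hom(L, G L) =
dim Hom(G L, L) = 1 because G is self-dual. -/
theorem finrank_hom_generator_le (M : Freyd k (i ⟶ i)) :
    Module.finrank k (M ⟶ (act G).obj L) ≤ Freyd.dimAt G M := by
  refine Freyd.finrank_hom_le_dimAt G _ (fun S hS => ?_) M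
  by_cases h : Module.finrank k (S ⟶ (act G).obj L) = 0
  · omega
  obtain ⟨f, hf⟩ := finrank_ne_zero_iff_exists.1 h
  have : Mono f := mono_of_nonzero_from_simple hf
  have h1 : Freyd.dimAt G S ≠ 0 := fun h0 =>
    Simple.not_isZero S (D.isZero_of_mono D.mem_generator D.rle f h0)
  obtain ⟨e⟩ := Freyd.simpleQuotient_unique D.isCellGenerator.1 D.isSimpleQuotient
    (Freyd.isSimpleQuotient_of_dimAt_ne_zero hS h1)
  rw [finrank_hom_congr k e.symm (Iso.refl _), ← D.finrank_hom_act_generator,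
    D.finrank_hom_generator]
  omega

/-- `dim Hom(M, X L) ≤ dim M(X)`. -/
theorem finrank_hom_le {j : C} {X : i ⟶ j} (hX : X ∈ Q i j) (hFX : RLe F X)
    {M : Freyd k (i ⟶ j)} (hM : IsSupportedBy F M) :
    Module.finrank k (M ⟶ (act X).obj L) ≤ Freyd.dimAt X M := by
  obtain ⟨e⟩ := D.selfDual
  -- The case of G, applied to X^* M. Both sides acquire the factor m_{G,G}: the left since G∘X^* is
  -- a multiple of X^*, the right since X∘G is a multiple of X.
  have h1 := D.finrank_hom_generator_le ((act (T.star X)).obj M)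
  rw [D.dimAt_act_star hX hFX hM, ← D.finrank_hom_act_generator,
    ← finrank_hom_congr k (actComp (T.star X) G M) (Iso.refl L),
    hM.finrank_act_of_isSumMod (T := T) D.stronglyRegular D.mem
      (D.stronglyRegular.comp_selfDual k T hX D.mem_generator e (D.rle_of_rle hX hFX)),
    finrank_hom_act_star T] at h1
  exact Nat.le_of_mul_le_mul_left h1 (Nat.pos_of_ne_zero D.mult_ne_zero)

theorem isSumMod_comp_star {j : C} {X Y : i ⟶ j} (hX : X ∈ Q i j) (hFX : RLe F X)
    (hY : Y ∈ Q i j) (hFY : RLe F Y) :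
    IsSumMod (Killed Q) (X ≫ T.star Y) G (mult T Q X Y) := by
  obtain ⟨e⟩ := D.selfDual
  exact D.stronglyRegular.isSumMod_selfDual k T hX hY
    ((D.stronglyRegular.regular D.mem hX hFX).trans hFY) D.mem_generator e (D.rle_of_rle hX hFX)

/-- Moving Y across the adjunction leaves Hom((Y^*∘X) L, L), which is m_{X,Y} copies of the line
Hom(G L, L). -/
theorem finrank_hom_act_act {j : C} {X Y : i ⟶ j} (hX : X ∈ Q i j) (hFX : RLe F X)
    (hY : Y ∈ Q i j) (hFY : RLe F Y) :
    Module.finrank k ((act X).obj L ⟶ (act Y).obj L) = mult T Q X Y := by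
  rw [← finrank_hom_act_star T, ← finrank_hom_congr k (actComp X (T.star Y) L) (Iso.refl L),
    D.supported.finrank_act_of_isSumMod (T := T) D.stronglyRegular D.mem
      (D.isSumMod_comp_star hX hFX hY hFY), D.finrank_hom_generator, mul_one]

theorem dimAt_act_generator {j : C} {X Y : i ⟶ j} (hX : X ∈ Q i j) (hFX : RLe F X)
    (hY : Y ∈ Q i j) (hFY : RLe F Y) : Freyd.dimAt X ((act Y).obj L) = mult T Q X Y := by
  rw [dimAt_act T, D.supported.dimAt_of_isSumMod D.mem (D.isSumMod_comp_star hX hFX hY hFY),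
    D.dimAt_generator, mul_one]

/-- Maps `0 ⟶ X` to `Y L` factor through `X L`. -/
theorem exists_factor {j : C} {X Y : i ⟶ j} (hX : X ∈ Q i j) (hFX : RLe F X)
    (hY : Y ∈ Q i j) (hFY : RLe F Y) (p : (Freyd.projF k (i ⟶ j)).obj X ⟶ (act X).obj L) [Epi p]
    (x : (Freyd.projF k (i ⟶ j)).obj X ⟶ (act Y).obj L) :
    ∃ y : (act X).obj L ⟶ (act Y).obj L, p ≫ y = x := by
  -- Composition with p is injective between two spaces that both have dimension m_{X,Y}, hence
  -- surjective.
  have h : Module.finrank k ((act X).obj L ⟶ (act Y).obj L) =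
      Module.finrank k ((Freyd.projF k (i ⟶ j)).obj X ⟶ (act Y).obj L) := by
    rw [D.finrank_hom_act_act hX hFX hY hFY, ← D.dimAt_act_generator hX hFX hY hFY, Freyd.dimAt]
  have h1 : Function.Injective (Linear.leftComp k ((act Y).obj L) p) :=
    fun a b hab => (cancel_epi p).1 hab
  exact (LinearMap.injective_iff_surjective_of_finrank_eq_finrank h).1 h1 x

end CellData

end CellModules

/-! ### Additive closures -/

section InAdd

variable {B : Type*} [Category B] [Preadditive B] {𝒮 : Set B}

theorem InAdd.exists_sum {X : B} (h : InAdd 𝒮 X) :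
    ∃ (n : ℕ) (Y : Fin n → B) (s : ∀ a, X ⟶ Y a) (t : ∀ a, Y a ⟶ X),
      (∀ a, Y a ∈ 𝒮) ∧ ∑ a, s a ≫ t a = 𝟙 X := by
  obtain ⟨n, Y, b, hY, ⟨hb⟩, ⟨r⟩⟩ := h
  refine ⟨n, Y, fun a => r.i ≫ b.π a, fun a => b.ι a ≫ r.r, hY, ?_⟩
  have h1 : r.i ≫ (∑ a, b.π a ≫ b.ι a) ≫ r.r = 𝟙 X := by
    rw [CategoryTheory.Limits.IsBilimit.total hb, Category.id_comp, r.retract]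
  simpa [Preadditive.comp_sum, Preadditive.sum_comp] using h1

variable [HasFiniteBiproducts B]

theorem inAdd_of_sum {ι : Type*} [Fintype ι] {X : B} {Y : ι → B} (s : ∀ a, X ⟶ Y a)
    (t : ∀ a, Y a ⟶ X) (hY : ∀ a, Y a ∈ 𝒮) (h : ∑ a, s a ≫ t a = 𝟙 X) : InAdd 𝒮 X := by
  let e := (Fintype.equivFin ι).symm
  refine ⟨Fintype.card ι, fun a => Y (e a), biproduct.bicone _, fun a => hY _,
    ⟨biproduct.isBilimit _⟩, ⟨⟨biproduct.lift fun a => s (e a), biproduct.desc fun a => t (e a), ?_⟩⟩⟩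
  rw [biproduct.lift_desc, e.sum_comp (fun a => s a ≫ t a), h]

theorem inAdd_of_mem {X : B} (h : X ∈ 𝒮) : InAdd 𝒮 X :=
  inAdd_of_sum (ι := Unit) (fun _ => 𝟙 X) (fun _ => 𝟙 X) (fun _ => h) (by simp)

theorem inAdd_of_isZero {X : B} (h : IsZero X) : InAdd 𝒮 X :=
  inAdd_of_sum (ι := Empty) (Y := fun _ => X) (fun a => a.elim) (fun a => a.elim)
    (fun a => a.elim) (h.eq_of_src _ _)

theorem InAdd.of_retract {X X' : B} (h : InAdd 𝒮 X) (r : Retract X' X) : InAdd 𝒮 X' := by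
  obtain ⟨n, Y, s, t, hY, h1⟩ := h.exists_sum
  refine inAdd_of_sum (fun a => r.i ≫ s a) (fun a => t a ≫ r.r) hY ?_
  have h2 : r.i ≫ (∑ a, s a ≫ t a) ≫ r.r = 𝟙 X' := by rw [h1, Category.id_comp, r.retract]
  simpa [Preadditive.comp_sum, Preadditive.sum_comp] using h2

theorem InAdd.biprod {X X' : B} (h : InAdd 𝒮 X) (h' : InAdd 𝒮 X') : InAdd 𝒮 (X ⊞ X') := by
  obtain ⟨n, Y, s, t, hY, h1⟩ := h.exists_sum
  obtain ⟨n', Y', s', t', hY', h1'⟩ := h'.exists_sum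
  refine inAdd_of_sum (ι := Fin n ⊕ Fin n') (Y := Sum.elim Y Y')
    (fun a => match a with
      | .inl a => biprod.fst ≫ s a
      | .inr a => biprod.snd ≫ s' a)
    (fun a => match a with
      | .inl a => t a ≫ biprod.inl
      | .inr a => t' a ≫ biprod.inr)
    (fun a => match a with
      | .inl a => hY a
      | .inr a => hY' a) ?_
  rw [Fintype.sum_sum_type]
  have h2 : biprod.fst ≫ (∑ a, s a ≫ t a) ≫ biprod.inl +
      biprod.snd ≫ (∑ a, s' a ≫ t' a) ≫ biprod.inr = 𝟙 (X ⊞ X') := by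
    rw [h1, h1', Category.id_comp, Category.id_comp, biprod.total]
  simpa [Preadditive.comp_sum, Preadditive.sum_comp] using h2

/-- `M` is a quotient of an object of the additive closure. -/
def IsQuotientOf (𝒮 : Set B) (M : B) : Prop := ∃ (X : B) (g : X ⟶ M), InAdd 𝒮 X ∧ Epi g

omit [HasFiniteBiproducts B] in
theorem InAdd.isQuotientOf {X : B} (h : InAdd 𝒮 X) : IsQuotientOf 𝒮 X :=
  ⟨X, 𝟙 X, h, inferInstance⟩

omit [HasFiniteBiproducts B] in
theorem IsQuotientOf.of_epi {M N : B} (h : IsQuotientOf 𝒮 M) (f : M ⟶ N) [Epi f] :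
    IsQuotientOf 𝒮 N := by
  obtain ⟨X, g, hX, hg⟩ := h
  exact ⟨X, g ≫ f, hX, epi_comp _ _⟩

omit [HasFiniteBiproducts B] in
/-- Maps out of a quotient of an object of the additive closure of `𝒮` are detected by `𝒮`. -/
theorem IsQuotientOf.eq_zero {M N : B} (h : IsQuotientOf 𝒮 M) (f : M ⟶ N)
    (hf : ∀ Y ∈ 𝒮, ∀ y : Y ⟶ M, y ≫ f = 0) : f = 0 := by
  obtain ⟨X, g, hX, hg⟩ := h
  obtain ⟨n, Y, s, t, hY, h1⟩ := hX.exists_sum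
  rw [← cancel_epi g, comp_zero, ← Category.id_comp (g ≫ f), ← h1, Preadditive.sum_comp]
  refine Finset.sum_eq_zero fun a _ => ?_
  have := hf (Y a) (hY a) (t a ≫ g)
  simp only [Category.assoc] at this ⊢
  rw [this, comp_zero]

end InAdd

/-! ### The cell 2-representation -/

section CellRepresentation

variable {k : Type*} [Field k] [IsAlgClosed k] {C : Type u} [Bicategory.{w, v} C]
  [∀ i j : C, Preadditive (i ⟶ j)] [∀ i j : C, Linear k (i ⟶ j)]
  [∀ i j : C, HasFiniteBiproducts (i ⟶ j)] [IsFinitary k C] {T : FiatStructure C}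
  {Q : ∀ i j : C, Set (i ⟶ j)}

/-- The objects `X L` for `X` in `R`. -/
abbrev cellObjects {i : C} (R : ∀ l : C, Set (i ⟶ l)) (L : Freyd k (i ⟶ i)) (j : C) :
    Set (Freyd k (i ⟶ j)) := {Y | ∃ F ∈ R j, Y = (act F).obj L}

instance freydHasFiniteBiproducts (i j : C) : HasFiniteBiproducts (Freyd k (i ⟶ j)) :=
  HasFiniteBiproducts.of_hasFiniteProducts

section

variable {i : C} {R : ∀ l : C, Set (i ⟶ l)} {L : Freyd k (i ⟶ i)} {j : C}

theorem cellProp_of_cokernel {X₁ X₀ M : Freyd k (i ⟶ j)} (f : X₁ ⟶ X₀) (g : X₀ ⟶ M)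
    (h₁ : InAdd (cellObjects R L j) X₁) (h₀ : InAdd (cellObjects R L j) X₀) (z : f ≫ g = 0)
    [Epi g] (h : ∀ {Z : Freyd k (i ⟶ j)} (t : X₀ ⟶ Z), f ≫ t = 0 → ∃ t', g ≫ t' = t) :
    cellProp R L j M :=
  ⟨X₁, X₀, f, g, z, h₁, h₀, ⟨CokernelCofork.IsColimit.ofπ' g z fun t ht =>
    ⟨(h t ht).choose, (h t ht).choose_spec⟩⟩⟩

theorem cellProp_of_inAdd {X : Freyd k (i ⟶ j)} (h : InAdd (cellObjects R L j) X) :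
    cellProp R L j X :=
  cellProp_of_cokernel (0 : (0 : Freyd k (i ⟶ j)) ⟶ X) (𝟙 X) (inAdd_of_isZero (isZero_zero _)) h
    (by simp) fun t _ => ⟨t, by simp⟩

/-- Objects of the cell 2-representation have a presentation. -/
theorem exists_presentation {M : Freyd k (i ⟶ j)} (h : cellProp R L j M) :
    ∃ (X₁ X₀ : Freyd k (i ⟶ j)) (f : X₁ ⟶ X₀) (g : X₀ ⟶ M),
      InAdd (cellObjects R L j) X₁ ∧ InAdd (cellObjects R L j) X₀ ∧ f ≫ g = 0 ∧ Epi g ∧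
      ∀ {Z : Freyd k (i ⟶ j)} (t : X₀ ⟶ Z), f ≫ t = 0 → ∃ t', g ≫ t' = t := by
  obtain ⟨X₁, X₀, f, g, z, h₁, h₀, ⟨hc⟩⟩ := h
  exact ⟨X₁, X₀, f, g, h₁, h₀, z, Cofork.IsColimit.epi hc, fun t ht =>
    ⟨hc.desc (CokernelCofork.ofπ t ht), hc.fac (CokernelCofork.ofπ t ht) WalkingParallelPair.one⟩⟩

theorem isQuotientOf_of_cellProp {M : Freyd k (i ⟶ j)} (h : cellProp R L j M) :
    IsQuotientOf (cellObjects R L j) M := by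
  obtain ⟨X₁, X₀, f, g, h₁, h₀, -, hg, -⟩ := exists_presentation h
  exact ⟨X₀, g, h₀, hg⟩

theorem cellRep_hom_zero {M N : CellRep R L j} : (0 : M ⟶ N).hom = 0 := rfl

/-- Sources in C_R are quotients of sums of objects Y L, so cancellation can be tested on maps from
these; such a map need not be a monomorphism in the ambient category. -/
theorem cellRep_mono {M N : CellRep R L j} (f : M ⟶ N)
    (h : ∀ Y ∈ cellObjects R L j, ∀ y : Y ⟶ M.obj, y ≫ f.hom = 0 → y = 0) : Mono f := by
  refine Preadditive.mono_of_cancel_zero f fun {W} g hg => ?_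
  ext
  refine (isQuotientOf_of_cellProp W.property).eq_zero _ fun Y hY y => h Y hY _ ?_
  rw [Category.assoc, ← ObjectProperty.FullSubcategory.comp_hom, hg, cellRep_hom_zero, comp_zero]

theorem cellRep_epi {M N : CellRep R L j} (f : M ⟶ N) [Epi f.hom] : Epi f :=
  (cellProp R L j).ι.epi_of_epi_map (by simpa using (inferInstance : Epi f.hom))

end

namespace CellData

variable {i j₀ : C} {F : i ⟶ j₀} {G : i ⟶ i} {L : Freyd k (i ⟶ i)} (D : CellData T Q F G L)
include D

theorem mem_cellObjects {j : C} {X : i ⟶ j} (hX : X ∈ Q i j) (hFX : RLe F X) :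
    (act X).obj L ∈ cellObjects (rightCell F) L j := ⟨X, D.mem_rightCell hX hFX, rfl⟩

theorem supported_of_isQuotientOf {j : C} {M : Freyd k (i ⟶ j)}
    (h : IsQuotientOf (cellObjects (rightCell F) L j) M) : IsSupportedBy F M := by
  obtain ⟨X, g, hX, hg⟩ := h
  refine IsSupportedBy.of_epi (M := X) (fun Z hZ h => ?_) g
  obtain ⟨x, hx⟩ := Freyd.dimAt_ne_zero_iff.1 h
  obtain ⟨n, Y, s, t, hY, h1⟩ := hX.exists_sum
  have h2 : ∃ a, x ≫ s a ≠ 0 := by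
    by_contra! h3
    refine hx ?_
    rw [← Category.comp_id x, ← h1, Preadditive.comp_sum]
    exact Finset.sum_eq_zero fun a _ => by rw [← Category.assoc, h3, zero_comp]
  obtain ⟨a, ha⟩ := h2
  obtain ⟨X', -, hX'⟩ := hY a
  have h4 := D.supported_act X'
  rw [← hX'] at h4
  exact h4 Z hZ (Freyd.dimAt_ne_zero_iff.2 ⟨_, ha⟩)

/-- Maps `0 ⟶ X` to objects generated by the `Y L` factor through `X L`. -/
theorem exists_factor_of_isQuotientOf {j : C} {X : i ⟶ j} (hX : X ∈ Q i j) (hFX : RLe F X)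
    {M : Freyd k (i ⟶ j)} (hM : IsQuotientOf (cellObjects (rightCell F) L j) M)
    (p : (Freyd.projF k (i ⟶ j)).obj X ⟶ (act X).obj L) [Epi p]
    (x : (Freyd.projF k (i ⟶ j)).obj X ⟶ M) : ∃ y : (act X).obj L ⟶ M, p ≫ y = x := by
  obtain ⟨X₀, g, hX₀, hg⟩ := hM
  obtain ⟨n, Y, s, t, hY, h1⟩ := hX₀.exists_sum
  obtain ⟨x', rfl⟩ := Freyd.proj_lift g x
  have h2 (a) : ∃ y, p ≫ y = x' ≫ s a := by
    obtain ⟨X', hX', h3⟩ := hY a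
    obtain ⟨h4, h5⟩ := D.of_mem_rightCell hX'
    generalize x' ≫ s a = z
    revert z
    rw [h3]
    exact D.exists_factor hX hFX h4 h5 p
  choose y hy using h2
  refine ⟨∑ a, y a ≫ t a ≫ g, ?_⟩
  have h3 : x' ≫ (∑ a, s a ≫ t a) ≫ g = x' ≫ g := by rw [h1, Category.id_comp]
  rw [Preadditive.comp_sum, ← h3]
  simp [Preadditive.comp_sum, Preadditive.sum_comp, reassoc_of% hy]

/-- Objects in the additive closure of the `X L` are projective relative to the objects
generated by them. -/
theorem exists_lift {j : C} {W M N : Freyd k (i ⟶ j)}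
    (hW : InAdd (cellObjects (rightCell F) L j) W)
    (hM : IsQuotientOf (cellObjects (rightCell F) L j) M) (f : M ⟶ N) [Epi f] (w : W ⟶ N) :
    ∃ w', w' ≫ f = w := by
  obtain ⟨n, Y, s, t, hY, h1⟩ := hW.exists_sum
  have h2 (a) : ∃ y, y ≫ f = t a ≫ w := by
    obtain ⟨X', hX', h3⟩ := hY a
    obtain ⟨h4, h5⟩ := D.of_mem_rightCell hX'
    obtain ⟨p, hp⟩ := D.exists_epi h4 h5
    generalize t a ≫ w = w'
    revert w'
    rw [h3]
    intro w'
    obtain ⟨x, hx⟩ := Freyd.proj_lift f (p ≫ w')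
    obtain ⟨y, rfl⟩ := D.exists_factor_of_isQuotientOf h4 h5 hM p x
    exact ⟨y, by rw [← cancel_epi p, ← hx, Category.assoc]⟩
  choose y hy using h2
  refine ⟨∑ a, s a ≫ y a, ?_⟩
  rw [Preadditive.sum_comp, ← Category.id_comp w, ← h1, Preadditive.sum_comp]
  simp [hy]

/-- A presentation of N is enlarged by a lift of M₀ ⟶ M ⟶ N to the projective Y₀, where M₀ covers M.
-/
theorem cellProp_cokernel {j : C} {M N : Freyd k (i ⟶ j)} (hM : cellProp (rightCell F) L j M)
    (hN : cellProp (rightCell F) L j N) (f : M ⟶ N) :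
    cellProp (rightCell F) L j (cokernel f) := by
  obtain ⟨M₀, q, hM₀, hq⟩ := isQuotientOf_of_cellProp hM
  obtain ⟨Y₁, Y₀, d, g, hY₁, hY₀, hdg, hg, hc⟩ := exists_presentation hN
  obtain ⟨l, hl⟩ := D.exists_lift hM₀ hY₀.isQuotientOf g (q ≫ f)
  refine cellProp_of_cokernel (biprod.desc d l) (g ≫ cokernel.π f) (hY₁.biprod hM₀) hY₀ ?_ ?_
  · ext
    · simp [reassoc_of% hdg]
    · simp [reassoc_of% hl]
  · intro Z t ht
    have h1 : d ≫ t = 0 := by simpa using congrArg (biprod.inl ≫ ·) ht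
    have h2 : l ≫ t = 0 := by simpa using congrArg (biprod.inr ≫ ·) ht
    obtain ⟨t', rfl⟩ := hc t h1
    have h3 : f ≫ t' = 0 := by
      rw [← cancel_epi q, comp_zero, ← Category.assoc, ← hl, Category.assoc, h2]
    exact ⟨cokernel.desc f t' h3, by simp⟩

/-- The ambient cokernel stays in C_R, so it vanishes for an epimorphism of C_R. -/
theorem epi_hom {j : C} {M N : CellRep (rightCell F) L j} (f : M ⟶ N) [Epi f] : Epi f.hom := by
  let Z : CellRep (rightCell F) L j := ⟨_, D.cellProp_cokernel M.property N.property f.hom⟩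
  let π : N ⟶ Z := ObjectProperty.homMk (cokernel.π f.hom)
  have h : π = 0 := by
    rw [← cancel_epi f, comp_zero]
    ext
    exact cokernel.condition f.hom
  have h1 : cokernel.π f.hom = 0 := congrArg (fun t => t.hom) h
  exact Preadditive.epi_of_cokernel_zero h1

theorem projective_of_inAdd {j : C} (W : CellRep (rightCell F) L j)
    (hW : InAdd (cellObjects (rightCell F) L j) W.obj) : Projective W where
  factors {N M} w f _ := by
    have := D.epi_hom f
    obtain ⟨w', h⟩ := D.exists_lift hW (isQuotientOf_of_cellProp N.property) f.hom w.hom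
    exact ⟨ObjectProperty.homMk w', by ext; exact h⟩

/-- `dim Hom(X L, M) = dim M(X)`. -/
theorem finrank_hom_act_eq {j : C} {X : i ⟶ j} (hX : X ∈ Q i j) (hFX : RLe F X)
    {M : Freyd k (i ⟶ j)} (hM : IsQuotientOf (cellObjects (rightCell F) L j) M) :
    Module.finrank k ((act X).obj L ⟶ M) = Freyd.dimAt X M := by
  obtain ⟨p, hp⟩ := D.exists_epi hX hFX
  exact (LinearEquiv.ofBijective (Linear.leftComp k M p) ⟨fun a b hab => (cancel_epi p).1 hab,
    D.exists_factor_of_isQuotientOf hX hFX hM p⟩).finrank_eq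

end CellData

end CellRepresentation

/-! ### Injective and simple objects of the cell 2-representation -/

section CellSimple

variable {k : Type*} [Field k] [IsAlgClosed k] {C : Type u} [Bicategory.{w, v} C]
  [∀ i j : C, Preadditive (i ⟶ j)] [∀ i j : C, Linear k (i ⟶ j)]
  [∀ i j : C, HasFiniteBiproducts (i ⟶ j)] [IsFinitary k C] {T : FiatStructure C}
  {Q : ∀ i j : C, Set (i ⟶ j)}

theorem exists_lift_of_comp_cokernel {A : Type*} [Category A] [Preadditive A] [Linear k A]
    [HasFiniteBiproducts A] [FinitaryCategory k A] {M N : Freyd k A} (f : M ⟶ N) {X : A}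
    (x : (Freyd.projF k A).obj X ⟶ N) (h : x ≫ cokernel.π f = 0) : ∃ y, y ≫ f = x := by
  obtain ⟨y, hy⟩ := Freyd.proj_lift (Abelian.factorThruImage f) (kernel.lift _ x h)
  exact ⟨y, by rw [← Abelian.image.fac f, ← Category.assoc, hy, kernel.lift_ι]⟩

namespace CellData

variable {i j₀ : C} {F : i ⟶ j₀} {G : i ⟶ i} {L : Freyd k (i ⟶ i)} (D : CellData T Q F G L)
include D

theorem isGeneratedBy_of_isSumMod {j : C} {X Z : i ⟶ j} {n : ℕ}
    (h : IsSumMod (Killed Q) X Z n) : Freyd.IsGeneratedBy ((act Z).obj L) ((act X).obj L) := by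
  obtain ⟨s, p, -, -, N, f, g, hN, h1⟩ := h
  intro W u hu
  have h0 := D.supported.isZero_act_of_killed (T := T) D.stronglyRegular D.mem hN
  have h2 : (actOn L).map (f ≫ g) = 0 := by
    rw [CategoryTheory.Functor.map_comp]
    exact (congrArg (· ≫ _) (h0.eq_of_tgt ((actOn L).map f) 0)).trans zero_comp
  rw [h1, Functor.map_sub, CategoryTheory.Functor.map_id, sub_eq_zero, Functor.map_sum] at h2
  change (actOn L).obj X ⟶ W at u
  have h3 : 𝟙 ((actOn L).obj X) ≫ u = 0 := by
    rw [h2, Preadditive.sum_comp]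
    refine Finset.sum_eq_zero fun a _ => ?_
    rw [CategoryTheory.Functor.map_comp, Category.assoc]
    exact (congrArg (_ ≫ ·) (hu ((actOn L).map (s a)))).trans comp_zero
  exact (Category.id_comp u).symm.trans h3

/-- Reduce to M = Y L: then X^* M = (X^*∘Y) L, and X^*∘Y is a multiple of G modulo 1-morphisms that
annihilate L. -/
theorem isGeneratedBy {j : C} {X : i ⟶ j} (hX : X ∈ Q i j) (hFX : RLe F X) {M : Freyd k (i ⟶ j)}
    (hM : IsQuotientOf (cellObjects (rightCell F) L j) M) :
    Freyd.IsGeneratedBy ((act G).obj L) ((act (T.star X)).obj M) := by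
  obtain ⟨X₀, g, hX₀, hg⟩ := hM
  have := act_map_epi T (T.star X) g
  refine Freyd.IsGeneratedBy.of_epi (fun W u hu => ?_) ((act (T.star X)).map g)
  obtain ⟨n, Y, s, t, hY, h1⟩ := hX₀.exists_sum
  rw [← Category.id_comp u, ← CategoryTheory.Functor.map_id, ← h1, Functor.map_sum,
    Preadditive.sum_comp]
  refine Finset.sum_eq_zero fun a _ => ?_
  rw [CategoryTheory.Functor.map_comp, Category.assoc]
  have h2 (b : (act G).obj L ⟶ (act (T.star X)).obj (Y a)) :
      b ≫ (act (T.star X)).map (t a) ≫ u = 0 := by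
    rw [← Category.assoc, hu]
  have h3 : (act (T.star X)).map (t a) ≫ u = 0 := by
    obtain ⟨X', hX', h4⟩ := hY a
    obtain ⟨h5, h6⟩ := D.of_mem_rightCell hX'
    generalize (act (T.star X)).map (t a) ≫ u = z at h2
    revert z
    rw [h4]
    intro z hz
    have h7 := D.isGeneratedBy_of_isSumMod (D.isSumMod_comp_star h5 h6 hX hFX)
    exact (h7.of_epi (actComp X' (T.star X) L).hom) z hz
  rw [h3, comp_zero]

theorem iso_of_generator_epi (S : Freyd k (i ⟶ i)) (f : (act G).obj L ⟶ S) (hS : Simple S)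
    (hf : f ≠ 0) : Nonempty (S ≅ L) := by
  obtain ⟨p, hp⟩ := D.exists_epi D.mem_generator D.rle
  have : Epi f := epi_of_nonzero_to_simple hf
  exact Freyd.simpleQuotient_unique D.isCellGenerator.1 ⟨hS, p ≫ f, epi_comp _ _⟩
    D.isSimpleQuotient

/-- `dim Hom(M, X L) = dim M(X)`. -/
theorem finrank_hom_eq {j : C} {X : i ⟶ j} (hX : X ∈ Q i j) (hFX : RLe F X) {M : Freyd k (i ⟶ j)}
    (hM : IsQuotientOf (cellObjects (rightCell F) L j) M) :
    Module.finrank k (M ⟶ (act X).obj L) = Freyd.dimAt X M := by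
  have hs := D.supported_of_isQuotientOf hM
  refine le_antisymm (D.finrank_hom_le hX hFX hs) ?_
  -- For X^* M generated by G L this reads m_{G,G} M(X) ≤ m_{G,G} dim Hom(X^* M, L), and the last
  -- space is Hom(M, X L).
  have h1 := Freyd.IsGeneratedBy.dimAt_le (L := L) D.iso_of_generator_epi
    (D.isGeneratedBy hX hFX hM) G
  rw [D.dimAt_act_star hX hFX hs, D.dimAt_act_generator D.mem_generator D.rle D.mem_generator
    D.rle, finrank_hom_act_star T] at h1
  exact Nat.le_of_mul_le_mul_left h1 (Nat.pos_of_ne_zero D.mult_ne_zero)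

/-- The functor Hom(P'_X, -) is exact along M ⟶ N ⟶ coker f: injectivity on the left follows because
maps P'_X ⟶ M factor through X L, an object of C_R. Since Hom(-, X L) has the same dimensions,
restriction along f has full rank. -/
theorem exists_extension {j : C} {X : i ⟶ j} (hX : X ∈ Q i j) (hFX : RLe F X)
    {M N : CellRep (rightCell F) L j} (f : M ⟶ N) [Mono f] (y : M.obj ⟶ (act X).obj L) :
    ∃ z, f.hom ≫ z = y := by
  have hM := isQuotientOf_of_cellProp M.property
  have hN := isQuotientOf_of_cellProp N.property
  have hc := hN.of_epi (cokernel.π f.hom)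
  obtain ⟨p, hp⟩ := D.exists_epi hX hFX
  let P := (Freyd.projF k (i ⟶ j)).obj X
  have h1 : Module.finrank k (P ⟶ N.obj) =
      Module.finrank k (P ⟶ M.obj) + Module.finrank k (P ⟶ cokernel f.hom) := by
    refine finrank_eq_add_of_exact (Linear.rightComp k P f.hom)
      (Linear.rightComp k P (cokernel.π f.hom)) ?_ (fun x => ?_) fun x => ?_
    · refine (injective_iff_map_eq_zero _).2 fun x hx => ?_
      obtain ⟨x', rfl⟩ := D.exists_factor_of_isQuotientOf hX hFX hM p x
      change (p ≫ x') ≫ f.hom = 0 at hx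
      rw [Category.assoc, ← comp_zero (f := p), cancel_epi] at hx
      let W : CellRep (rightCell F) L j :=
        ⟨_, cellProp_of_inAdd (inAdd_of_mem (D.mem_cellObjects hX hFX))⟩
      let w : W ⟶ M := ObjectProperty.homMk x'
      have hw : w = 0 := by
        rw [← cancel_mono f, zero_comp]
        ext
        exact hx
      have hw' : x' = 0 := congrArg (fun t => t.hom) hw
      rw [hw', comp_zero]
    · exact Freyd.proj_lift (cokernel.π f.hom) x
    · refine ⟨exists_lift_of_comp_cokernel f.hom x, ?_⟩
      rintro ⟨u, rfl⟩
      change (u ≫ f.hom) ≫ cokernel.π f.hom = 0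
      simp
  let φ := Linear.leftComp k ((act X).obj L) f.hom
  have h2 : Module.finrank k (N.obj ⟶ (act X).obj L) =
      Module.finrank k (cokernel f.hom ⟶ (act X).obj L) + Module.finrank k (LinearMap.range φ) := by
    refine finrank_eq_add_of_exact (Linear.leftComp k ((act X).obj L) (cokernel.π f.hom))
      φ.rangeRestrict (fun a b hab => (cancel_epi (cokernel.π f.hom)).1 hab)
      φ.surjective_rangeRestrict fun x => ?_
    rw [← Subtype.coe_inj]
    refine ⟨fun h => ⟨cokernel.desc f.hom x h, cokernel.π_desc f.hom x h⟩, ?_⟩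
    rintro ⟨u, rfl⟩
    exact (cokernel.condition_assoc f.hom u).trans zero_comp
  rw [D.finrank_hom_eq hX hFX hN, D.finrank_hom_eq hX hFX hc] at h2
  change Freyd.dimAt X N.obj = Freyd.dimAt X M.obj + Freyd.dimAt X (cokernel f.hom) at h1
  have h3 := D.finrank_hom_eq hX hFX hM
  have h4 : LinearMap.range φ = ⊤ := Submodule.eq_top_of_finrank_eq (by omega)
  exact LinearMap.range_eq_top.1 h4 y

theorem injective_of_inAdd {j : C} (W : CellRep (rightCell F) L j)
    (hW : InAdd (cellObjects (rightCell F) L j) W.obj) : Injective W where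
  factors {M N} g f _ := by
    obtain ⟨n, Y, s, t, hY, h1⟩ := hW.exists_sum
    have h2 (a) : ∃ z, f.hom ≫ z = g.hom ≫ s a := by
      obtain ⟨X', hX', h3⟩ := hY a
      obtain ⟨h4, h5⟩ := D.of_mem_rightCell hX'
      generalize g.hom ≫ s a = z
      revert z
      rw [h3]
      exact D.exists_extension h4 h5 f
    choose z hz using h2
    refine ⟨ObjectProperty.homMk (∑ a, z a ≫ t a), ?_⟩
    ext
    have h3 : g.hom ≫ ∑ a, s a ≫ t a = g.hom := by rw [h1, Category.comp_id]
    change f.hom ≫ ∑ a, z a ≫ t a = g.hom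
    rw [← h3]
    simp [Preadditive.comp_sum, reassoc_of% hz]

theorem cellProp_cokernel_of_inAdd {j : C} {X₁ P : Freyd k (i ⟶ j)}
    (hX₁ : InAdd (cellObjects (rightCell F) L j) X₁) (hP : InAdd (cellObjects (rightCell F) L j) P)
    (d : X₁ ⟶ P) : cellProp (rightCell F) L j (cokernel d) :=
  cellProp_of_cokernel d (cokernel.π d) hX₁ hP (cokernel.condition d)
    fun t ht => ⟨cokernel.desc d t ht, cokernel.π_desc _ _ _⟩

/-- The image of a morphism in the cell 2-representation. -/
theorem exists_image {j : C} {P S : Freyd k (i ⟶ j)}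
    (hP : InAdd (cellObjects (rightCell F) L j) P) (f : P ⟶ S) :
    ∃ (X₁ : Freyd k (i ⟶ j)) (d : X₁ ⟶ P) (v : cokernel d ⟶ S),
      InAdd (cellObjects (rightCell F) L j) X₁ ∧ cokernel.π d ≫ v = f ∧
      ∀ Y ∈ cellObjects (rightCell F) L j, ∀ y : Y ⟶ cokernel d, y ≫ v = 0 → y = 0 := by
  classical
  -- Choose d with d ≫ f = 0 and cokernel of least size. Adjoining a lift of a map killed by the
  -- induced v cannot shrink the cokernel further, so that map is already zero.
  have h0 : ∃ (n : ℕ) (X₁ : Freyd k (i ⟶ j)) (d : X₁ ⟶ P),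
      InAdd (cellObjects (rightCell F) L j) X₁ ∧ d ≫ f = 0 ∧ Freyd.size (cokernel d) = n :=
    ⟨_, 0, 0, inAdd_of_isZero (isZero_zero _), zero_comp, rfl⟩
  obtain ⟨X₁, d, hX₁, hd, hn⟩ := Nat.find_spec h0
  refine ⟨X₁, d, cokernel.desc d f hd, hX₁, cokernel.π_desc _ _ _, fun Y hY y hy => ?_⟩
  obtain ⟨y', rfl⟩ := D.exists_lift (inAdd_of_mem hY) hP.isQuotientOf (cokernel.π d) y
  have h1 : y' ≫ f = 0 := by simpa using hy
  let d' : X₁ ⊞ Y ⟶ P := biprod.desc d y'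
  have h2 : Nat.find h0 ≤ Freyd.size (cokernel d') :=
    Nat.find_le ⟨_, d', hX₁.biprod (inAdd_of_mem hY), by ext <;> simp [d', hd, h1], rfl⟩
  have hd' : d ≫ cokernel.π d' = 0 := by
    rw [← biprod.inl_desc d y', Category.assoc]
    exact (congrArg (_ ≫ ·) (cokernel.condition d')).trans comp_zero
  have hy' : y' ≫ cokernel.π d' = 0 := by
    rw [← biprod.inr_desc d y', Category.assoc]
    exact (congrArg (_ ≫ ·) (cokernel.condition d')).trans comp_zero
  let e : cokernel d ⟶ cokernel d' := cokernel.desc d (cokernel.π d') hd'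
  have he : Epi (cokernel.π d ≫ e) := by
    rw [cokernel.π_desc]
    infer_instance
  have : Epi e := epi_of_epi (cokernel.π d) e
  have : IsIso e := Freyd.isIso_of_epi_of_size e (by omega)
  rw [← cancel_mono e, zero_comp, Category.assoc, cokernel.π_desc, hy']

theorem cellRep_not_isZero {j : C} (S : CellRep (rightCell F) L j) (hS : Simple S) :
    ¬ IsZero S.obj := fun h =>
  Simple.not_isZero S ((IsZero.iff_id_eq_zero _).2 (by ext; exact h.eq_of_src _ _))

/-- Maps from projective objects to a simple object of the cell 2-representation factor
through any nonzero map. -/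
theorem exists_lift_of_simple {j : C} (S : CellRep (rightCell F) L j) (hS : Simple S)
    {Y W : Freyd k (i ⟶ j)} (hY : InAdd (cellObjects (rightCell F) L j) Y)
    (hW : InAdd (cellObjects (rightCell F) L j) W) (f : Y ⟶ S.obj) (hf : f ≠ 0)
    (w : W ⟶ S.obj) : ∃ t, t ≫ f = w := by
  obtain ⟨X₁, d, v, hX₁, rfl, hv⟩ := D.exists_image hY f
  let I : CellRep (rightCell F) L j := ⟨_, D.cellProp_cokernel_of_inAdd hX₁ hY d⟩
  let v' : I ⟶ S := ObjectProperty.homMk v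
  have h1 : Mono v' := cellRep_mono v' hv
  have h2 : v' ≠ 0 := fun h0 => hf (by
    have : v = 0 := congrArg (fun t => t.hom) h0
    rw [this, comp_zero])
  have h3 : IsIso v' := isIso_of_mono_of_nonzero h2
  have h4 : IsIso v := inferInstanceAs (IsIso v'.hom)
  obtain ⟨t, ht⟩ := D.exists_lift hW hY.isQuotientOf (cokernel.π d) (w ≫ inv v)
  exact ⟨t, by rw [← Category.assoc, ht, Category.assoc, IsIso.inv_hom_id, Category.comp_id]⟩

end CellData

end CellSimple

/-! ### The simple objects `L_X` of the cell 2-representation -/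

section CellSimple

variable {k : Type*} [Field k] [IsAlgClosed k] {C : Type u} [Bicategory.{w, v} C]
  [∀ i j : C, Preadditive (i ⟶ j)] [∀ i j : C, Linear k (i ⟶ j)]
  [∀ i j : C, HasFiniteBiproducts (i ⟶ j)] [IsFinitary k C] {T : FiatStructure C}
  {Q : ∀ i j : C, Set (i ⟶ j)}

theorem isIso_of_projF_map_comp {A : Type*} [Category A] [Preadditive A] [Linear k A]
    [HasFiniteBiproducts A] [FinitaryCategory k A] {X : A} (hX : Indecomposable X) {M : Freyd k A}
    {p : (Freyd.projF k A).obj X ⟶ M} (hp : p ≠ 0) (e : X ⟶ X)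
    (h : (Freyd.projF k A).map e ≫ p = p) : IsIso e := by
  have hs : ∑ b : Bool, (cond b e (𝟙 X - e)) = 𝟙 X := by simp
  obtain ⟨b, -, hb⟩ := hX.exists_isIso_of_sum k Finset.univ _ hs
  cases b
  · have h1 : IsIso (𝟙 X - e) := hb
    refine absurd ?_ hp
    rw [← cancel_epi ((Freyd.projF k A).map (𝟙 X - e)), comp_zero, Functor.map_sub,
      Preadditive.sub_comp, h]
    simp
  · exact hb

namespace CellData

variable {i j₀ : C} {F : i ⟶ j₀} {G : i ⟶ i} {L : Freyd k (i ⟶ i)} (D : CellData T Q F G L)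
include D

section

variable {j : C} {X : i ⟶ j} (hX : X ∈ Q i j) (hFX : RLe F X) {S : CellRep (rightCell F) L j}
  (hS : IsCellSimple (rightCell F) L X S)
include hX hFX hS

theorem exists_map_simple : ∃ p : (act X).obj L ⟶ S.obj, p ≠ 0 := by
  obtain ⟨h, hS, p, hp⟩ := hS
  refine ⟨p.hom, fun h0 => D.cellRep_not_isZero S hS ?_⟩
  have := D.epi_hom p
  exact IsZero.of_epi_eq_zero p.hom h0

/-- The lifting property of simple objects is transferred from the P_Y to the P'_Y, where maps come
from 1-morphisms and locality of End(X) can be used. -/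
theorem exists_map_simple_proj : ∃ p : (Freyd.projF k (i ⟶ j)).obj X ⟶ S.obj, p ≠ 0 ∧
    ∀ (Y : i ⟶ j), Y ∈ Q i j → RLe F Y → ∀ y : (Freyd.projF k (i ⟶ j)).obj Y ⟶ S.obj,
      (∃ t : Y ⟶ X, (Freyd.projF k (i ⟶ j)).map t ≫ p = y) ∧
      (y ≠ 0 → ∃ t : X ⟶ Y, (Freyd.projF k (i ⟶ j)).map t ≫ y = p) := by
  obtain ⟨f, hf⟩ := D.exists_map_simple hX hFX hS
  obtain ⟨p, hp⟩ := D.exists_epi hX hFX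
  refine ⟨p ≫ f, fun h0 => hf ?_, fun Y hY hFY y => ?_⟩
  · rwa [← comp_zero (f := p), cancel_epi] at h0
  have hSs := hS.choose_spec.1
  obtain ⟨q, hq⟩ := D.exists_epi hY hFY
  obtain ⟨g, rfl⟩ := D.exists_factor_of_isQuotientOf hY hFY (isQuotientOf_of_cellProp S.property)
    q y
  have hX' := inAdd_of_mem (D.mem_cellObjects hX hFX)
  have hY' := inAdd_of_mem (D.mem_cellObjects hY hFY)
  constructor
  · obtain ⟨t, rfl⟩ := D.exists_lift_of_simple S hSs hX' hY' f hf g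
    obtain ⟨t', ht'⟩ := Freyd.proj_lift p (q ≫ t)
    exact ⟨(Freyd.projF k (i ⟶ j)).preimage t', by
      rw [Functor.map_preimage, ← Category.assoc, ht', Category.assoc]⟩
  · intro hy
    have hg : g ≠ 0 := fun h0 => hy (by rw [h0, comp_zero])
    obtain ⟨t, rfl⟩ := D.exists_lift_of_simple S hSs hY' hX' g hg f
    obtain ⟨t', ht'⟩ := Freyd.proj_lift q (p ≫ t)
    exact ⟨(Freyd.projF k (i ⟶ j)).preimage t', by
      rw [Functor.map_preimage, ← Category.assoc, ht', Category.assoc]⟩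

/-- Every map P'_X ⟶ S is t ≫ p with t in End(X); subtract a scalar c making t - c non-invertible.
If (t - c) ≫ p were nonzero, some s would give s ≫ (t - c) ≫ p = p, making t - c invertible. -/
theorem dimAt_simple : Freyd.dimAt X S.obj = 1 := by
  obtain ⟨p, hp, h⟩ := D.exists_map_simple_proj hX hFX hS
  have hXi := D.stronglyRegular.indec hX
  refine finrank_eq_one p hp fun y => ?_
  obtain ⟨⟨t, rfl⟩, -⟩ := h X hX hFX y
  obtain ⟨c, hc⟩ := hXi.scalar_or k t
  refine ⟨c, ?_⟩
  by_contra hne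
  have h1 : (Freyd.projF k (i ⟶ j)).map (t - c • 𝟙 X) ≫ p ≠ 0 := fun h0 => hne (by
    rw [Functor.map_sub, Preadditive.sub_comp, sub_eq_zero, Functor.map_smul,
      CategoryTheory.Functor.map_id, Linear.smul_comp, Category.id_comp] at h0
    exact h0.symm)
  obtain ⟨-, h2⟩ := h X hX hFX ((Freyd.projF k (i ⟶ j)).map (t - c • 𝟙 X) ≫ p)
  obtain ⟨s, hs⟩ := h2 h1
  rw [← Category.assoc, ← CategoryTheory.Functor.map_comp] at hs
  have h3 := isIso_of_projF_map_comp hXi hp _ hs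
  refine hc (Freyd.isIso_of_section (k := k) hXi (s := inv (s ≫ (t - c • 𝟙 X)) ≫ s) ?_)
  rw [Category.assoc, IsIso.inv_hom_id]

theorem iso_of_dimAt_simple_ne_zero {Y : i ⟶ j} (hY : Y ∈ Q i j) (hFY : RLe F Y)
    (h : Freyd.dimAt Y S.obj ≠ 0) : Nonempty (X ≅ Y) := by
  obtain ⟨p, hp, h1⟩ := D.exists_map_simple_proj hX hFX hS
  obtain ⟨y, hy⟩ := Freyd.dimAt_ne_zero_iff.1 h
  obtain ⟨⟨t, rfl⟩, h2⟩ := h1 Y hY hFY y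
  obtain ⟨s, hs⟩ := h2 hy
  rw [← Category.assoc, ← CategoryTheory.Functor.map_comp] at hs
  have hXi := D.stronglyRegular.indec hX
  have h3 := isIso_of_projF_map_comp hXi hp _ hs
  exact hXi.iso_of_retract k (D.stronglyRegular.indec hY) ⟨s, t ≫ inv (s ≫ t), by
    rw [← Category.assoc, IsIso.hom_inv_id]⟩

theorem simple_supported : IsSupportedBy F S.obj :=
  D.supported_of_isQuotientOf (isQuotientOf_of_cellProp S.property)

/-- `X^* L_X ≅ P_G`. -/
theorem act_star_simple_iso : Nonempty ((act (T.star X)).obj S.obj ≅ (act G).obj L) := by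
  have hq := isQuotientOf_of_cellProp S.property
  have h1 := D.isGeneratedBy hX hFX hq
  have h2 : Module.finrank k ((act (T.star X)).obj S.obj ⟶ L) = 1 := by
    rw [finrank_hom_act_star T, D.finrank_hom_eq hX hFX hq, D.dimAt_simple hX hFX hS]
  have h3 : Freyd.dimAt G ((act (T.star X)).obj S.obj) = mult T Q G G := by
    rw [D.dimAt_act_star hX hFX (D.simple_supported hX hFX hS), D.dimAt_simple hX hFX hS, mul_one]
  obtain ⟨f, hf⟩ := finrank_ne_zero_iff_exists.1 (h2 ▸ one_ne_zero)
  have h4 : ∃ a : (act G).obj L ⟶ (act (T.star X)).obj S.obj, a ≫ f ≠ 0 := by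
    by_contra! h4
    exact hf (h1 f h4)
  obtain ⟨a, ha⟩ := h4
  -- Otherwise coker a has a simple quotient, necessarily L. The resulting map to L spans the line
  -- Hom(X^* S, L), so f is a multiple of it and vanishes on a.
  have h5 : Epi a := by
    refine Freyd.epi_of_isZero_cokernel a (by_contra fun h0 => ?_)
    obtain ⟨S', q, hS', hq'⟩ := Freyd.exists_simple_quotient h0
    have h6 : ∃ b : (act G).obj L ⟶ (act (T.star X)).obj S.obj, b ≫ cokernel.π a ≫ q ≠ 0 := by
      by_contra! h6
      have h7 := h1 _ h6
      rw [← comp_zero (f := cokernel.π a), cancel_epi] at h7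
      exact Simple.not_isZero S' (IsZero.of_epi_eq_zero q h7)
    obtain ⟨b, hb⟩ := h6
    obtain ⟨e⟩ := D.iso_of_generator_epi S' _ hS' hb
    have h8 : cokernel.π a ≫ q ≫ e.hom ≠ 0 := fun h8 => hb (by
      rw [← cancel_mono e.hom, Category.assoc, Category.assoc, h8, comp_zero, zero_comp])
    obtain ⟨c, hc⟩ := (finrank_eq_one_iff_of_nonzero' _ h8).1 h2 f
    rw [← hc, Linear.comp_smul, cokernel.condition_assoc, zero_comp, smul_zero] at ha
    exact ha rfl
  -- Source and target both have dimension m_{G,G} at G, so ker a vanishes at G; as a subobject of G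
  -- L it is zero.
  have h6 := Freyd.dimAt_kernel G a
  rw [h3, D.dimAt_act_generator D.mem_generator D.rle D.mem_generator D.rle] at h6
  have h7 := Freyd.isIso_of_isZero_kernel a
    (D.isZero_of_mono D.mem_generator D.rle (kernel.ι a) (by omega))
  exact ⟨(asIso a).symm⟩

/-- `H L_X` is zero or a direct sum of objects `Y L`. -/
theorem isZero_or_inAdd {l : C} {H : j ⟶ l} (hH : H ∈ Q j l) :
    IsZero ((act H).obj S.obj) ∨
      InAdd (cellObjects (rightCell F) L l) ((act H).obj S.obj) := by
  refine or_iff_not_imp_left.2 fun h0 => ?_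
  have hQ := D.stronglyRegular
  have hH' := hQ.star_mem k T hH
  have hX' := hQ.star_mem k T hX
  obtain ⟨Z, hZ, hFZ, hHZ, h1⟩ := (D.simple_supported hX hFX hS).exists_of_act_ne_zero
    hQ D.mem hH' h0
  -- H L_X ≠ 0 forces H^* ≤_L X, that is, H and X^* lie in the same right cell, with a common
  -- self-dual element E.
  obtain ⟨e⟩ := D.iso_of_dimAt_simple_ne_zero hX hFX hS hZ hFZ h1
  have h2 : RLe H (T.star X) := ((RLe.of_iso (T.starStar H).symm).trans (hHZ.star T)).trans
    (.of_iso (starIso T e.symm))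
  have h3 := hQ.regular hH hX' h2
  obtain ⟨E, hE, ⟨eE⟩, hXE, -⟩ := hQ.exists_selfDual k T hX'
  obtain ⟨-, ⟨r⟩⟩ := hQ.selfDual_retracts k T hX' hE eE hXE
  obtain ⟨⟨s⟩, -⟩ := hQ.selfDual_retracts k T hH hE eE (h2.trans hXE)
  -- H is a summand of H∘E, and E is a summand of X∘X^*.
  have r₁ : Retract H (T.star X ≫ X ≫ H) :=
    (s.trans (retractWhiskerRight r H)).trans (.ofIso (whiskerRightIso
      (whiskerLeftIso _ (T.starStar X)) H ≪≫ α_ _ _ _))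
  obtain ⟨e'⟩ := D.act_star_simple_iso hX hFX hS
  have r₂ : Retract ((act H).obj S.obj) ((act (G ≫ X ≫ H)).obj L) :=
    (actRetract r₁ S.obj).trans (.ofIso (actComp _ _ _ ≪≫ (act (X ≫ H)).mapIso e' ≪≫
      (actComp _ _ _).symm))
  refine InAdd.of_retract ?_ r₂
  obtain ⟨ι, _, E', hE', hs⟩ := exists_indecomposable_decomposition k (G ≫ X ≫ H)
  obtain ⟨s', p', h5, h6, h7⟩ := Freyd.IsDirectSum.map (actOn L) hs
  -- The summands in Q lie in the right cell of F and contribute objects Y L; the killed ones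
  -- annihilate L.
  have h8 (a) : E' a ∈ Q i l ∨ Killed Q (E' a) := by
    obtain ⟨s₀, p₀, h9, -⟩ := hs
    exact hQ.mem_or_killed D.mem_generator (hE' a)
      (RLe.of_retract (F := G) (H := X ≫ H) ⟨s₀ a, p₀ a, h9 a⟩).jle
  obtain ⟨_⟩ : Nonempty (Fintype {a // E' a ∈ Q i l}) := ⟨Fintype.ofFinite _⟩
  refine inAdd_of_sum (ι := {a // E' a ∈ Q i l}) (Y := fun a => (act (E' a)).obj L)
    (fun a => p' a) (fun a => s' a) (fun a => ?_) ?_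
  · obtain ⟨s₀, p₀, h9, -⟩ := hs
    exact D.mem_cellObjects a.2 (D.rle.trans (RLe.of_retract ⟨s₀ a, p₀ a, h9 a⟩))
  · classical
    refine Eq.trans ?_ h7
    rw [← Finset.sum_filter_of_ne (s := Finset.univ) (p := fun a => E' a ∈ Q i l)]
    · exact (Finset.sum_subtype (f := fun a => p' a ≫ s' a) _ (by simp)).symm
    · intro a _ ha
      refine (h8 a).resolve_right fun h9 => ha ?_
      have h10 := D.supported.isZero_act_of_killed (T := T) hQ D.mem h9
      exact (congrArg (· ≫ _) (h10.eq_of_tgt (p' a) 0)).trans zero_comp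

end

/-- The simple objects `L_X` exist. -/
theorem exists_isCellSimple {j : C} {X : i ⟶ j} (hX : X ∈ Q i j) (hFX : RLe F X) :
    ∃ S : CellRep (rightCell F) L j, IsCellSimple (rightCell F) L X S := by
  classical
  let P := (act X).obj L
  have hP : InAdd (cellObjects (rightCell F) L j) P := inAdd_of_mem (D.mem_cellObjects hX hFX)
  -- L_X is the nonzero cokernel of least size of a map from the additive closure to P_X.
  have h0 : ∃ (n : ℕ) (X₁ : Freyd k (i ⟶ j)) (d : X₁ ⟶ P),
      InAdd (cellObjects (rightCell F) L j) X₁ ∧ ¬ IsZero (cokernel d) ∧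
      Freyd.size (cokernel d) = n :=
    ⟨_, 0, 0, inAdd_of_isZero (isZero_zero _), fun h => D.not_isZero hX hFX
      (h.of_iso cokernelZeroIsoTarget.symm), rfl⟩
  obtain ⟨X₁, d, hX₁, hd, hn⟩ := Nat.find_spec h0
  let I : CellRep (rightCell F) L j := ⟨_, D.cellProp_cokernel_of_inAdd hX₁ hP d⟩
  let X₁' : CellRep (rightCell F) L j := ⟨X₁, cellProp_of_inAdd hX₁⟩
  let P' : CellRep (rightCell F) L j := ⟨P, cellProp_of_inAdd hP⟩
  let u : P' ⟶ I := ObjectProperty.homMk (cokernel.π d)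
  have hu : Epi u := by
    have : Epi u.hom := inferInstanceAs (Epi (cokernel.π d))
    exact cellRep_epi u
  refine ⟨I, P'.property, ⟨fun {M} f _ => ⟨fun h h1 => ?_, fun hf => ?_⟩⟩, u, hu⟩
  · refine hd ((IsZero.iff_id_eq_zero _).2 ?_)
    have h2 : 𝟙 I = 0 := (IsIso.inv_hom_id f).symm.trans
      ((congrArg (inv f ≫ ·) h1).trans comp_zero)
    exact congrArg (fun t => t.hom) h2
  have hMq := isQuotientOf_of_cellProp M.property
  have h1 : ∃ Y ∈ cellObjects (rightCell F) L j, ∃ y : Y ⟶ M.obj, y ≫ f.hom ≠ 0 := by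
    by_contra! h1
    exact hf (by ext; exact hMq.eq_zero f.hom h1)
  obtain ⟨Y, hY, y, hy⟩ := h1
  obtain ⟨t, ht⟩ := D.exists_lift (inAdd_of_mem hY) hP.isQuotientOf (cokernel.π d) (y ≫ f.hom)
  let d' : X₁ ⊞ Y ⟶ P := biprod.desc d t
  have hd' : d ≫ cokernel.π d' = 0 := by
    rw [← biprod.inl_desc d t, Category.assoc]
    exact (congrArg (_ ≫ ·) (cokernel.condition d')).trans comp_zero
  have ht' : t ≫ cokernel.π d' = 0 := by
    rw [← biprod.inr_desc d t, Category.assoc]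
    exact (congrArg (_ ≫ ·) (cokernel.condition d')).trans comp_zero
  let e : cokernel d ⟶ cokernel d' := cokernel.desc d (cokernel.π d') hd'
  have he : cokernel.π d ≫ e = cokernel.π d' := cokernel.π_desc _ _ _
  have he' : Epi (cokernel.π d ≫ e) := by
    rw [he]
    infer_instance
  have : Epi e := epi_of_epi (cokernel.π d) e
  have hye : (y ≫ f.hom) ≫ e = 0 := by rw [← ht, Category.assoc, he, ht']
  -- Passing from d to d' kills the nonzero map y ≫ f, so the cokernel strictly shrinks; minimality
  -- makes it zero.
  have h2 : IsZero (cokernel d') := by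
    by_contra h2
    have h3 : Nat.find h0 ≤ Freyd.size (cokernel d') :=
      Nat.find_le ⟨_, d', hX₁.biprod (inAdd_of_mem hY), h2, rfl⟩
    have : IsIso e := Freyd.isIso_of_epi_of_size e (by omega)
    rw [← zero_comp (f := e), cancel_mono] at hye
    exact hy hye
  have h3 : Epi f.hom := by
    refine Preadditive.epi_of_cancel_zero _ fun {Z} z hz => ?_
    have h4 : d' ≫ cokernel.π d ≫ z = 0 := by
      ext
      · simp [d', cokernel.condition_assoc]
      · simp only [d', biprod.inr_desc_assoc, reassoc_of% ht, comp_zero]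
        rw [hz, comp_zero]
    have h5 := Freyd.epi_of_isZero_cokernel d' h2
    rw [← comp_zero (f := d'), cancel_epi, ← comp_zero (f := cokernel.π d), cancel_epi] at h4
    exact h4
  -- The projection lifts along f, and the lift kills d because f is a monomorphism. It thus
  -- descends to a section of f.
  obtain ⟨s, hs⟩ := D.exists_lift hP hMq f.hom (cokernel.π d)
  let g : X₁' ⟶ M := ObjectProperty.homMk (d ≫ s)
  have hg : g = 0 := by
    rw [← cancel_mono f, zero_comp]
    ext
    change (d ≫ s) ≫ f.hom = 0
    rw [Category.assoc, hs, cokernel.condition]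
  have hg' : d ≫ s = 0 := congrArg (fun t => t.hom) hg
  have h4 : cokernel.desc d s hg' ≫ f.hom = 𝟙 (cokernel d) := by
    rw [← cancel_epi (cokernel.π d)]
    simp [hs]
  have : IsSplitEpi f := IsSplitEpi.mk' ⟨ObjectProperty.homMk (cokernel.desc d s hg'),
    ObjectProperty.hom_ext _ h4⟩
  exact isIso_of_mono_of_isSplitEpi f

/-! ### Dimensions -/

theorem generator_iso {H : i ⟶ i} (hH : H ∈ Q i i) (eH : H ≅ T.star H) (hFH : RLe F H) :
    Nonempty (H ≅ G) := by
  obtain ⟨e⟩ := D.selfDual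
  exact D.stronglyRegular.selfDual_unique k T D.mem_generator hH e eH
    ((D.stronglyRegular.regular D.mem D.mem_generator D.rle).trans hFH)

/-- By adjunction End(F L_H) is Hom(F^*∘F L_H, L_H), that is, m_{F,F} copies of Hom(H L_H, L_H). As
H ≅ H^*, H L_H ≅ P_G with G ≅ H, so the latter has dimension L_H(G) = 1. -/
theorem finrank_end_act_simple {H : i ⟶ i} (hH : H ∈ Q i i) (eH : H ≅ T.star H) (hFH : RLe F H)
    {S : CellRep (rightCell F) L i} (hS : IsCellSimple (rightCell F) L H S) :
    Module.finrank k ((act F).obj S.obj ⟶ (act F).obj S.obj) = mult T Q F F := by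
  have hQ := D.stronglyRegular
  obtain ⟨e⟩ := D.generator_iso hH eH hFH
  obtain ⟨e'⟩ := D.act_star_simple_iso hH hFH hS
  rw [← finrank_hom_act_star T, ← finrank_hom_congr k (actComp F (T.star F) S.obj) (Iso.refl _),
    (D.simple_supported hH hFH hS).finrank_act_of_isSumMod (T := T) hQ D.mem
      (hQ.isSumMod_selfDual k T D.mem D.mem (RLe.refl F) hH eH hFH),
    finrank_hom_congr k ((actIso eH).app S.obj ≪≫ e') (Iso.refl _),
    D.finrank_hom_act_eq D.mem_generator D.rle (isQuotientOf_of_cellProp S.property),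
    ← Freyd.dimAt_congr e (Iso.refl S.obj), D.dimAt_simple hH hFH hS, mul_one]

variable {S : CellRep (rightCell F) L j₀} (hS : IsCellSimple (rightCell F) L F S)
include hS

/-- Move H = H^* to the left: H∘F ≅ m_{H,H} F modulo the ideal, and dim Hom(P_F, L_F) = 1. -/
theorem finrank_hom_act_simple {H : j₀ ⟶ j₀} (hH : H ∈ Q j₀ j₀) (eH : H ≅ T.star H)
    (hFH : LLe F H) :
    Module.finrank k ((act F).obj L ⟶ (act H).obj S.obj) = mult T Q H H := by
  have hQ := D.stronglyRegular
  have h1 := (hQ.comp_selfDual k T (hQ.star_mem k T D.mem) hH eH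
    (hQ.star_rle_of_lle k T eH hFH)).of_iso (whiskerRightIso (T.starStar F) H) (T.starStar F)
  rw [finrank_hom_congr k (Iso.refl _) ((actIso eH).app S.obj), ← finrank_hom_act T,
    ← finrank_hom_congr k (actComp F H L) (Iso.refl _),
    D.supported.finrank_act_of_isSumMod (T := T) hQ D.mem h1,
    D.finrank_hom_act_eq D.mem (RLe.refl F) (isQuotientOf_of_cellProp S.property),
    D.dimAt_simple D.mem (RLe.refl F) hS, mul_one]

/-- Compute dim Hom(F P_G, L_F) twice. Since F∘G is m_{G,G} copies of F, it is m_{G,G}; since P_G ≅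
F^* L_F and F∘F^* is m_{F^*,F^*} copies of H, it is m_{F^*,F^*} dim Hom(H L_F, L_F). -/
theorem mult_star_dvd {H : j₀ ⟶ j₀} (hH : H ∈ Q j₀ j₀) (eH : H ≅ T.star H)
    (hFH : LLe F H) : mult T Q (T.star F) (T.star F) ∣ mult T Q G G := by
  have hQ := D.stronglyRegular
  obtain ⟨eG⟩ := D.selfDual
  have hF' := hQ.star_mem k T D.mem
  have h1 := (hQ.isSumMod_selfDual k T hF' hF' (RLe.refl _) hH eH
    (hQ.star_rle_of_lle k T eH hFH)).of_iso (whiskerLeftIso _ (T.starStar F)) (Iso.refl H)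
  obtain ⟨e⟩ := D.act_star_simple_iso D.mem (RLe.refl F) hS
  have h2 := (D.simple_supported D.mem (RLe.refl F) hS).finrank_act_of_isSumMod (T := T) hQ D.mem
    h1 S.obj
  have h3 := D.supported.finrank_act_of_isSumMod (T := T) hQ D.mem
    (hQ.selfDual_comp k T D.mem D.mem_generator eG D.rle) S.obj
  rw [D.finrank_hom_act_eq D.mem (RLe.refl F) (isQuotientOf_of_cellProp S.property),
    D.dimAt_simple D.mem (RLe.refl F) hS, mul_one] at h3
  rw [← h3, finrank_hom_congr k (actComp G F L ≪≫ (act F).mapIso e.symm ≪≫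
    (actComp (T.star F) F S.obj).symm) (Iso.refl S.obj), h2]
  exact Dvd.intro _ rfl

end CellData

end CellSimple

end Fiat

end

theorem proposition7 {k : Type*} [Field k] [IsAlgClosed k]
    {C : Type*} [Bicategory C]
    [∀ i j : C, Preadditive (i ⟶ j)] [∀ i j : C, Linear k (i ⟶ j)]
    [∀ i j : C, HasFiniteBiproducts (i ⟶ j)]
    [Fiat.IsFinitary k C] (T : Fiat.FiatStructure C)
    (Q : ∀ i j : C, Set (i ⟶ j)) (hQ : Fiat.IsStronglyRegular Q) :
    ∃ m : ∀ ⦃i j l : C⦄, (i ⟶ j) → (l ⟶ j) → ℕ,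
      -- (a)
      (∀ {i j l : C}, ∀ F ∈ Q i j, ∀ H ∈ Q l j,
        ∃ G : i ⟶ l, (G ∈ Fiat.leftCell (T.star H) i ∧ G ∈ Fiat.rightCell F l) ∧
          (∀ G' : i ⟶ l, G' ∈ Fiat.leftCell (T.star H) i → G' ∈ Fiat.rightCell F l →
            Nonempty (G' ≅ G)) ∧
          ∀ n : ℕ, Fiat.IsoMod Q (F ≫ T.star H) (Fiat.copies n G) ↔ n = m F H) ∧
      (∀ {i j : C}, ∀ F ∈ Q i j, m F F ≠ 0) ∧
      -- (b)
      (∀ {i j : C}, ∀ F ∈ Q i j, ∀ H ∈ Q i j, H ∈ Fiat.rightCell F j → m F H = m H F) ∧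
      -- (c)
      (∀ {i j : C}, ∀ F ∈ Q i j, ∀ H ∈ Q i i,
        Nonempty (H ≅ T.star H) → H ∈ Fiat.rightCell F i →
        ∀ (G : i ⟶ i) (L : Fiat.Freyd k (i ⟶ i)),
          Fiat.IsCellGenerator (Fiat.rightCell F) G L →
          m F F = Module.finrank k ((Fiat.act F).obj L ⟶ (Fiat.act F).obj L) ∧
          ∀ S : Fiat.CellRep (Fiat.rightCell F) L i,
            Fiat.IsCellSimple (Fiat.rightCell F) L H S →
            m F F = Module.finrank k
              ((Fiat.act F).obj S.obj ⟶ (Fiat.act F).obj S.obj)) ∧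
      -- (d)
      (∀ {i j : C}, ∀ F ∈ Q i j, ∀ H ∈ Q i i,
        Nonempty (H ≅ T.star H) → H ∈ Fiat.rightCell F i →
        Fiat.IsoMod Q (H ≫ F) (Fiat.copies (m H H) F) ∧
        Fiat.IsoMod Q (T.star F ≫ H) (Fiat.copies (m H H) (T.star F))) ∧
      -- (e)
      (∀ {i j : C}, ∀ F ∈ Q i j, ∀ H ∈ Q j j,
        Nonempty (H ≅ T.star H) → H ∈ Fiat.leftCell F j →
        ∀ (G : i ⟶ i) (L : Fiat.Freyd k (i ⟶ i)),
          Fiat.IsCellGenerator (Fiat.rightCell F) G L →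
          ∀ S : Fiat.CellRep (Fiat.rightCell F) L j,
            Fiat.IsCellSimple (Fiat.rightCell F) L F S →
            m H H = Module.finrank k ((Fiat.act F).obj L ⟶ (Fiat.act H).obj S.obj)) ∧
      -- (f)
      (∀ {i j : C}, ∀ F ∈ Q i j, ∀ H ∈ Q j j, ∀ G ∈ Q i i,
        Nonempty (H ≅ T.star H) → Nonempty (G ≅ T.star G) →
        H ∈ Fiat.leftCell F j → G ∈ Fiat.rightCell F i →
        m F F * m G G = m (T.star F) (T.star F) * m H H) ∧
      -- the cell 2-representation of the right cell of `F`: the objects `G_R`, `L_F` exist,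
      -- `P_F` is injective, `F^* L_F ≅ P_{G_R}`, `H L_F` is zero or projective and injective
      (∀ {i j : C}, ∀ F ∈ Q i j,
        (∃ (G : i ⟶ i) (L : Fiat.Freyd k (i ⟶ i)),
          Fiat.IsCellGenerator (Fiat.rightCell F) G L) ∧
        ∀ (G : i ⟶ i) (L : Fiat.Freyd k (i ⟶ i)),
          Fiat.IsCellGenerator (Fiat.rightCell F) G L →
          (∃ S : Fiat.CellRep (Fiat.rightCell F) L j,
            Fiat.IsCellSimple (Fiat.rightCell F) L F S) ∧
          (∃ h : Fiat.cellProp (Fiat.rightCell F) L j ((Fiat.act F).obj L),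
            Injective (⟨(Fiat.act F).obj L, h⟩ : Fiat.CellRep (Fiat.rightCell F) L j)) ∧
          ∀ S : Fiat.CellRep (Fiat.rightCell F) L j,
            Fiat.IsCellSimple (Fiat.rightCell F) L F S →
            Nonempty ((Fiat.act (T.star F)).obj S.obj ≅ (Fiat.act G).obj L) ∧
            ∀ {l : C}, ∀ H ∈ Q j l,
              IsZero ((Fiat.act H).obj S.obj) ∨
              ∃ h : Fiat.cellProp (Fiat.rightCell F) L l ((Fiat.act H).obj S.obj),
                Projective
                  (⟨(Fiat.act H).obj S.obj, h⟩ : Fiat.CellRep (Fiat.rightCell F) L l) ∧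
                Injective
                  (⟨(Fiat.act H).obj S.obj, h⟩ : Fiat.CellRep (Fiat.rightCell F) L l)) ∧
      -- divisibility
      (∀ {i j : C}, ∀ F ∈ Q i j, ∀ H ∈ Q j j,
        Nonempty (H ≅ T.star H) → F ∈ Fiat.leftCell H i → m F F ∣ m H H) := by
  have hs := fun i j : C => Fiat.StronglyRegular.idempotentComplete k i j
  have hQ' := hQ.stronglyRegular
  have hr {i j l : C} {F : i ⟶ j} {G : i ⟶ l} (hF : F ∈ Q i j) (h : G ∈ Fiat.rightCell F l) :
      G ∈ Q i l ∧ Fiat.RLe F G := (hQ'.mem_rightCell_iff hF).1 h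
  refine ⟨Fiat.mult T Q, fun F hF H hH => ?_, fun F hF => hQ'.mult_self_ne_zero k T hF,
    fun F hF H hH h => hQ'.mult_comm k T hF hH (hr hF h).2, ?_, ?_, ?_, ?_, ?_, ?_⟩
  · have hH' := hQ'.star_mem k T hH
    obtain ⟨G, hG, h1, h2⟩ := hQ'.inter F (T.star H) hF hH'
    refine ⟨G, ⟨(hQ'.mem_leftCell_iff k T hH').2 ⟨hG, h2⟩, (hQ'.mem_rightCell_iff hF).2 ⟨hG, h1⟩⟩,
      fun G' h3 h4 => ?_, fun n => Fiat.isoMod_iff k hQ' hG (hQ'.isSumMod_mult k T hF hH hG h1 h2) n⟩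
    obtain ⟨hG', h3⟩ := (hQ'.mem_leftCell_iff k T hH').1 h3
    exact hQ'.iso_of_le k T hG hG' ((hQ'.regular hF hG h1).trans (hr hF h4).2)
      ((hQ'.lregular k T hH' hG h2).trans h3)
  · rintro i j F hF H hH ⟨e⟩ hFH G L hL
    have D : Fiat.CellData T Q F G L := hL.cellData hQ' hF
    refine ⟨(D.finrank_hom_act_act hF (.refl F) hF (.refl F)).symm, fun S hS => ?_⟩
    exact (D.finrank_end_act_simple hH e (hr hF hFH).2 hS).symm
  · rintro i j F hF H hH ⟨e⟩ hFH
    have h := (hr hF hFH).2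
    exact ⟨(Fiat.isoMod_iff k hQ' hF (hQ'.selfDual_comp k T hF hH e h) _).2 rfl,
      (Fiat.isoMod_iff k hQ' (hQ'.star_mem k T hF) (hQ'.comp_selfDual k T hF hH e h) _).2 rfl⟩
  · rintro i j F hF H hH ⟨e⟩ hFH G L hL S hS
    have D : Fiat.CellData T Q F G L := hL.cellData hQ' hF
    exact (D.finrank_hom_act_simple hS hH e ((hQ'.mem_leftCell_iff k T hF).1 hFH).2).symm
  · rintro i j F hF H hH G hG ⟨eH⟩ ⟨eG⟩ hFH hFG
    exact hQ'.mult_mul k T hF hH hG eH eG ((hQ'.mem_leftCell_iff k T hF).1 hFH).2 (hr hF hFG).2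
  · intro i j F hF
    refine ⟨hQ'.exists_generator k T hF, fun G L hL => ?_⟩
    have D : Fiat.CellData T Q F G L := hL.cellData hQ' hF
    have hP := Fiat.inAdd_of_mem (D.mem_cellObjects hF (.refl F))
    refine ⟨D.exists_isCellSimple hF (.refl F), ⟨Fiat.cellProp_of_inAdd hP,
      D.injective_of_inAdd _ hP⟩, fun S hS => ⟨D.act_star_simple_iso hF (.refl F) hS,
      fun {l} H hH => (D.isZero_or_inAdd hF (.refl F) hS hH).imp_right fun h =>
        ⟨Fiat.cellProp_of_inAdd h, D.projective_of_inAdd _ h, D.injective_of_inAdd _ h⟩⟩⟩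
  · rintro i j F hF H hH ⟨e⟩ hHF
    obtain ⟨-, h1⟩ := (hQ'.mem_leftCell_iff k T hH).1 hHF
    have hFH := hQ'.lregular k T hH hF h1
    obtain ⟨G, L, hL⟩ := hQ'.exists_generator k T hF
    have D : Fiat.CellData T Q F G L := hL.cellData hQ' hF
    obtain ⟨S, hS⟩ := D.exists_isCellSimple hF (.refl F)
    obtain ⟨eG⟩ := D.selfDual
    obtain ⟨x, hx⟩ := D.mult_star_dvd hS hH e hFH
    have h2 := hQ'.mult_mul k T hF hH D.mem_generator e eG hFH D.rle
    -- Substituting m_{G,G} = m_{F^*,F^*} x into m_{F,F} m_{G,G} = m_{F^*,F^*} m_{H,H} and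
    -- cancelling m_{F^*,F^*} ≠ 0 leaves m_{H,H} = m_{F,F} x.
    rw [hx, mul_left_comm] at h2
    exact ⟨x, (Nat.eq_of_mul_eq_mul_left
      (Nat.pos_of_ne_zero (hQ'.mult_self_ne_zero k T (hQ'.star_mem k T hF))) h2).symm⟩
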